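/- Let $n,k,l$ be integers with $k\ge 2$ and $0\le l<k<n$. Write $\sigma_j$ for the $j$-th elementary symmetric function ($\sigma_0=1$) and $\Gamma_j=\{\lambda:\sigma_i(\lambda)>0,\ 1\le i\le j\}$. Let $\Omega\subset\mathbb{R}^n$ be a bounded domain with $\partial\Omega\in C^{2,1}$ which is uniformly $k$-convex: there is a constant $K>0$ such that $(\kappa^b_1(x),\dots,\kappa^b_{n-1}(x),K)\in\Gamma_{k+1}$ for every $x\in\partial\Omega$, where $\kappa^b_1(x),\dots,\kappa^b_{n-1}(x)$ are the principal curvatures of $\partial\Omega$ at $x$ with respect to the interior normal. For a $C^2$ function $u$ put $g_{ij}=\delta_{ij}+u_iu_j$, $h_{ij}=u_{ij}/\sqrt{1+|Du|^2}$, $\nu=(-Du,1)/\sqrt{1+|Du|^2}$, let $\kappa=(\kappa_1,\dots,\kappa_n)$ be the eigenvalues of $g^{-1}h$ (the principal curvatures of the graph of $u$), $H=\sum_i\kappa_i$, $\eta_{ij}=Hg_{ij}-h_{ij}$, and let $\lambda(\eta)$ be the eigenvalues of $g^{-1}\eta$. Call $u$ admissible if at every point of $\Omega$ the vector with entries $\sum_{j\ne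 i}\kappa_j$, $1\le i\le n$, lies in $\Gamma_k$. Then for all real $M_1,M_2$ there is a constant $C>0$, depending only on $n,k,l,M_1,M_2$ and $\Omega$, with the following property. Let $\psi=\psi(x,z,\nu)\ge 0$ on $\overline\Omega\times\mathbb{R}\times\mathbb{S}^n$ satisfy $\psi^{1/(k-l)}\in C^1(\overline\Omega\times\mathbb{R}\times\mathbb{S}^n)$, and let $u\in C^3(\overline\Omega)$ be an admissible solution of $$\frac{\sigma_k}{\sigma_l}(\lambda(\eta))=\psi(x,u,\nu)\ \text{ in }\Omega,\qquad u=0\ \text{ on }\partial\Omega,$$ such that $|u|\le M_1$ and $|Du|\le M_1$ in $\Omega$, and such that $\psi^{1/(k-l)}$ and its first derivatives are bounded by $M_2$ on $\Omega\times[-M_1,M_1]\times\mathbb{S}^n$. Then $$\max_{\partial\Omega}|D^2u|\le C.$$ -/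

import Mathlib

noncomputable section

namespace HessianQuotient

/-- Euclidean space of dimension `n`. -/
abbrev E (n : ℕ) : Type := EuclideanSpace ℝ (Fin n)

/-- The multiset of real eigenvalues of a matrix, repeated according to algebraic multiplicity. -/
def eigen {n : ℕ} (A : Matrix (Fin n) (Fin n) ℝ) : Multiset ℝ :=
  A.charpoly.roots

/-- Membership of a vector, given by the multiset of its entries, in the Garding cone: the first
`k` elementary symmetric functions are positive. -/
def InGamma (k : ℕ) (s : Multiset ℝ) : Prop :=
  ∀ i : ℕ, 1 ≤ i → i ≤ k → 0 < s.esymm i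

/-- From the entries `κ₁, …, κₙ` to the entries `∑_{j ≠ i} κⱼ = (∑ⱼ κⱼ) - κᵢ`. -/
def complementarySums (s : Multiset ℝ) : Multiset ℝ :=
  s.map (fun t => s.sum - t)

/-- The cone of curvature vectors whose complementary sums lie in the Garding cone. -/
def InGammaTilde (k : ℕ) (s : Multiset ℝ) : Prop :=
  InGamma k (complementarySums s)

section Graph

variable {n : ℕ}

/-- The partial derivative of `u` in the `i`-th coordinate direction. -/
def partialDeriv (u : E n → ℝ) (x : E n) (i : Fin n) : ℝ :=
  fderiv ℝ u x (EuclideanSpace.single i 1)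

/-- The matrix of second partial derivatives of `u`. -/
def hessian (u : E n → ℝ) (x : E n) : Matrix (Fin n) (Fin n) ℝ :=
  Matrix.of fun i j =>
    iteratedFDeriv ℝ 2 u x ![EuclideanSpace.single i 1, EuclideanSpace.single j 1]

/-- `√(1 + |Du|²)`. -/
def areaFactor (u : E n → ℝ) (x : E n) : ℝ :=
  Real.sqrt (1 + ∑ i, partialDeriv u x i ^ 2)

/-- The first fundamental form `δᵢⱼ + uᵢ uⱼ` of the graph of `u`. -/
def firstForm (u : E n → ℝ) (x : E n) : Matrix (Fin n) (Fin n) ℝ :=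
  1 + Matrix.of fun i j => partialDeriv u x i * partialDeriv u x j

/-- The second fundamental form `uᵢⱼ / √(1 + |Du|²)` of the graph of `u`, with respect to the
upward unit normal. -/
def secondForm (u : E n → ℝ) (x : E n) : Matrix (Fin n) (Fin n) ℝ :=
  (areaFactor u x)⁻¹ • hessian u x

/-- The upward unit normal `(-Du, 1) / √(1 + |Du|²)` of the graph of `u`. -/
def unitNormal (u : E n → ℝ) (x : E n) : E (n + 1) :=
  WithLp.toLp 2
    (Fin.snoc (α := fun _ => ℝ) (fun i => -partialDeriv u x i / areaFactor u x)
      (1 / areaFactor u x))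

/-- The principal curvatures of the graph of `u`. -/
def graphCurvatures (u : E n → ℝ) (x : E n) : Multiset ℝ :=
  eigen ((firstForm u x)⁻¹ * secondForm u x)

/-- The mean curvature of the graph of `u`, the sum of its principal curvatures. -/
def meanCurvature (u : E n → ℝ) (x : E n) : ℝ :=
  ((firstForm u x)⁻¹ * secondForm u x).trace

/-- The tensor `ηᵢⱼ = H gᵢⱼ - hᵢⱼ` of the graph of `u`. -/
def etaForm (u : E n → ℝ) (x : E n) : Matrix (Fin n) (Fin n) ℝ :=
  meanCurvature u x • firstForm u x - secondForm u x

/-- The eigenvalues of `g⁻¹ η` on the graph of `u`. -/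
def etaEigen (u : E n → ℝ) (x : E n) : Multiset ℝ :=
  eigen ((firstForm u x)⁻¹ * etaForm u x)

/-- `u` is admissible in `Ω`: the principal curvatures of its graph lie in the cone
`InGammaTilde k` at every point. -/
def Admissible (k : ℕ) (Ω : Set (E n)) (u : E n → ℝ) : Prop :=
  ∀ x ∈ Ω, InGammaTilde k (graphCurvatures u x)

/-- `u` solves the Dirichlet problem `σₖ/σₗ (λ(η)) = ψ(x, u, ν)` in `Ω`, `u = 0` on `∂Ω`. -/
def SolvesDirichlet (k l : ℕ) (Ω : Set (E n)) (ψ : E n → ℝ → E (n + 1) → ℝ)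
    (u : E n → ℝ) : Prop :=
  (∀ x ∈ Ω, (etaEigen u x).esymm k / (etaEigen u x).esymm l = ψ x (u x) (unitNormal u x)) ∧
    ∀ x ∈ frontier Ω, u x = 0

end Graph

section Boundary

variable {n : ℕ}

/-- Near `p` (and in the Euclidean coordinates `x = p + T (y, t)`, with `y` in dimension `n - 1`),
the set `Ω` is the region `t > ρ y` above the graph of a `C^{2,1}` function `ρ` that vanishes
together with its gradient at the origin. So `T (0, 1)` is the interior normal at `p`. -/
structure IsBoundaryGraph (Ω : Set (E n)) (p : E n)
    (T : WithLp 2 (E (n - 1) × ℝ) ≃ₗᵢ[ℝ] E n) (ρ : E (n - 1) → ℝ) (r : ℝ) : Prop where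
  pos : 0 < r
  value : ρ 0 = 0
  gradient : fderiv ℝ ρ 0 = 0
  smooth : ContDiffOn ℝ 2 ρ (Metric.ball 0 r)
  lipschitz : ∃ L : ℝ, ∀ y ∈ Metric.ball (0 : E (n - 1)) r, ∀ z ∈ Metric.ball (0 : E (n - 1)) r,
    ‖iteratedFDeriv ℝ 2 ρ y - iteratedFDeriv ℝ 2 ρ z‖ ≤ L * ‖y - z‖
  region : ∀ y ∈ Metric.ball (0 : E (n - 1)) r, ∀ t : ℝ, |t| < r →
    (p + T (WithLp.toLp 2 (y, t)) ∈ Ω ↔ ρ y < t)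

/-- The boundary of `Ω` is of class `C^{2,1}`. -/
def HasC21Boundary (Ω : Set (E n)) : Prop :=
  ∀ p ∈ frontier Ω, ∃ (T : WithLp 2 (E (n - 1) × ℝ) ≃ₗᵢ[ℝ] E n) (ρ : E (n - 1) → ℝ) (r : ℝ),
    IsBoundaryGraph Ω p T ρ r

/-- `s` is the multiset of the principal curvatures of `∂Ω` at `p` with respect to the interior
normal (positive for a round ball): the eigenvalues at the origin of the Hessian of a graph
representation over the tangent plane. They do not depend on the representation. -/
def HasBoundaryCurvatures (Ω : Set (E n)) (p : E n) (s : Multiset ℝ) : Prop :=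
  ∃ (T : WithLp 2 (E (n - 1) × ℝ) ≃ₗᵢ[ℝ] E n) (ρ : E (n - 1) → ℝ) (r : ℝ),
    IsBoundaryGraph Ω p T ρ r ∧ s = eigen (hessian ρ 0)

/-- Uniform `k`-convexity, for `k < n`: for one constant `K > 0`, the vector
`(κ₁, …, κₙ₋₁, K)` lies in the Garding cone of index `k + 1` at every boundary point. -/
def UniformlyConvex (k : ℕ) (Ω : Set (E n)) : Prop :=
  ∃ K : ℝ, 0 < K ∧ ∀ p ∈ frontier Ω, ∃ s : Multiset ℝ,
    HasBoundaryCurvatures Ω p s ∧ InGamma (k + 1) (K ::ₘ s)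

end Boundary

section Data

variable {n : ℕ}

/-- The extension of a function of `(x, z, ν)`, `ν` in the unit sphere of dimension `n`, that is
constant along rays in the last variable. It only uses the values at unit vectors `ν`, and its
derivative in the last variable at a unit vector is the tangential derivative along the sphere. -/
def rayExtension (f : E n → ℝ → E (n + 1) → ℝ) (q : E n × ℝ × E (n + 1)) : ℝ :=
  f q.1 q.2.1 (‖q.2.2‖⁻¹ • q.2.2)

/-- `f` is of class `C^1` on the product of the closure of `Ω`, the line and the unit sphere. -/
def IsC1Data (Ω : Set (E n)) (f : E n → ℝ → E (n + 1) → ℝ) : Prop :=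
  ContDiffOn ℝ 1 (rayExtension f) (closure Ω ×ˢ (Set.univ ×ˢ {0}ᶜ))

/-- `f` and its first derivatives are bounded by `B` for `x` in `Ω`, `|z| ≤ R` and unit `ν`. -/
def C1DataBound (Ω : Set (E n)) (R B : ℝ) (f : E n → ℝ → E (n + 1) → ℝ) : Prop :=
  ∀ x ∈ Ω, ∀ z : ℝ, |z| ≤ R → ∀ ν : E (n + 1), ‖ν‖ = 1 →
    |f x z ν| ≤ B ∧ ‖fderiv ℝ (rayExtension f) (x, z, ν)‖ ≤ B

/-- `u` and its gradient are bounded by `B` in `Ω`. -/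
def C1Bound (Ω : Set (E n)) (B : ℝ) (u : E n → ℝ) : Prop :=
  ∀ x ∈ Ω, |u x| ≤ B ∧ ‖fderiv ℝ u x‖ ≤ B

/-- The power `ψ^{1/m}` of a nonnegative function. -/
def rootData (m : ℕ) (ψ : E n → ℝ → E (n + 1) → ℝ) : E n → ℝ → E (n + 1) → ℝ :=
  fun x z ν => ψ x z ν ^ (1 / (m : ℝ))

end Data

end HessianQuotient

end

/-!
The proof rests on two facts about the equation, both consequences of `k < n`.

*Uniform ellipticity.* Write the equation as `F(κ) = ψ ^ (1 / (k - l))`, where `F(κ)` is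
`(σₖ / σₗ) ^ (1 / (k - l))` of the sums `∑_{j ≠ i} κⱼ`. By the Marcus-Lopes inequality
(`marcus_lopes`) the logarithmic derivative of `σₖ / σₗ` is nonnegative in all directions of the
Garding cone (`logRatioDeriv_nonneg`). For `k < n` this cone contains the vectors with all entries
`1` but one entry slightly negative (`posTo_update`), so no partial derivative of `log (σₖ / σₗ)`
exceeds a multiple of the sum of the others (`logGrad_le_sum`). In terms of `κ` each partial
derivative is replaced by the sum of the others, hence all of them are comparable
(`weight_bounds`). After division by their sum, which is bounded below relative to `F`
(`sum_logGrad_ge`), the linearized operator `L` has bounds that do not depend on a positive lower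
bound for `ψ`. Euler's identity and mean convexity bound `L^{ij} uᵢⱼ` from above and
`g^{ij} uᵢⱼ` from below. The differentiated equation bounds `L^{ij} u_{ijα}` by
`C (|α| + (1 + |D²u|) |D²u α|)` (`exists_uniform_linearization`).

*Growth.* If all second derivatives `D²u τ` with `τ` in a hyperplane are known, the remaining one
`u_νν` is bounded above through `L` and below through `g⁻¹`, so that
`|D²u| ≤ C (1 + ∑_β |D²u τ_β|)` (`norm_le_of_elliptic`).

At a boundary point `q` the tangential second derivatives come from differentiating `u = 0` twice
along `∂Ω` (`GraphChart.hessUp_tang_tang`). For the mixed ones, take a direction `e` tangent at `q`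
and extend it to an affine field that is tangent to `∂Ω` up to second order, and let `Q` be the
derivative of `u` along this field plus `∑_β (D_{τ_β} u)²`, where the `τ_β` are tangent at `q`. The
squares contribute `2 c ∑_β |D²u τ_β|²` to `L^{ij} Q_{ij}`, which by the growth estimate dominates
`c' |D²u|²` and therefore all terms linear in `D²u`. The third derivatives enter in the direction
`α` for which `DQ = D²u α + O(1)`, so that by the differentiated equation they are bounded by
`C (1 + |D²u|) (1 + |DQ|)`. The result is `L^{ij} Q_{ij} ≥ -C₂ - A c |DQ|²`
(`exists_test_constants`), and passing to `exp (A Q)` removes the quadratic term. Comparison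
(`exp_le_of_boundary`) with `1 + A v`, where `v = a |x - q|² + b (d - N d²)` and `d` is the height
above the boundary graph, gives `Q ≤ v` near `q`. Both sides vanish at `q`, hence
`u_{eν}(q) ≤ b` (`exists_mixed_bound`), and the same with `-e`. The growth estimate, which extends
to the boundary by continuity, bounds `u_νν` (`exists_boundary_bound`).

All constants depend on `Ω` only through the radius and the `C^{2,1}` norm of charts of `∂Ω`, which
are uniform by compactness (`HasC21Boundary.exists_uniform_charts`).
-/

noncomputable section

namespace HessianQuotient

/-! ### Elementary symmetric functions and Newton's inequality -/

section Esym

variable {ι : Type*}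

/-- The `k`-th elementary symmetric function of the numbers `x i`, `i ∈ s`. -/
def esym (s : Finset ι) (x : ι → ℝ) (k : ℕ) : ℝ :=
  ∑ t ∈ s.powersetCard k, ∏ i ∈ t, x i

theorem esym_eq_multiset_esymm (s : Finset ι) (x : ι → ℝ) (k : ℕ) :
    (s.val.map x).esymm k = esym s x k :=
  Finset.esymm_map_val x s k

@[simp]
theorem esym_zero (s : Finset ι) (x : ι → ℝ) : esym s x 0 = 1 := by
  simp [esym]

theorem esym_empty_succ (x : ι → ℝ) (k : ℕ) : esym ∅ x (k + 1) = 0 := by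
  simp only [esym]
  rw [Finset.powersetCard_eq_empty.2 (by simp)]
  simp

theorem esym_congr {s : Finset ι} {x y : ι → ℝ} (h : ∀ i ∈ s, x i = y i) (k : ℕ) :
    esym s x k = esym s y k := by
  refine Finset.sum_congr rfl fun t ht => Finset.prod_congr rfl fun i hi => ?_
  exact h i ((Finset.mem_powersetCard.1 ht).1 hi)

theorem esym_const (s : Finset ι) (c : ℝ) (k : ℕ) :
    esym s (fun _ => c) k = (s.card.choose k) * c ^ k := by
  unfold esym
  rw [Finset.sum_congr rfl (g := fun _ => c ^ k), Finset.sum_const, Finset.card_powersetCard,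
    nsmul_eq_mul]
  intro t ht
  rw [Finset.prod_const, (Finset.mem_powersetCard.1 ht).2]

theorem prod_X_add_C_coeff_esym (s : Finset ι) (x : ι → ℝ) {j : ℕ} (hj : j ≤ s.card) :
    (∏ i ∈ s, (Polynomial.X + Polynomial.C (x i))).coeff j = esym s x (s.card - j) := by
  have := Multiset.prod_X_add_C_coeff (s.val.map x) (k := j) (by simpa using hj)
  rw [Multiset.map_map] at this
  simpa [esym_eq_multiset_esymm] using this

variable [DecidableEq ι]

theorem esym_insert {a : ι} {s : Finset ι} (ha : a ∉ s) (x : ι → ℝ) (k : ℕ) :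
    esym (insert a s) x (k + 1) = esym s x (k + 1) + x a * esym s x k := by
  unfold esym
  rw [Finset.powersetCard_succ_insert ha, Finset.sum_union, Finset.sum_image, Finset.mul_sum]
  · congr 1
    refine Finset.sum_congr rfl fun t ht => ?_
    rw [Finset.prod_insert]
    exact fun h => ha ((Finset.mem_powersetCard.1 ht).1 h)
  · intro t ht t' ht' h
    have h1 : a ∉ t := fun h => ha ((Finset.mem_powersetCard.1 ht).1 h)
    have h2 : a ∉ t' := fun h => ha ((Finset.mem_powersetCard.1 ht').1 h)
    rw [← Finset.erase_insert h1, ← Finset.erase_insert h2, h]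
  · rw [Finset.disjoint_left]
    intro t ht ht'
    obtain ⟨t', -, rfl⟩ := Finset.mem_image.1 ht'
    exact ha ((Finset.mem_powersetCard.1 ht).1 (Finset.mem_insert_self _ _))

theorem esym_eq_erase {i : ι} {s : Finset ι} (hi : i ∈ s) (x : ι → ℝ) (k : ℕ) :
    esym s x (k + 1) = esym (s.erase i) x (k + 1) + x i * esym (s.erase i) x k := by
  conv_lhs => rw [← Finset.insert_erase hi]
  exact esym_insert (Finset.notMem_erase i s) x k

/-- The derivative of `esym s · k` at `x` in the direction `v`. -/
def desym (s : Finset ι) (x v : ι → ℝ) : ℕ → ℝ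
  | 0 => 0
  | k + 1 => ∑ i ∈ s, v i * esym (s.erase i) x k

theorem desym_insert {a : ι} {s : Finset ι} (ha : a ∉ s) (x v : ι → ℝ) (k : ℕ) :
    desym (insert a s) x v (k + 1) =
      desym s x v (k + 1) + (v a * esym s x k + x a * desym s x v k) := by
  have key : ∀ i ∈ s, (insert a s).erase i = insert a (s.erase i) := fun i hi =>
    Finset.erase_insert_of_ne (by rintro rfl; exact ha hi)
  have hn : ∀ i, a ∉ s.erase i := fun i h => ha (Finset.mem_of_mem_erase h)
  cases k with
  | zero =>
    simp only [desym, esym_zero]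
    rw [Finset.sum_insert ha]
    ring
  | succ k =>
    simp only [desym]
    rw [Finset.sum_insert ha, Finset.erase_insert ha, Finset.mul_sum,
      Finset.sum_congr rfl fun i hi => by rw [key i hi, esym_insert (hn i)]]
    simp only [mul_add, Finset.sum_add_distrib]
    rw [Finset.sum_congr rfl fun i _ => mul_left_comm (v i) (x a) _]
    ring

/-- Euler's identity for the homogeneous polynomials `esym s · k`. -/
theorem desym_self (s : Finset ι) (x : ι → ℝ) (k : ℕ) :
    desym s x x k = k * esym s x k := by
  induction s using Finset.induction_on generalizing k with
  | empty => cases k <;> simp [desym, esym_empty_succ]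
  | insert a s ha ih =>
    cases k with
    | zero => simp [desym]
    | succ k =>
      rw [desym_insert ha, esym_insert ha, ih, ih]
      push_cast
      ring

theorem hasDerivAt_esym (s : Finset ι) (x v : ι → ℝ) (k : ℕ) :
    HasDerivAt (fun t : ℝ => esym s (x + t • v) k) (desym s x v k) 0 := by
  induction s using Finset.induction_on generalizing k with
  | empty =>
    cases k with
    | zero => simpa [desym] using hasDerivAt_const (0 : ℝ) (1 : ℝ)
    | succ k => simpa [desym, esym_empty_succ] using hasDerivAt_const (0 : ℝ) (0 : ℝ)
  | insert a s ha ih =>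
    cases k with
    | zero => simpa [desym] using hasDerivAt_const (0 : ℝ) (1 : ℝ)
    | succ k =>
      rw [desym_insert ha]
      simp only [esym_insert ha]
      have h1 : HasDerivAt (fun t : ℝ => (x + t • v) a) (v a) 0 := by
        simpa using ((hasDerivAt_id (0 : ℝ)).mul_const (v a)).const_add (x a)
      have := (ih (k + 1)).add (h1.mul (ih k))
      exact this.congr_deriv (by simp)

end Esym

open Polynomial in
/-- The derivative of a real polynomial with only real roots has only real roots. -/
theorem splits_derivative_real {p : ℝ[X]} (hp : p.Splits) : (derivative p).Splits := by
  by_cases h0 : p.natDegree = 0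
  · rw [natDegree_eq_zero.1 h0 |>.choose_spec.symm]
    simp
  rw [splits_iff_card_roots] at hp ⊢
  refine le_antisymm (card_roots' _) ?_
  have h1 := card_roots_le_derivative p
  rw [hp] at h1
  rw [natDegree_derivative]
  omega

open Polynomial in
/-- **Laguerre's inequality** for real polynomials with only real roots. -/
theorem laguerre_inequality {p : ℝ[X]} (hp : p.Splits) (x : ℝ) :
    p.eval x * (derivative (derivative p)).eval x ≤ (derivative p).eval x ^ 2 := by
  rw [splits_iff_exists_multiset] at hp
  obtain ⟨m, hm⟩ := hp
  have key : ∀ m : Multiset ℝ,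
      ((m.map (X - C ·)).prod).eval x * (derivative (derivative (m.map (X - C ·)).prod)).eval x ≤
        (derivative (m.map (X - C ·)).prod).eval x ^ 2 := by
    intro m
    induction m using Multiset.induction_on with
    | empty => simp
    | cons a m ih =>
      set q := (m.map (X - C ·)).prod
      simp only [Multiset.map_cons, Multiset.prod_cons]
      have hd : derivative ((X - C a) * q) = q + (X - C a) * derivative q := by
        simp [derivative_mul]
      have hdd : derivative (derivative ((X - C a) * q)) =
          2 * derivative q + (X - C a) * derivative (derivative q) := by
        rw [hd]; simp [derivative_mul]; ring
      rw [hdd, hd]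
      simp only [eval_mul, eval_add, eval_sub, eval_X, eval_C, eval_ofNat]
      nlinarith [mul_nonneg (sq_nonneg (x - a)) (sub_nonneg.2 ih), sq_nonneg (q.eval x)]
  rw [hm]
  simp only [derivative_C_mul, eval_mul, eval_C]
  nlinarith [mul_le_mul_of_nonneg_left (key m) (sq_nonneg p.leadingCoeff)]

open Polynomial in
/-- **Newton's inequality**, with the constant `1`, which holds for all real vectors. -/
theorem newton_inequality {ι : Type*} [DecidableEq ι] (s : Finset ι) (x : ι → ℝ) (k : ℕ) :
    esym s x k * esym s x (k + 2) ≤ esym s x (k + 1) ^ 2 := by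
  by_cases hk : k + 2 ≤ s.card
  swap
  · have : esym s x (k + 2) = 0 := by
      unfold esym
      rw [Finset.powersetCard_eq_empty.2 (by omega)]
      simp
    rw [this, mul_zero]
    positivity
  obtain ⟨j, hj⟩ : ∃ j, s.card = j + (k + 2) := ⟨s.card - (k + 2), by omega⟩
  set p : ℝ[X] := ∏ i ∈ s, (X + C (x i)) with hpdef
  have hp : p.Splits := Splits.prod fun i _ => Splits.X_add_C _
  have hj' : (derivative^[j] p).Splits := by
    clear_value p
    clear hpdef hj
    induction j with
    | zero => exact hp
    | succ j ih => rw [Function.iterate_succ_apply']; exact splits_derivative_real ih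
  have h := laguerre_inequality hj' 0
  have e : ∀ q : ℝ[X], q.eval 0 = q.coeff 0 := fun q => (coeff_zero_eq_eval_zero q).symm
  rw [← Function.iterate_succ_apply' derivative j, ← Function.iterate_succ_apply' derivative _, e, e, e,
    coeff_iterate_derivative, coeff_iterate_derivative, coeff_iterate_derivative] at h
  simp only [zero_add, Nat.descFactorial_self, nsmul_eq_mul] at h
  rw [hpdef, prod_X_add_C_coeff_esym s x (by omega), prod_X_add_C_coeff_esym s x (by omega),
    prod_X_add_C_coeff_esym s x (by omega), show s.card - j = k + 2 by omega,
    show s.card - j.succ = k + 1 by omega, show s.card - (j.succ).succ = k by omega] at h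
  set a := esym s x k
  set b := esym s x (k + 1)
  set c := esym s x (k + 2)
  have hf : (0 : ℝ) < (Nat.factorial j : ℝ) := by exact_mod_cast Nat.factorial_pos j
  rw [show (j.succ).succ = j + 2 from rfl, show j.succ = j + 1 from rfl, Nat.factorial_succ (j + 1),
    Nat.factorial_succ] at h
  push_cast at h
  set f := (Nat.factorial j : ℝ)
  have h1 : f ^ 2 * (j + 1) * ((j + 2) * (a * c)) ≤ f ^ 2 * (j + 1) * ((j + 1) * b ^ 2) := by
    nlinarith [h]
  have h2 : ((j : ℝ) + 2) * (a * c) ≤ (j + 1) * b ^ 2 :=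
    le_of_mul_le_mul_left h1 (by positivity)
  have hj0 : (0 : ℝ) ≤ j := Nat.cast_nonneg j
  by_contra hcon
  push Not at hcon
  nlinarith [sq_nonneg b]

/-! ### Superadditivity of quotients of elementary symmetric functions on the Garding cone -/

section Cone

variable {ι : Type*}

/-- The Garding cone: the elementary symmetric functions up to order `k` are positive. -/
def PosTo (s : Finset ι) (x : ι → ℝ) (k : ℕ) : Prop :=
  ∀ j ≤ k, 0 < esym s x j

theorem PosTo.mono {s : Finset ι} {x : ι → ℝ} {j k : ℕ} (h : PosTo s x k) (hjk : j ≤ k) :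
    PosTo s x j := fun i hi => h i (hi.trans hjk)

/-- The function `ab/(a+b)` is superadditive on the half plane `a + b > 0`. -/
theorem parallel_add_le {a b a' b' : ℝ} (h : 0 < a + b) (h' : 0 < a' + b') :
    a * b / (a + b) + a' * b' / (a' + b') ≤
      (a + a') * (b + b') / ((a + a') + (b + b')) := by
  have h2 : 0 < (a + a') + (b + b') := by linarith
  rw [div_add_div _ _ h.ne' h'.ne', div_le_div_iff₀ (mul_pos h h') h2]
  nlinarith [sq_nonneg (a * b' - a' * b)]

theorem parallel_mono {a b c : ℝ} (h : 0 < a + b) (hbc : b ≤ c) :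
    a * b / (a + b) ≤ a * c / (a + c) := by
  have h2 : 0 < a + c := by linarith
  rw [div_le_div_iff₀ h h2]
  nlinarith [mul_nonneg (sq_nonneg a) (sub_nonneg.2 hbc)]

theorem esym_smul (s : Finset ι) (x : ι → ℝ) (t : ℝ) (k : ℕ) :
    esym s (t • x) k = t ^ k * esym s x k := by
  unfold esym
  rw [Finset.mul_sum]
  refine Finset.sum_congr rfl fun u hu => ?_
  simp [Finset.prod_mul_distrib, (Finset.mem_powersetCard.1 hu).2]

theorem esym_div_eq_prod {s : Finset ι} {k l : ℕ} (hlk : l ≤ k) {x : ι → ℝ} (hx : PosTo s x k) :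
    esym s x k / esym s x l = ∏ j ∈ Finset.Ico l k, esym s x (j + 1) / esym s x j := by
  induction k, hlk using Nat.le_induction with
  | base => simp [(hx l le_rfl).ne']
  | succ k hk ih =>
    rw [Finset.prod_Ico_succ_top hk, ← ih (hx.mono (by omega))]
    have h1 := (hx k (by omega)).ne'
    have h2 := (hx l (by omega)).ne'
    field_simp

variable [DecidableEq ι]

/-- Deleting an entry lowers the index of the cone by one. This is where Newton's inequality
enters. -/
theorem PosTo.erase {s : Finset ι} {x : ι → ℝ} {k : ℕ} (h : PosTo s x (k + 1)) {i : ι}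
    (hi : i ∈ s) : PosTo (s.erase i) x k := by
  induction k with
  | zero => intro j hj; simp [Nat.le_zero.1 hj]
  | succ k ih =>
    have ih' := ih (h.mono (by omega))
    intro j hj
    rcases Nat.lt_or_ge j (k + 1) with hj' | hj'
    · exact ih' j (by omega)
    obtain rfl : j = k + 1 := by omega
    have h1 := h (k + 1) (by omega)
    have h2 := h (k + 2) le_rfl
    rw [esym_eq_erase hi] at h1 h2
    have h0 := ih' k le_rfl
    have hN := newton_inequality (s.erase i) x k
    set a := esym (s.erase i) x k
    set b := esym (s.erase i) x (k + 1)
    set c := esym (s.erase i) x (k + 2)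
    by_contra hb
    push Not at hb
    -- `a (c + x b) - b (b + x a) = a c - b ^ 2`, and the left side is positive when `b ≤ 0`.
    nlinarith [mul_pos h0 h2, mul_nonneg (neg_nonneg.2 hb) h1.le]

/-- The quotient of consecutive elementary symmetric functions, as an average of parallel sums. -/
theorem esym_div_eq_sum {s : Finset ι} {x : ι → ℝ} {k : ℕ} (h : PosTo s x (k + 1)) :
    ((k : ℝ) + 2) * (esym s x (k + 2) / esym s x (k + 1)) =
      ∑ i ∈ s, x i * (esym (s.erase i) x (k + 1) / esym (s.erase i) x k) /
        (x i + esym (s.erase i) x (k + 1) / esym (s.erase i) x k) := by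
  have hE := desym_self s x (k + 2)
  simp only [desym] at hE
  push_cast at hE
  rw [← mul_div_assoc, ← hE, Finset.sum_div]
  refine Finset.sum_congr rfl fun i hi => ?_
  have h0 : 0 < esym (s.erase i) x k := h.erase hi k le_rfl
  have h1 := h (k + 1) le_rfl
  rw [esym_eq_erase hi] at h1 ⊢
  have h2 : x i + esym (s.erase i) x (k + 1) / esym (s.erase i) x k =
      (esym (s.erase i) x (k + 1) + x i * esym (s.erase i) x k) / esym (s.erase i) x k := by
    field_simp
    ring
  rw [h2]
  field_simp

theorem add_ratio_pos {s : Finset ι} {x : ι → ℝ} {k : ℕ} (h : PosTo s x (k + 1)) {i : ι}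
    (hi : i ∈ s) : 0 < x i + esym (s.erase i) x (k + 1) / esym (s.erase i) x k := by
  have h0 : 0 < esym (s.erase i) x k := h.erase hi k le_rfl
  have h1 := h (k + 1) le_rfl
  rw [esym_eq_erase hi] at h1
  have h2 : x i + esym (s.erase i) x (k + 1) / esym (s.erase i) x k =
      (esym (s.erase i) x (k + 1) + x i * esym (s.erase i) x k) / esym (s.erase i) x k := by
    field_simp
    ring
  rw [h2]
  exact div_pos h1 h0

/-- The **Marcus-Lopes inequality**: the Garding cone is closed under addition, and the quotients
of consecutive elementary symmetric functions are superadditive on it. -/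
theorem marcus_lopes (k : ℕ) : ∀ (s : Finset ι) (x y : ι → ℝ), PosTo s x (k + 1) →
    PosTo s y (k + 1) → PosTo s (x + y) (k + 1) ∧
      esym s x (k + 1) / esym s x k + esym s y (k + 1) / esym s y k ≤
        esym s (x + y) (k + 1) / esym s (x + y) k := by
  induction k with
  | zero =>
    intro s x y hx hy
    have hd : ∀ z : ι → ℝ, esym s z 1 = ∑ i ∈ s, z i := fun z => by
      simp [esym, Finset.powersetCard_one]
    have hadd : esym s (x + y) 1 = esym s x 1 + esym s y 1 := by
      simp [hd, Finset.sum_add_distrib]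
    have h1 := hx 1 le_rfl
    have h2 := hy 1 le_rfl
    refine ⟨?_, by simp [hadd]⟩
    intro j hj
    interval_cases j
    · simp
    · rw [hadd]; positivity
  | succ k ih =>
    intro s x y hx hy
    obtain ⟨hxy, -⟩ := ih s x y (hx.mono (by omega)) (hy.mono (by omega))
    have main : esym s x (k + 2) / esym s x (k + 1) + esym s y (k + 2) / esym s y (k + 1) ≤
        esym s (x + y) (k + 2) / esym s (x + y) (k + 1) := by
      have hk : (0 : ℝ) < (k : ℝ) + 2 := by positivity
      refine le_of_mul_le_mul_left ?_ hk
      rw [mul_add, esym_div_eq_sum (hx.mono (by omega)), esym_div_eq_sum (hy.mono (by omega)),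
        esym_div_eq_sum hxy, ← Finset.sum_add_distrib]
      refine Finset.sum_le_sum fun i hi => ?_
      have h1 := add_ratio_pos (hx.mono (by omega : k + 1 ≤ k + 1 + 1)) hi
      have h2 := add_ratio_pos (hy.mono (by omega : k + 1 ≤ k + 1 + 1)) hi
      have h3 := (ih (s.erase i) x y (hx.erase hi) (hy.erase hi)).2
      refine (parallel_add_le h1 h2).trans ?_
      exact parallel_mono (by linarith) h3
    refine ⟨fun j hj => ?_, main⟩
    rcases Nat.lt_or_ge j (k + 2) with hj' | hj'
    · exact hxy j (by omega)
    obtain rfl : j = k + 2 := by omega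
    have h1 : 0 < esym s (x + y) (k + 1) := hxy _ le_rfl
    have h2 : 0 < esym s (x + y) (k + 2) / esym s (x + y) (k + 1) :=
      lt_of_lt_of_le (add_pos (div_pos (hx (k + 2) le_rfl) (hx (k + 1) (by omega)))
        (div_pos (hy (k + 2) le_rfl) (hy (k + 1) (by omega)))) main
    have h3 := mul_pos h2 h1
    rwa [div_mul_cancel₀ _ h1.ne'] at h3

/-- The logarithmic derivative of `esym s · (k + 1) / esym s · k` in a direction of the cone is
bounded below by the quotient of the values. -/
theorem le_log_deriv_ratio {s : Finset ι} {x y : ι → ℝ} {k : ℕ} (hx : PosTo s x (k + 1))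
    (hy : PosTo s y (k + 1)) :
    (esym s y (k + 1) / esym s y k) / (esym s x (k + 1) / esym s x k) ≤
      desym s x y (k + 1) / esym s x (k + 1) - desym s x y k / esym s x k := by
  have h0 := hx k (by omega)
  have h1 := hx (k + 1) le_rfl
  set r := esym s x (k + 1) / esym s x k with hr
  have hrpos : 0 < r := div_pos h1 h0
  have hder : HasDerivAt (fun t : ℝ => esym s (x + t • y) (k + 1) / esym s (x + t • y) k)
      ((desym s x y (k + 1) * esym s x k - esym s x (k + 1) * desym s x y k) /
        esym s x k ^ 2) 0 := by
    have := (hasDerivAt_esym s x y (k + 1)).div (hasDerivAt_esym s x y k) (by simpa using h0.ne')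
    exact this.congr_deriv (by simp)
  have hlow : esym s y (k + 1) / esym s y k ≤
      (desym s x y (k + 1) * esym s x k - esym s x (k + 1) * desym s x y k) /
        esym s x k ^ 2 := by
    have hlim := hasDerivWithinAt_iff_tendsto_slope.1 (hder.hasDerivWithinAt (s := Set.Ioi 0))
    rw [Set.sdiff_singleton_eq_self (by simp)] at hlim
    refine ge_of_tendsto hlim ?_
    filter_upwards [self_mem_nhdsWithin] with t ht
    have ht' : (0 : ℝ) < t := ht
    have hty : PosTo s (t • y) (k + 1) := fun j hj => by
      rw [esym_smul]; exact mul_pos (pow_pos ht' j) (hy j hj)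
    have hm := (marcus_lopes k s x (t • y) hx hty).2
    rw [slope_def_field, sub_zero, le_div_iff₀ ht']
    rw [esym_smul, esym_smul, pow_succ] at hm
    have hyk := hy k (by omega)
    have : t ^ k * t * esym s y (k + 1) / (t ^ k * esym s y k) =
        esym s y (k + 1) / esym s y k * t := by
      field_simp
    rw [this] at hm
    simp only [zero_smul, add_zero]
    linarith
  have heq : desym s x y (k + 1) / esym s x (k + 1) - desym s x y k / esym s x k =
      (desym s x y (k + 1) * esym s x k - esym s x (k + 1) * desym s x y k) /
        esym s x k ^ 2 / r := by
    rw [hr]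
    field_simp
  rw [heq]
  exact div_le_div_of_nonneg_right hlow hrpos.le

/-- The derivative of `log (esym s · k / esym s · l)` at `x` in the direction `v`. -/
def logRatioDeriv (s : Finset ι) (k l : ℕ) (x v : ι → ℝ) : ℝ :=
  desym s x v k / esym s x k - desym s x v l / esym s x l

theorem logRatioDeriv_eq_sum (s : Finset ι) {k l : ℕ} (hlk : l ≤ k) (x v : ι → ℝ) :
    logRatioDeriv s k l x v = ∑ j ∈ Finset.Ico l k,
      (desym s x v (j + 1) / esym s x (j + 1) - desym s x v j / esym s x j) := by
  rw [Finset.sum_Ico_sub (fun j => desym s x v j / esym s x j) hlk]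
  rfl

/-- The quotient `σₖ / σₗ` is nondecreasing in every direction of the cone, not only in the
coordinate directions. -/
theorem logRatioDeriv_nonneg {s : Finset ι} {k l : ℕ} (hlk : l ≤ k) {x y : ι → ℝ} (hx : PosTo s x k)
    (hy : PosTo s y k) : 0 ≤ logRatioDeriv s k l x y := by
  rw [logRatioDeriv_eq_sum s hlk]
  refine Finset.sum_nonneg fun j hj => ?_
  have hj' := (Finset.mem_Ico.1 hj).2
  refine le_trans ?_ (le_log_deriv_ratio (hx.mono hj') (hy.mono hj'))
  have h1 := hx (j + 1) hj'
  have h2 := hx j (by omega)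
  have h3 := hy (j + 1) hj'
  have h4 := hy j (by omega)
  positivity

/-- Euler's identity. -/
theorem logRatioDeriv_self {s : Finset ι} {k l : ℕ} (hlk : l ≤ k) {x : ι → ℝ} (hx : PosTo s x k) :
    logRatioDeriv s k l x x = (k : ℝ) - l := by
  have h1 := (hx k le_rfl).ne'
  have h2 := (hx l hlk).ne'
  rw [logRatioDeriv, desym_self, desym_self]
  field_simp

theorem desym_eq_sum (s : Finset ι) (x v : ι → ℝ) (k : ℕ) :
    desym s x v k = ∑ i ∈ s, v i * desym s x (Pi.single i 1) k := by
  cases k with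
  | zero => simp [desym]
  | succ k =>
    simp only [desym]
    refine Finset.sum_congr rfl fun i hi => ?_
    rw [Finset.sum_eq_single i]
    · simp
    · intro j _ hj
      rw [Pi.single_eq_of_ne hj, zero_mul]
    · exact fun h => absurd hi h

theorem logRatioDeriv_eq_sum_single (s : Finset ι) (k l : ℕ) (x v : ι → ℝ) :
    logRatioDeriv s k l x v = ∑ i ∈ s, v i * logRatioDeriv s k l x (Pi.single i 1) := by
  simp only [logRatioDeriv, mul_sub, Finset.sum_sub_distrib]
  rw [desym_eq_sum s x v k, desym_eq_sum s x v l, Finset.sum_div, Finset.sum_div]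
  simp only [mul_div_assoc]

end Cone

/-! ### Uniform ellipticity of the Hessian quotient in the complementary sums -/

section Gradient

variable {n : ℕ}

theorem ratio_one_ge {j : ℕ} (hj : j < n) :
    1 / (n : ℝ) ≤ esym (Finset.univ : Finset (Fin n)) (fun _ => 1) (j + 1) /
      esym (Finset.univ : Finset (Fin n)) (fun _ => 1) j := by
  rw [esym_const, esym_const]
  simp only [Finset.card_univ, Fintype.card_fin, one_pow, mul_one]
  have h1 : (0 : ℝ) < n.choose j := by exact_mod_cast Nat.choose_pos hj.le
  have h2 := Nat.choose_succ_right_eq n j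
  have h3 : (n.choose (j + 1) : ℝ) * (j + 1) = n.choose j * ((n - j : ℕ) : ℝ) := by
    exact_mod_cast h2
  have h4 : (1 : ℝ) ≤ ((n - j : ℕ) : ℝ) := by exact_mod_cast (by omega : 1 ≤ n - j)
  have h5 : ((j : ℝ) + 1) ≤ n := by exact_mod_cast hj
  have hn : (0 : ℝ) < n := by exact_mod_cast (by omega : 0 < n)
  rw [div_le_div_iff₀ hn h1]
  have h6 : (0 : ℝ) ≤ n.choose (j + 1) := Nat.cast_nonneg _
  nlinarith

theorem posTo_one {k : ℕ} (hk : k ≤ n) :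
    PosTo (Finset.univ : Finset (Fin n)) (fun _ => 1) k := by
  intro j hj
  rw [esym_const]
  simp only [Finset.card_univ, Fintype.card_fin, one_pow, mul_one]
  exact_mod_cast Nat.choose_pos (hj.trans hk)

/-- The vector with entries `1`, except for one slightly negative entry, lies in the Garding cone
of any index `k < n`. -/
theorem posTo_update {k : ℕ} (hk : k < n) (i : Fin n) :
    PosTo (Finset.univ : Finset (Fin n)) (Function.update (fun _ => 1) i (-(1 / (2 * n)))) k := by
  intro j hj
  cases j with
  | zero => simp
  | succ j =>
    rw [esym_eq_erase (Finset.mem_univ i)]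
    have hc : ∀ m, esym (Finset.univ.erase i)
        (Function.update (fun _ => (1 : ℝ)) i (-(1 / (2 * n)))) m = ((n - 1).choose m : ℝ) := by
      intro m
      rw [esym_congr (y := fun _ => 1), esym_const, Finset.card_erase_of_mem (Finset.mem_univ i)]
      · simp
      · intro a ha
        rw [Function.update_of_ne (Finset.ne_of_mem_erase ha)]
    rw [hc, hc, Function.update_self]
    have h1 : (0 : ℝ) < (n - 1).choose j := by exact_mod_cast Nat.choose_pos (by omega)
    have h3 : ((n - 1).choose (j + 1) : ℝ) * (j + 1) =
        (n - 1).choose j * ((n - 1 - j : ℕ) : ℝ) := by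
      exact_mod_cast Nat.choose_succ_right_eq (n - 1) j
    have h4 : (1 : ℝ) ≤ ((n - 1 - j : ℕ) : ℝ) := by exact_mod_cast (by omega : 1 ≤ n - 1 - j)
    have h5 : ((j : ℝ) + 1) ≤ n := by exact_mod_cast (by omega : j + 1 ≤ n)
    have hn : (0 : ℝ) < n := by exact_mod_cast (by omega : 0 < n)
    have h6 : (0 : ℝ) ≤ (n - 1).choose (j + 1) := Nat.cast_nonneg _
    have h7 : ((n - 1).choose j : ℝ) ≤ (n - 1).choose (j + 1) * n := by nlinarith
    have h8 : -(1 / (2 * (n : ℝ))) * ((n - 1).choose j : ℝ) =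
      -(((n - 1).choose j : ℝ) / (2 * n)) := by ring
    have h9 : ((n - 1).choose j : ℝ) / (2 * n) < (n - 1).choose (j + 1) := by
      rw [div_lt_iff₀ (by positivity)]
      nlinarith
    rw [h8]
    linarith

/-- The partial derivatives of `log (σₖ / σₗ)`. -/
def logGrad (k l : ℕ) (x : Fin n → ℝ) (i : Fin n) : ℝ :=
  logRatioDeriv Finset.univ k l x (Pi.single i 1)

theorem sum_mul_logGrad (k l : ℕ) (x v : Fin n → ℝ) :
    ∑ i, v i * logGrad k l x i = logRatioDeriv Finset.univ k l x v :=
  (logRatioDeriv_eq_sum_single _ k l x v).symm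

variable {k l : ℕ} {x : Fin n → ℝ}

/-- The key consequence of `k < n`: no partial derivative dominates the sum of the others. -/
theorem logGrad_le_sum (hlk : l ≤ k) (hkn : k < n) (hx : PosTo Finset.univ x k) (i : Fin n) :
    1 / (2 * n) * logGrad k l x i ≤ (∑ j, logGrad k l x j) - logGrad k l x i := by
  have h := logRatioDeriv_nonneg hlk hx (posTo_update hkn i)
  rw [← sum_mul_logGrad, ← Finset.add_sum_erase _ _ (Finset.mem_univ i), Function.update_self] at h
  rw [← Finset.add_sum_erase _ _ (Finset.mem_univ i)]
  rw [Finset.sum_congr rfl (g := fun j => logGrad k l x j)] at h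
  · linarith
  · intro j hj
    rw [Function.update_of_ne (Finset.ne_of_mem_erase hj), one_mul]

/-- With `F` the geometric mean of the consecutive quotients between `l` and `k`, the sum of the
partial derivatives of `log (σₖ / σₗ)` is at least `1 / (n F)`. -/
theorem sum_logGrad_ge (hlk : l < k) (hkn : k < n) (hx : PosTo Finset.univ x k) {F : ℝ}
    (hF : 0 < F) (hFk : F ^ (k - l) = esym Finset.univ x k / esym Finset.univ x l) :
    1 / n ≤ F * ∑ j, logGrad k l x j := by
  have hn : (0 : ℝ) < n := by exact_mod_cast (by omega : 0 < n)
  -- One of the consecutive quotients is at most their geometric mean.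
  obtain ⟨j, hj, hjF⟩ : ∃ j ∈ Finset.Ico l k,
      esym Finset.univ x (j + 1) / esym Finset.univ x j ≤ F := by
    by_contra! hcon
    rw [esym_div_eq_prod hlk.le hx] at hFk
    have : F ^ (k - l) < ∏ j ∈ Finset.Ico l k, esym Finset.univ x (j + 1) / esym Finset.univ x j := by
      have h1 : F ^ (k - l) = ∏ j ∈ Finset.Ico l k, F := by simp
      rw [h1]
      exact Finset.prod_lt_prod_of_nonempty (fun _ _ => hF) hcon (by simpa using hlk)
    linarith
  have h1 : ∑ j, logGrad k l x j = logRatioDeriv Finset.univ k l x (fun _ => 1) := by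
    rw [← sum_mul_logGrad]; simp
  have hjk := Finset.mem_Ico.1 hj
  have hpos1 := posTo_one hkn.le
  have hxr : 0 < esym Finset.univ x (j + 1) / esym Finset.univ x j :=
    div_pos (hx _ hjk.2) (hx _ hjk.2.le)
  have h2 : 1 / n / F ≤ logRatioDeriv Finset.univ k l x (fun _ => 1) := by
    rw [logRatioDeriv_eq_sum _ hlk.le]
    refine le_trans ?_ (Finset.single_le_sum (f := fun j =>
      desym Finset.univ x (fun _ => 1) (j + 1) / esym Finset.univ x (j + 1) -
        desym Finset.univ x (fun _ => 1) j / esym Finset.univ x j) ?_ hj)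
    · refine le_trans ?_ (le_log_deriv_ratio (hx.mono hjk.2) (hpos1.mono hjk.2))
      exact div_le_div₀ (le_trans (by positivity) (ratio_one_ge (by omega)))
        (ratio_one_ge (by omega)) hxr hjF
    · intro a ha
      have hak := Finset.mem_Ico.1 ha
      refine le_trans ?_ (le_log_deriv_ratio (hx.mono hak.2) (hpos1.mono hak.2))
      have := hx (a + 1) hak.2
      have := hx a hak.2.le
      have := hpos1 (a + 1) hak.2
      have := hpos1 a hak.2.le
      positivity
  rw [h1]
  rw [div_le_iff₀ hF] at h2
  linarith

end Gradient

/-! ### Derivatives of the elementary symmetric functions of the eigenvalues -/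

section MatrixFunctions

variable {n : ℕ}

/-- The elementary symmetric functions of the eigenvalues of a matrix, as coefficients of its
characteristic polynomial; they are polynomials in the entries. -/
def matEsym (M : Matrix (Fin n) (Fin n) ℝ) (j : ℕ) : ℝ :=
  (-1) ^ j * M.charpoly.coeff (n - j)

theorem matEsym_eq_of_charpoly {M : Matrix (Fin n) (Fin n) ℝ} {d : Fin n → ℝ}
    (h : M.charpoly = ∏ i, (Polynomial.X - Polynomial.C (d i))) {j : ℕ} (hj : j ≤ n) :
    matEsym M j = esym Finset.univ d j := by
  have h1 : ∏ i, (Polynomial.X - Polynomial.C (d i)) =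
      ∏ i, (Polynomial.X + Polynomial.C ((-1 : ℝ) * d i)) := by
    simp [sub_eq_add_neg]
  rw [matEsym, h, h1, prod_X_add_C_coeff_esym _ _ (by simp)]
  have h2 : (fun i => (-1 : ℝ) * d i) = (-1 : ℝ) • d := by ext; simp
  simp only [Finset.card_univ, Fintype.card_fin]
  rw [h2, esym_smul, show n - (n - j) = j by omega, ← mul_assoc, ← mul_pow]
  simp

theorem eigen_eq_of_charpoly {M : Matrix (Fin n) (Fin n) ℝ} {d : Fin n → ℝ}
    (h : M.charpoly = ∏ i, (Polynomial.X - Polynomial.C (d i))) :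
    eigen M = Finset.univ.val.map d := by
  rw [eigen, h]
  have h' := Polynomial.roots_multiset_prod_X_sub_C (Finset.univ.val.map d)
  rw [Multiset.map_map] at h'
  exact h'

theorem charpoly_conj_diagonal {U : Matrix (Fin n) (Fin n) ℝ} (hU : U.transpose * U = 1)
    (d : Fin n → ℝ) :
    (U * Matrix.diagonal d * U.transpose).charpoly =
      ∏ i, (Polynomial.X - Polynomial.C (d i)) := by
  rw [Matrix.charpoly_mul_comm, ← mul_assoc, hU, one_mul, Matrix.charpoly_diagonal]

theorem differentiable_mvPolynomial_eval {σ : Type*} [Fintype σ] (P : MvPolynomial σ ℝ) :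
    Differentiable ℝ fun v : σ → ℝ => MvPolynomial.eval v P := by
  induction P using MvPolynomial.induction_on with
  | C a => simp
  | add p q hp hq => simpa using hp.fun_add hq
  | mul_X p i hp => simpa using hp.fun_mul (differentiable_apply i)

theorem matEsym_eq_eval (M : Matrix (Fin n) (Fin n) ℝ) (j : ℕ) :
    matEsym M j = (-1) ^ j * MvPolynomial.eval (fun p : Fin n × Fin n => M p.1 p.2)
      ((Matrix.charpoly.univ ℝ (Fin n)).coeff (n - j)) := by
  rw [matEsym]
  exact congrArg _ (Matrix.charpoly.univ_coeff_eval₂Hom (Fin n) (RingHom.id ℝ)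
    (fun p : Fin n × Fin n => M p.1 p.2) (n - j)).symm

/-- Off-diagonal perturbations in a single entry do not change the characteristic polynomial of a
diagonal matrix. -/
theorem charpoly_diagonal_add_single {d : Fin n → ℝ} {a b : Fin n} (hab : a ≠ b) (t : ℝ) :
    (Matrix.diagonal d + Matrix.single a b t).charpoly = (Matrix.diagonal d).charpoly := by
  wlog h : a < b generalizing a b
  · rw [← Matrix.charpoly_transpose, Matrix.transpose_add, Matrix.diagonal_transpose,
      Matrix.transpose_single]
    exact this hab.symm (lt_of_le_of_ne (not_lt.1 h) hab.symm)
  rw [Matrix.charpoly_diagonal, Matrix.charpoly_of_isUpperTriangular]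
  · refine Finset.prod_congr rfl fun i _ => ?_
    have : Matrix.single a b t i i = 0 := by
      rw [Matrix.single_apply]
      exact if_neg fun h => hab (h.1.trans h.2.symm)
    simp [this]
  · intro i j hij
    have hij' : j < i := hij
    rw [Matrix.add_apply, Matrix.diagonal_apply_ne _ hij'.ne', Matrix.single_apply, if_neg]
    · simp
    · rintro ⟨rfl, rfl⟩
      exact absurd hij' (not_lt.2 h.le)

/-- At a diagonal matrix only the diagonal entries of a perturbation contribute to first order. -/
theorem hasDerivAt_matEsym_diagonal {M : ℝ → Matrix (Fin n) (Fin n) ℝ}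
    {E : Matrix (Fin n) (Fin n) ℝ} {d : Fin n → ℝ} (h0 : M 0 = Matrix.diagonal d)
    (hM : ∀ a b, HasDerivAt (fun s => M s a b) (E a b) 0) {j : ℕ} (hj : j ≤ n) :
    HasDerivAt (fun s => matEsym (M s) j) (desym Finset.univ d (fun i => E i i) j) 0 := by
  set P : MvPolynomial (Fin n × Fin n) ℝ := (Matrix.charpoly.univ ℝ (Fin n)).coeff (n - j)
  have hdiff : Differentiable ℝ fun v : Fin n × Fin n → ℝ => (-1 : ℝ) ^ j * MvPolynomial.eval v P :=
    (differentiable_mvPolynomial_eval P).const_mul _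
  set D : Fin n × Fin n → ℝ := fun p => Matrix.diagonal d p.1 p.2 with hD
  set T := fderiv ℝ (fun v : Fin n × Fin n → ℝ => (-1 : ℝ) ^ j * MvPolynomial.eval v P) D with hT
  have hTD := (hdiff D).hasFDerivAt
  rw [← hT] at hTD
  have hline : ∀ v : Fin n × Fin n → ℝ,
      HasDerivAt (fun s : ℝ => (-1 : ℝ) ^ j * MvPolynomial.eval (D + s • v) P) (T v) 0 := by
    intro v
    have h1 : HasDerivAt (fun s : ℝ => D + s • v) v 0 := by
      have := ((hasDerivAt_id (0 : ℝ)).smul_const v).const_add D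
      simpa using this
    have h2 : HasFDerivAt (fun v : Fin n × Fin n → ℝ => (-1 : ℝ) ^ j * MvPolynomial.eval v P) T
        (D + (0 : ℝ) • v) := by simpa using hTD
    exact h2.comp_hasDerivAt (0 : ℝ) h1
  have hsing : ∀ (a b : Fin n) (s : ℝ), (-1 : ℝ) ^ j * MvPolynomial.eval
      (D + s • (Pi.single (a, b) (1 : ℝ) : Fin n × Fin n → ℝ)) P =
        matEsym (Matrix.diagonal d + Matrix.single a b s) j := by
    intro a b s
    rw [matEsym_eq_eval]
    congr 3
    ext p
    simp only [hD, Pi.add_apply, Pi.smul_apply, smul_eq_mul, Matrix.add_apply, Matrix.single_apply,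
      Pi.single_apply, Prod.ext_iff]
    congr 1
    by_cases h : p.1 = a ∧ p.2 = b
    · rw [if_pos h, if_pos ⟨h.1.symm, h.2.symm⟩, mul_one]
    · rw [if_neg h, if_neg fun h' => h ⟨h'.1.symm, h'.2.symm⟩, mul_zero]
  have hoff : ∀ a b : Fin n, a ≠ b → T (Pi.single (a, b) 1) = 0 := by
    intro a b hab
    have h1 := hline (Pi.single (a, b) 1)
    simp only [hsing, matEsym, charpoly_diagonal_add_single hab] at h1
    exact h1.unique (hasDerivAt_const _ _)
  have hdiag : ∀ a : Fin n, T (Pi.single (a, a) 1) = desym Finset.univ d (Pi.single a 1) j := by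
    intro a
    have h1 := hline (Pi.single (a, a) 1)
    simp only [hsing] at h1
    refine h1.unique ?_
    have h2 := hasDerivAt_esym Finset.univ d (Pi.single a 1) j
    refine h2.congr_of_eventuallyEq (Filter.Eventually.of_forall fun s => ?_)
    refine matEsym_eq_of_charpoly ?_ hj
    rw [← Matrix.charpoly_diagonal]
    congr 1
    ext p q
    rw [Matrix.add_apply, Matrix.single_apply]
    by_cases hpq : p = q
    · subst hpq
      by_cases hp : a = p
      · subst hp; simp
      · simp [hp, Ne.symm hp]
    · rw [Matrix.diagonal_apply_ne _ hpq, Matrix.diagonal_apply_ne _ hpq, if_neg]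
      · simp
      · exact fun h => hpq (h.1.symm.trans h.2)
  have hTE : T (fun p => E p.1 p.2) = desym Finset.univ d (fun i => E i i) j := by
    have h1 : (fun p : Fin n × Fin n => E p.1 p.2) =
        ∑ p : Fin n × Fin n, E p.1 p.2 • (Pi.single p (1 : ℝ) : Fin n × Fin n → ℝ) := by
      ext q
      simp [Finset.sum_apply, Pi.single_apply]
    rw [h1, map_sum, desym_eq_sum, Fintype.sum_prod_type]
    refine Finset.sum_congr rfl fun a _ => ?_
    rw [Finset.sum_eq_single a]
    · rw [map_smul, hdiag, smul_eq_mul]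
    · intro b _ hb
      rw [map_smul, hoff a b hb.symm, smul_zero]
    · simp
  have hcurve : HasDerivAt (fun s => fun p : Fin n × Fin n => M s p.1 p.2)
      (fun p => E p.1 p.2) 0 := hasDerivAt_pi.2 fun p => hM p.1 p.2
  have hTD' : HasFDerivAt (fun v : Fin n × Fin n → ℝ => (-1 : ℝ) ^ j * MvPolynomial.eval v P) T
      ((fun s => fun p : Fin n × Fin n => M s p.1 p.2) 0) := by
    simpa [h0] using hTD
  have := hTD'.comp_hasDerivAt (0 : ℝ) hcurve
  rw [hTE] at this
  exact this.congr_of_eventuallyEq (Filter.Eventually.of_forall fun s => matEsym_eq_eval _ _)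

theorem matEsym_conj {U : Matrix (Fin n) (Fin n) ℝ} (hU : U.transpose * U = 1)
    (M : Matrix (Fin n) (Fin n) ℝ) (j : ℕ) :
    matEsym (U.transpose * M * U) j = matEsym M j := by
  have h : U * U.transpose = 1 := mul_eq_one_comm.1 hU
  rw [matEsym, Matrix.charpoly_mul_comm, ← mul_assoc, h, one_mul, ← matEsym]

theorem hasDerivAt_matEsym {M : ℝ → Matrix (Fin n) (Fin n) ℝ}
    {E U : Matrix (Fin n) (Fin n) ℝ} {d : Fin n → ℝ} (hU : U.transpose * U = 1)
    (h0 : M 0 = U * Matrix.diagonal d * U.transpose)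
    (hM : ∀ a b, HasDerivAt (fun s => M s a b) (E a b) 0) {j : ℕ} (hj : j ≤ n) :
    HasDerivAt (fun s => matEsym (M s) j)
      (desym Finset.univ d (fun i => (U.transpose * E * U) i i) j) 0 := by
  have h1 : U.transpose * M 0 * U = Matrix.diagonal d := by
    rw [h0]
    calc U.transpose * (U * Matrix.diagonal d * U.transpose) * U
        = (U.transpose * U) * Matrix.diagonal d * (U.transpose * U) := by
          simp only [mul_assoc]
      _ = Matrix.diagonal d := by rw [hU]; simp
  have h2 : ∀ a b, HasDerivAt (fun s => (U.transpose * M s * U) a b)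
      ((U.transpose * E * U) a b) 0 := by
    intro a b
    simp only [Matrix.mul_apply]
    refine HasDerivAt.fun_sum fun c _ => HasDerivAt.mul_const ?_ _
    exact HasDerivAt.fun_sum fun e _ => (hM e c).const_mul _
  have h3 := hasDerivAt_matEsym_diagonal (M := fun s => U.transpose * M s * U) h1 h2 hj
  simpa only [matEsym_conj hU] using h3

/-- The derivative of `(σₖ / σₗ) ^ (1 / (k - l))` of the eigenvalues along a curve of matrices, at
an orthogonally diagonalized matrix in the Garding cone. -/
theorem hasDerivAt_quotient {k l : ℕ} (hlk : l < k) (hkn : k ≤ n)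
    {M : ℝ → Matrix (Fin n) (Fin n) ℝ}
    {E U : Matrix (Fin n) (Fin n) ℝ} {d : Fin n → ℝ} (hU : U.transpose * U = 1)
    (h0 : M 0 = U * Matrix.diagonal d * U.transpose)
    (hM : ∀ a b, HasDerivAt (fun s => M s a b) (E a b) 0) (hd : PosTo Finset.univ d k) :
    HasDerivAt (fun s => (matEsym (M s) k / matEsym (M s) l) ^ (1 / ((k - l : ℕ) : ℝ)))
      ((esym Finset.univ d k / esym Finset.univ d l) ^ (1 / ((k - l : ℕ) : ℝ)) / ((k - l : ℕ) : ℝ) *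
        ∑ i, (U.transpose * E * U) i i * logGrad k l d i) 0 := by
  have hk := hasDerivAt_matEsym hU h0 hM hkn
  have hl := hasDerivAt_matEsym hU h0 hM (hlk.le.trans hkn)
  have hch : (M 0).charpoly = ∏ i, (Polynomial.X - Polynomial.C (d i)) := by
    rw [h0, charpoly_conj_diagonal hU]
  have ek := matEsym_eq_of_charpoly hch hkn
  have el := matEsym_eq_of_charpoly hch (hlk.le.trans hkn)
  have pk := hd k le_rfl
  have pl := hd l hlk.le
  have hq := hk.div hl (by rw [el]; exact pl.ne')
  have hpos : 0 < esym Finset.univ d k / esym Finset.univ d l := div_pos pk pl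
  have := hq.rpow_const (p := 1 / ((k - l : ℕ) : ℝ)) (by
    left; simp only [Pi.div_apply]; rw [ek, el]; exact hpos.ne')
  refine this.congr_deriv ?_
  simp only [Pi.div_apply]
  rw [ek, el, sum_mul_logGrad, logRatioDeriv, Real.rpow_sub_one hpos.ne']
  field_simp

end MatrixFunctions

/-! ### The symmetrized curvature matrix as a function of gradient and Hessian -/

section CurvatureMatrix

variable {n : ℕ}

/-- The area factor `√(1 + |p|²)` as a function of the gradient. -/
def slopeFactor (p : Fin n → ℝ) : ℝ := Real.sqrt (1 + ∑ i, p i ^ 2)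

/-- The square root of the inverse of the first fundamental form `1 + p pᵀ`. -/
def invRootForm (p : Fin n → ℝ) : Matrix (Fin n) (Fin n) ℝ :=
  1 - (slopeFactor p * (1 + slopeFactor p))⁻¹ • Matrix.vecMulVec p p

/-- The inverse of the first fundamental form `1 + p pᵀ`. -/
def invForm (p : Fin n → ℝ) : Matrix (Fin n) (Fin n) ℝ :=
  1 - (slopeFactor p ^ 2)⁻¹ • Matrix.vecMulVec p p

theorem slopeFactor_sq (p : Fin n → ℝ) : slopeFactor p ^ 2 = 1 + ∑ i, p i ^ 2 :=
  Real.sq_sqrt (by positivity)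

theorem one_le_slopeFactor (p : Fin n → ℝ) : 1 ≤ slopeFactor p := by
  rw [slopeFactor, Real.one_le_sqrt]
  have : 0 ≤ ∑ i, p i ^ 2 := by positivity
  linarith

theorem slopeFactor_pos (p : Fin n → ℝ) : 0 < slopeFactor p :=
  lt_of_lt_of_le one_pos (one_le_slopeFactor p)

theorem slopeFactor_le {p : Fin n → ℝ} {R : ℝ} (h : ∀ i, |p i| ≤ R) :
    slopeFactor p ≤ Real.sqrt (1 + n * R ^ 2) := by
  refine Real.sqrt_le_sqrt ?_
  have : ∑ i, p i ^ 2 ≤ ∑ _i : Fin n, R ^ 2 :=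
    Finset.sum_le_sum fun i _ => sq_le_sq' (by linarith [neg_abs_le (p i), h i])
      (by linarith [le_abs_self (p i), h i])
  simp only [Finset.sum_const, Finset.card_univ, Fintype.card_fin, nsmul_eq_mul] at this
  linarith

theorem vecMulVec_self_mul_self (p : Fin n → ℝ) :
    Matrix.vecMulVec p p * Matrix.vecMulVec p p =
      (slopeFactor p ^ 2 - 1) • Matrix.vecMulVec p p := by
  rw [slopeFactor_sq, Matrix.vecMulVec_mul_vecMulVec]
  have : p ⬝ᵥ p = ∑ i, p i ^ 2 := by simp [dotProduct, pow_two]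
  rw [this]
  ext i j
  simp only [Matrix.vecMulVec_apply, Matrix.smul_apply, Pi.smul_apply, smul_eq_mul,
    add_sub_cancel_left]
  ring

theorem invRootForm_mul_self (p : Fin n → ℝ) : invRootForm p * invRootForm p = invForm p := by
  have hw := slopeFactor_pos p
  have hw2 : (1 + slopeFactor p) ≠ 0 := by positivity
  simp only [invRootForm, invForm, sub_mul, mul_sub, one_mul, mul_one, Matrix.smul_mul,
    Matrix.mul_smul, vecMulVec_self_mul_self]
  rw [smul_smul, smul_smul]
  set w := slopeFactor p
  have : (w * (1 + w))⁻¹ + (w * (1 + w))⁻¹ - (w * (1 + w))⁻¹ * ((w * (1 + w))⁻¹ * (w ^ 2 - 1)) =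
      (w ^ 2)⁻¹ := by
    field_simp
    ring
  rw [← this]
  simp only [sub_smul, add_smul, mul_assoc]
  abel

theorem one_add_mul_invForm (p : Fin n → ℝ) :
    (1 + Matrix.vecMulVec p p) * invForm p = 1 := by
  have hw := slopeFactor_pos p
  simp only [invForm, add_mul, mul_sub, one_mul, mul_one, Matrix.mul_smul,
    vecMulVec_self_mul_self, smul_smul]
  set w := slopeFactor p
  have : (w ^ 2)⁻¹ * w ^ 2 = 1 := inv_mul_cancel₀ (by positivity)
  rw [this, sub_smul, one_smul]
  abel

theorem invRootForm_transpose (p : Fin n → ℝ) : (invRootForm p).transpose = invRootForm p := by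
  simp [invRootForm, Matrix.transpose_sub, Matrix.transpose_vecMulVec]

theorem invForm_quadratic (p ξ : Fin n → ℝ) :
    ∑ i, ∑ j, invForm p i j * (ξ i * ξ j) =
      ∑ i, ξ i ^ 2 - (slopeFactor p ^ 2)⁻¹ * (∑ i, p i * ξ i) ^ 2 := by
  have h1 : ∀ i j, invForm p i j * (ξ i * ξ j) = (if i = j then ξ i ^ 2 else 0) -
      (slopeFactor p ^ 2)⁻¹ * ((p i * ξ i) * (p j * ξ j)) := by
    intro i j
    simp only [invForm, Matrix.sub_apply, Matrix.smul_apply, Matrix.vecMulVec_apply, smul_eq_mul,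
      Matrix.one_apply]
    split_ifs with h
    · subst h; ring
    · ring
  simp only [h1, Finset.sum_sub_distrib, Finset.sum_ite_eq, Finset.mem_univ, if_true]
  congr 1
  rw [pow_two (∑ i, p i * ξ i), Finset.sum_mul_sum, Finset.mul_sum]
  simp only [Finset.mul_sum]

theorem invForm_lower (p ξ : Fin n → ℝ) :
    (slopeFactor p ^ 2)⁻¹ * ∑ i, ξ i ^ 2 ≤ ∑ i, ∑ j, invForm p i j * (ξ i * ξ j) := by
  rw [invForm_quadratic]
  have hw := slopeFactor_pos p
  have hw2 := slopeFactor_sq p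
  have hcs := Finset.sum_mul_sq_le_sq_mul_sq Finset.univ p ξ
  have hS : 0 ≤ ∑ i, ξ i ^ 2 := by positivity
  have h1 : (slopeFactor p ^ 2)⁻¹ * (∑ i, p i * ξ i) ^ 2 ≤
      (slopeFactor p ^ 2)⁻¹ * ((slopeFactor p ^ 2 - 1) * ∑ i, ξ i ^ 2) := by
    refine mul_le_mul_of_nonneg_left ?_ (by positivity)
    rw [hw2]
    simpa using hcs
  have h2 : (slopeFactor p ^ 2)⁻¹ * ((slopeFactor p ^ 2 - 1) * ∑ i, ξ i ^ 2) =
      ∑ i, ξ i ^ 2 - (slopeFactor p ^ 2)⁻¹ * ∑ i, ξ i ^ 2 := by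
    field_simp
  linarith

theorem invForm_upper (p ξ : Fin n → ℝ) :
    ∑ i, ∑ j, invForm p i j * (ξ i * ξ j) ≤ ∑ i, ξ i ^ 2 := by
  rw [invForm_quadratic]
  have : 0 ≤ (slopeFactor p ^ 2)⁻¹ * (∑ i, p i * ξ i) ^ 2 := by positivity
  linarith

theorem invForm_abs_le (p : Fin n → ℝ) (i j : Fin n) : |invForm p i j| ≤ 2 := by
  have hw := slopeFactor_pos p
  have hi : p i ^ 2 ≤ slopeFactor p ^ 2 := by
    rw [slopeFactor_sq]
    have := Finset.single_le_sum (f := fun i => p i ^ 2) (fun i _ => sq_nonneg (p i))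
      (Finset.mem_univ i)
    linarith
  have hj : p j ^ 2 ≤ slopeFactor p ^ 2 := by
    rw [slopeFactor_sq]
    have := Finset.single_le_sum (f := fun i => p i ^ 2) (fun i _ => sq_nonneg (p i))
      (Finset.mem_univ j)
    linarith
  have h1 : |(slopeFactor p ^ 2)⁻¹ * (p i * p j)| ≤ 1 := by
    rw [abs_mul, abs_of_pos (by positivity), inv_mul_le_iff₀ (by positivity), mul_one, abs_le]
    constructor <;> nlinarith [sq_nonneg (p i - p j), sq_nonneg (p i + p j)]
  have h2 : |(1 : Matrix (Fin n) (Fin n) ℝ) i j| ≤ 1 := by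
    rw [Matrix.one_apply]; split_ifs <;> simp
  simp only [invForm, Matrix.sub_apply, Matrix.smul_apply, Matrix.vecMulVec_apply, smul_eq_mul]
  exact (abs_sub _ _).trans (by linarith)

/-- The symmetric matrix `g^{-1/2} h g^{-1/2}` of the graph of a function with gradient `p` and
Hessian `X`; its eigenvalues are the principal curvatures. -/
def curvatureMatrix (p : Fin n → ℝ) (X : Matrix (Fin n) (Fin n) ℝ) : Matrix (Fin n) (Fin n) ℝ :=
  (slopeFactor p)⁻¹ • (invRootForm p * X * invRootForm p)

/-- The coefficients of the linear map `curvatureMatrix p`. -/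
def curvatureCoeff (i j k l : Fin n) (p : Fin n → ℝ) : ℝ :=
  (slopeFactor p)⁻¹ * (invRootForm p i k * invRootForm p l j)

theorem curvatureMatrix_apply (p : Fin n → ℝ) (X : Matrix (Fin n) (Fin n) ℝ) (i j : Fin n) :
    curvatureMatrix p X i j = ∑ k, ∑ l, curvatureCoeff i j k l p * X k l := by
  simp only [curvatureMatrix, curvatureCoeff, Matrix.smul_apply, Matrix.mul_apply, smul_eq_mul,
    Finset.sum_mul, Finset.mul_sum]
  rw [Finset.sum_comm]
  refine Finset.sum_congr rfl fun k _ => Finset.sum_congr rfl fun l _ => ?_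
  ring

theorem contDiff_slopeFactor : ContDiff ℝ 1 (slopeFactor (n := n)) := by
  unfold slopeFactor
  refine ContDiff.sqrt ?_ ?_
  · fun_prop
  · intro x
    positivity

theorem contDiff_invRootForm (i j : Fin n) : ContDiff ℝ 1 fun p => invRootForm p i j := by
  have h : ∀ p : Fin n → ℝ, invRootForm p i j =
      (1 : Matrix (Fin n) (Fin n) ℝ) i j -
        (slopeFactor p * (1 + slopeFactor p))⁻¹ * (p i * p j) := fun p => rfl
  simp only [h]
  refine contDiff_const.sub (ContDiff.mul (ContDiff.inv ?_ ?_) ?_)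
  · exact contDiff_slopeFactor.mul (contDiff_const.add contDiff_slopeFactor)
  · intro p
    have := slopeFactor_pos p
    positivity
  · fun_prop

theorem contDiff_curvatureCoeff (i j k l : Fin n) :
    ContDiff ℝ 1 (curvatureCoeff i j k l) := by
  unfold curvatureCoeff
  exact (contDiff_slopeFactor.inv fun p => (slopeFactor_pos p).ne').mul
    ((contDiff_invRootForm i k).mul (contDiff_invRootForm l j))

/-- The upward unit normal as a function of the gradient. -/
def normalOf (p : Fin n → ℝ) : E (n + 1) :=
  WithLp.toLp 2
    (Fin.snoc (α := fun _ => ℝ) (fun i => -p i / slopeFactor p) (1 / slopeFactor p))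

theorem contDiff_normalOf : ContDiff ℝ 1 (normalOf (n := n)) := by
  rw [contDiff_euclidean]
  intro i
  refine Fin.lastCases ?_ (fun j => ?_) i
  · simp only [normalOf, Fin.snoc_last]
    exact contDiff_const.div contDiff_slopeFactor fun p => (slopeFactor_pos p).ne'
  · simp only [normalOf, Fin.snoc_castSucc]
    exact ContDiff.div (by fun_prop) contDiff_slopeFactor fun p => (slopeFactor_pos p).ne'

theorem norm_normalOf (p : Fin n → ℝ) : ‖normalOf p‖ = 1 := by
  rw [EuclideanSpace.norm_eq, Fin.sum_univ_castSucc]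
  simp only [normalOf, Fin.snoc_last, Fin.snoc_castSucc]
  have hw := slopeFactor_pos p
  have h : ∑ i, ‖-p i / slopeFactor p‖ ^ 2 + ‖1 / slopeFactor p‖ ^ 2 = 1 := by
    simp only [Real.norm_eq_abs, sq_abs, div_pow, neg_sq]
    rw [← Finset.sum_div, ← add_div, div_eq_one_iff_eq (by positivity), slopeFactor_sq]
    ring
  rw [h, Real.sqrt_one]

/-- On bounded sets of gradients, a continuously differentiable function has bounded derivative. -/
theorem exists_bound_fderiv {F : Type*} [NormedAddCommGroup F] [NormedSpace ℝ F]
    {f : (Fin n → ℝ) → F} (hf : ContDiff ℝ 1 f) (R : ℝ) :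
    ∃ C, 0 ≤ C ∧ ∀ p : Fin n → ℝ, (∀ i, |p i| ≤ R) → ‖fderiv ℝ f p‖ ≤ C := by
  obtain ⟨C, hC⟩ := (isCompact_closedBall (0 : Fin n → ℝ) R).exists_bound_of_continuousOn
    (hf.continuous_fderiv one_ne_zero).continuousOn
  refine ⟨max C 0, le_max_right _ _, fun p hp => ?_⟩
  by_cases hR : 0 ≤ R
  · refine (hC p ?_).trans (le_max_left _ _)
    rw [mem_closedBall_zero_iff, pi_norm_le_iff_of_nonneg hR]
    exact hp
  · -- For negative `R` the hypothesis forces `n = 0`, where the derivative vanishes.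
    have : IsEmpty (Fin n) := ⟨fun i => hR ((abs_nonneg _).trans (hp i))⟩
    have h0 : fderiv ℝ f p = 0 := Subsingleton.elim _ _
    simp [h0]

end CurvatureMatrix

/-! ### The curvature operator at a point of an admissible graph -/

section GraphMatrices

variable {n : ℕ}

/-- The matrix `H - g^{-1/2} h g^{-1/2}`, which is similar to `g⁻¹ η`. -/
def etaMatrix (p : Fin n → ℝ) (X : Matrix (Fin n) (Fin n) ℝ) : Matrix (Fin n) (Fin n) ℝ :=
  (curvatureMatrix p X).trace • (1 : Matrix (Fin n) (Fin n) ℝ) - curvatureMatrix p X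

theorem firstForm_eq (u : E n → ℝ) (x : E n) :
    firstForm u x = 1 + Matrix.vecMulVec (partialDeriv u x) (partialDeriv u x) := rfl

theorem firstForm_inv (u : E n → ℝ) (x : E n) :
    (firstForm u x)⁻¹ = invForm (partialDeriv u x) :=
  Matrix.inv_eq_right_inv (one_add_mul_invForm _)

theorem inv_mul_secondForm (u : E n → ℝ) (x : E n) :
    (firstForm u x)⁻¹ * secondForm u x = invRootForm (partialDeriv u x) *
      (invRootForm (partialDeriv u x) * ((slopeFactor (partialDeriv u x))⁻¹ • hessian u x)) := by
  rw [firstForm_inv, ← invRootForm_mul_self, mul_assoc]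
  rfl

theorem curvatureMatrix_eq (p : Fin n → ℝ) (X : Matrix (Fin n) (Fin n) ℝ) :
    invRootForm p * ((slopeFactor p)⁻¹ • X) * invRootForm p = curvatureMatrix p X := by
  simp [curvatureMatrix]

theorem charpoly_inv_mul_secondForm (u : E n → ℝ) (x : E n) :
    ((firstForm u x)⁻¹ * secondForm u x).charpoly =
      (curvatureMatrix (partialDeriv u x) (hessian u x)).charpoly := by
  rw [inv_mul_secondForm, Matrix.charpoly_mul_comm, curvatureMatrix_eq]

theorem meanCurvature_eq (u : E n → ℝ) (x : E n) :
    meanCurvature u x = (curvatureMatrix (partialDeriv u x) (hessian u x)).trace := by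
  rw [meanCurvature, inv_mul_secondForm, Matrix.trace_mul_comm, curvatureMatrix_eq]

theorem charpoly_inv_mul_etaForm (u : E n → ℝ) (x : E n) :
    ((firstForm u x)⁻¹ * etaForm u x).charpoly =
      (etaMatrix (partialDeriv u x) (hessian u x)).charpoly := by
  set p := partialDeriv u x with hp
  set b := invRootForm p with hb
  have hbb : b * (b * firstForm u x) = 1 := by
    rw [← mul_assoc, hb, invRootForm_mul_self, firstForm_eq]
    exact mul_eq_one_comm.1 (one_add_mul_invForm p)
  have hbb' : b * firstForm u x * b = 1 := mul_eq_one_comm.1 hbb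
  have h1 : (firstForm u x)⁻¹ * etaForm u x =
      b * (etaMatrix p (hessian u x) * (b * firstForm u x)) := by
    have e1 : (firstForm u x)⁻¹ * firstForm u x = 1 := by
      rw [firstForm_inv]
      exact mul_eq_one_comm.1 (one_add_mul_invForm p)
    have e2 : b * (curvatureMatrix p (hessian u x) * (b * firstForm u x)) =
        (firstForm u x)⁻¹ * secondForm u x := by
      rw [← curvatureMatrix_eq, inv_mul_secondForm, ← hp, ← hb,
        mul_assoc _ b (b * firstForm u x), hbb, mul_one]
    rw [etaForm, mul_sub, Matrix.mul_smul, e1, etaMatrix, sub_mul, mul_sub, e2, Matrix.smul_mul,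
      one_mul, Matrix.mul_smul, hbb, meanCurvature_eq]
  rw [h1, Matrix.charpoly_mul_comm, mul_assoc, hbb', mul_one]

/-- The spectral theorem for real symmetric matrices, with transposes. -/
theorem exists_orthogonal_diagonalization {A : Matrix (Fin n) (Fin n) ℝ}
    (hA : A.transpose = A) : ∃ (U : Matrix (Fin n) (Fin n) ℝ) (κ : Fin n → ℝ),
      U.transpose * U = 1 ∧ A = U * Matrix.diagonal κ * U.transpose := by
  have hH : A.IsHermitian := by
    rw [Matrix.IsHermitian, Matrix.conjTranspose_eq_transpose_of_trivial, hA]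
  have hst : ∀ B : Matrix (Fin n) (Fin n) ℝ, star B = B.transpose := fun B => by
    rw [Matrix.star_eq_conjTranspose, Matrix.conjTranspose_eq_transpose_of_trivial]
  refine ⟨hH.eigenvectorUnitary, hH.eigenvalues, ?_, ?_⟩
  · rw [← hst]
    exact Unitary.coe_star_mul_self hH.eigenvectorUnitary
  · conv_lhs => rw [hH.spectral_theorem]
    rw [Unitary.conjStarAlgAut_apply, hst]
    rfl

theorem curvatureMatrix_transpose (p : Fin n → ℝ) {X : Matrix (Fin n) (Fin n) ℝ}
    (hX : X.transpose = X) : (curvatureMatrix p X).transpose = curvatureMatrix p X := by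
  rw [curvatureMatrix, Matrix.transpose_smul, Matrix.transpose_mul, Matrix.transpose_mul, hX,
    invRootForm_transpose, mul_assoc]

theorem etaMatrix_eq_conj {p : Fin n → ℝ} {X U : Matrix (Fin n) (Fin n) ℝ} {κ : Fin n → ℝ}
    (hU : U.transpose * U = 1)
    (hA : curvatureMatrix p X = U * Matrix.diagonal κ * U.transpose) :
    etaMatrix p X = U * Matrix.diagonal (fun i => ∑ j, κ j - κ i) * U.transpose := by
  have hU' : U * U.transpose = 1 := mul_eq_one_comm.1 hU
  have htr : (curvatureMatrix p X).trace = ∑ j, κ j := by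
    rw [hA, Matrix.trace_mul_comm, ← mul_assoc, hU, one_mul, Matrix.trace_diagonal]
  have hd : Matrix.diagonal (fun i => ∑ j, κ j - κ i) =
      (∑ j, κ j) • (1 : Matrix (Fin n) (Fin n) ℝ) - Matrix.diagonal κ := by
    ext i j
    by_cases h : i = j
    · subst h; simp
    · simp [h]
  rw [etaMatrix, htr, hA, hd, mul_sub, sub_mul, Matrix.mul_smul, Matrix.smul_mul, mul_one, hU']

theorem etaEigen_esymm (u : E n → ℝ) (x : E n) (hX : (hessian u x).transpose = hessian u x)
    {j : ℕ} (hj : j ≤ n) :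
    (etaEigen u x).esymm j = matEsym (etaMatrix (partialDeriv u x) (hessian u x)) j := by
  obtain ⟨U, κ, hU, hA⟩ := exists_orthogonal_diagonalization
    (curvatureMatrix_transpose (partialDeriv u x) hX)
  have hch := charpoly_conj_diagonal hU (fun i => ∑ j, κ j - κ i)
  rw [← etaMatrix_eq_conj hU hA] at hch
  rw [matEsym_eq_of_charpoly hch hj, etaEigen,
    eigen_eq_of_charpoly ((charpoly_inv_mul_etaForm u x).trans hch), esym_eq_multiset_esymm]

/-- Simultaneous diagonalization of `h` and `η` at a point where the curvatures are admissible. -/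
theorem exists_spectral_data {k : ℕ} {u : E n → ℝ} {x : E n}
    (hX : (hessian u x).transpose = hessian u x) (hadm : InGammaTilde k (graphCurvatures u x)) :
    ∃ (U : Matrix (Fin n) (Fin n) ℝ) (κ : Fin n → ℝ), U.transpose * U = 1 ∧
      curvatureMatrix (partialDeriv u x) (hessian u x) =
        U * Matrix.diagonal κ * U.transpose ∧
      PosTo Finset.univ (fun i => ∑ j, κ j - κ i) k := by
  obtain ⟨U, κ, hU, hA⟩ := exists_orthogonal_diagonalization
    (curvatureMatrix_transpose (partialDeriv u x) hX)
  refine ⟨U, κ, hU, hA, fun j hj => ?_⟩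
  cases j with
  | zero => simp
  | succ j =>
    have h := hadm (j + 1) (by omega) hj
    have hch := charpoly_conj_diagonal hU κ
    rw [← hA, ← charpoly_inv_mul_secondForm] at hch
    rw [complementarySums, graphCurvatures, eigen_eq_of_charpoly hch, Multiset.map_map] at h
    rw [← esym_eq_multiset_esymm]
    exact h

end GraphMatrices

/-! ### Elliptic coefficient matrices -/

section Elliptic

variable {n : ℕ}

/-- Uniform ellipticity of a coefficient matrix, with an upper bound for its entries. -/
def Elliptic (c C : ℝ) (L : Matrix (Fin n) (Fin n) ℝ) : Prop :=
  (∀ ξ : Fin n → ℝ, c * ∑ i, ξ i ^ 2 ≤ ∑ i, ∑ j, L i j * (ξ i * ξ j)) ∧ ∀ i j, |L i j| ≤ C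

theorem Elliptic.mono {c C c' C' : ℝ} {L : Matrix (Fin n) (Fin n) ℝ} (h : Elliptic c C L)
    (hc : c' ≤ c) (hC : C ≤ C') : Elliptic c' C' L :=
  ⟨fun ξ => (mul_le_mul_of_nonneg_right hc (by positivity)).trans (h.1 ξ),
    fun i j => (h.2 i j).trans hC⟩

/-- The linear combination with coefficients `L` of the entries of a matrix. -/
def contractMat (L X : Matrix (Fin n) (Fin n) ℝ) : ℝ := ∑ i, ∑ j, L i j * X i j

theorem abs_entry_le_one_of_row {V : Matrix (Fin n) (Fin n) ℝ} {i : Fin n}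
    (h : (V * V.transpose) i i ≤ 1) (j : Fin n) : |V i j| ≤ 1 := by
  rw [Matrix.mul_apply] at h
  have h1 := Finset.single_le_sum (f := fun j => V i j * V.transpose j i)
    (fun j _ => by rw [Matrix.transpose_apply]; exact mul_self_nonneg _) (Finset.mem_univ j)
  simp only [Matrix.transpose_apply] at h1 h
  rw [abs_le_one_iff_mul_self_le_one]
  linarith

variable {p : Fin n → ℝ} {U : Matrix (Fin n) (Fin n) ℝ}

/-- The coefficients, with respect to the Hessian, of the linear map
`X ↦ ∑ᵢ μᵢ (Uᵀ A(p, X) U)ᵢᵢ`, where `A(p, X)` is the curvature matrix. -/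
def pulledCoeff (p : Fin n → ℝ) (U : Matrix (Fin n) (Fin n) ℝ) (μ : Fin n → ℝ) :
    Matrix (Fin n) (Fin n) ℝ :=
  Matrix.of fun a b => (slopeFactor p)⁻¹ *
    ∑ i, μ i * ((invRootForm p * U) a i * (invRootForm p * U) b i)

theorem contractMat_pulledCoeff (μ : Fin n → ℝ) (X : Matrix (Fin n) (Fin n) ℝ) :
    contractMat (pulledCoeff p U μ) X =
      ∑ i, μ i * (U.transpose * curvatureMatrix p X * U) i i := by
  have h : ∀ i, (U.transpose * curvatureMatrix p X * U) i i = (slopeFactor p)⁻¹ *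
      ∑ a, ∑ b, (invRootForm p * U) a i * X a b * (invRootForm p * U) b i := by
    intro i
    have h1 : U.transpose * curvatureMatrix p X * U =
        (slopeFactor p)⁻¹ • ((invRootForm p * U).transpose * X * (invRootForm p * U)) := by
      rw [curvatureMatrix, Matrix.mul_smul, Matrix.smul_mul, Matrix.transpose_mul,
        invRootForm_transpose]
      simp only [mul_assoc]
    rw [h1, Matrix.smul_apply, smul_eq_mul, Matrix.mul_apply]
    congr 1
    simp only [Matrix.mul_apply (M := (invRootForm p * U).transpose), Finset.sum_mul]
    rw [Finset.sum_comm]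
    rfl
  simp only [h, contractMat, pulledCoeff, Matrix.of_apply, Finset.mul_sum, Finset.sum_mul]
  rw [Finset.sum_congr rfl fun a _ => Finset.sum_comm, Finset.sum_comm]
  refine Finset.sum_congr rfl fun i _ => Finset.sum_congr rfl fun a _ =>
    Finset.sum_congr rfl fun b _ => ?_
  ring

theorem pulledCoeff_elliptic (hU : U.transpose * U = 1) {μ : Fin n → ℝ} {m₀ m₁ : ℝ}
    (h0 : 0 ≤ m₀) (hm₀ : ∀ i, m₀ ≤ μ i) (hm₁ : ∀ i, μ i ≤ m₁) :
    Elliptic (m₀ * (slopeFactor p ^ 3)⁻¹) (n * m₁) (pulledCoeff p U μ) := by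
  have hw := slopeFactor_pos p
  have hU' : U * U.transpose = 1 := mul_eq_one_comm.1 hU
  set V := invRootForm p * U with hV
  have hVV : V * V.transpose = invForm p := by
    rw [hV, Matrix.transpose_mul, invRootForm_transpose, mul_assoc, ← mul_assoc U, hU', one_mul,
      invRootForm_mul_self]
  constructor
  · intro ξ
    have h1 : ∑ a, ∑ b, pulledCoeff p U μ a b * (ξ a * ξ b) =
        (slopeFactor p)⁻¹ * ∑ i, μ i * (∑ a, V a i * ξ a) ^ 2 := by
      simp only [pulledCoeff, Matrix.of_apply, ← hV, pow_two, Finset.mul_sum, Finset.sum_mul]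
      rw [Finset.sum_congr rfl fun a _ => Finset.sum_comm, Finset.sum_comm]
      refine Finset.sum_congr rfl fun i _ => Finset.sum_congr rfl fun a _ =>
        Finset.sum_congr rfl fun b _ => ?_
      ring
    have h2 : ∑ i, (∑ a, V a i * ξ a) ^ 2 = ∑ a, ∑ b, invForm p a b * (ξ a * ξ b) := by
      rw [← hVV]
      simp only [Matrix.mul_apply, Matrix.transpose_apply, pow_two, Finset.sum_mul, Finset.mul_sum]
      rw [eq_comm, Finset.sum_congr rfl fun a _ => Finset.sum_comm, Finset.sum_comm]
      refine Finset.sum_congr rfl fun i _ => Finset.sum_congr rfl fun a _ =>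
        Finset.sum_congr rfl fun b _ => ?_
      ring
    have h3 := invForm_lower p ξ
    rw [h1]
    have h4 : m₀ * ∑ i, (∑ a, V a i * ξ a) ^ 2 ≤ ∑ i, μ i * (∑ a, V a i * ξ a) ^ 2 := by
      rw [Finset.mul_sum]
      exact Finset.sum_le_sum fun i _ => mul_le_mul_of_nonneg_right (hm₀ i) (sq_nonneg _)
    rw [h2] at h4
    calc m₀ * (slopeFactor p ^ 3)⁻¹ * ∑ i, ξ i ^ 2
        = (slopeFactor p)⁻¹ * (m₀ * ((slopeFactor p ^ 2)⁻¹ * ∑ i, ξ i ^ 2)) := by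
          field_simp
      _ ≤ _ := mul_le_mul_of_nonneg_left ((mul_le_mul_of_nonneg_left h3 h0).trans h4)
          (by positivity)
  · have hent : ∀ a i, |V a i| ≤ 1 := by
      intro a i
      refine abs_entry_le_one_of_row ?_ i
      rw [hVV]
      have := invForm_upper p (Pi.single a 1)
      simpa [Pi.single_apply] using this
    intro a b
    simp only [pulledCoeff, Matrix.of_apply, ← hV]
    rw [abs_mul, abs_of_pos (inv_pos.2 hw)]
    have h1 : |∑ i, μ i * (V a i * V b i)| ≤ n * m₁ := by
      refine (Finset.abs_sum_le_sum_abs _ _).trans ?_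
      have : ∑ i, |μ i * (V a i * V b i)| ≤ ∑ _i : Fin n, m₁ := by
        refine Finset.sum_le_sum fun i _ => ?_
        rw [abs_mul, abs_mul, abs_of_nonneg (h0.trans (hm₀ i))]
        have h5 : |V a i| * |V b i| ≤ 1 :=
          mul_le_one₀ (hent a i) (abs_nonneg _) (hent b i)
        nlinarith [hm₁ i, h0.trans (hm₀ i)]
      simpa using this
    have h2 : (slopeFactor p)⁻¹ ≤ 1 := inv_le_one_of_one_le₀ (one_le_slopeFactor p)
    calc (slopeFactor p)⁻¹ * |∑ i, μ i * (V a i * V b i)|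
        ≤ 1 * |∑ i, μ i * (V a i * V b i)| := mul_le_mul_of_nonneg_right h2 (abs_nonneg _)
      _ ≤ n * m₁ := by rw [one_mul]; exact h1

theorem invForm_elliptic (p : Fin n → ℝ) : Elliptic ((slopeFactor p ^ 2)⁻¹) 2 (invForm p) :=
  ⟨invForm_lower p, invForm_abs_le p⟩

theorem contractMat_invForm (p : Fin n → ℝ) (X : Matrix (Fin n) (Fin n) ℝ)
    (hX : X.transpose = X) :
    contractMat (invForm p) X = slopeFactor p * (curvatureMatrix p X).trace := by
  rw [curvatureMatrix, Matrix.trace_smul, Matrix.trace_mul_comm, ← mul_assoc, invRootForm_mul_self,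
    smul_eq_mul, mul_inv_cancel_left₀ (slopeFactor_pos p).ne']
  simp only [contractMat, Matrix.trace, Matrix.diag, Matrix.mul_apply]
  refine Finset.sum_congr rfl fun i _ => Finset.sum_congr rfl fun j _ => ?_
  conv_rhs => rw [← hX, Matrix.transpose_apply]

end Elliptic

/-! ### Linearization of the equation -/

section Weights

variable {n k l : ℕ} {κ : Fin n → ℝ}

/-- The normalized partial derivatives, with respect to the principal curvatures, of a function
of the complementary sums whose logarithm has the partial derivatives `logGrad k l`. -/
def weight (k l : ℕ) (κ : Fin n → ℝ) (i : Fin n) : ℝ :=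
  ((∑ j, logGrad k l (fun i => ∑ j, κ j - κ i) j) - logGrad k l (fun i => ∑ j, κ j - κ i) i) /
    ∑ j, logGrad k l (fun i => ∑ j, κ j - κ i) j

/-- The chain rule for the complementary sums: the directional derivative of `log (σₖ / σₗ)` in the
direction of the complementary sums of `t`, in terms of `t`. -/
theorem sum_mul_logGrad_eq_weight (t : Fin n → ℝ)
    (hS : 0 < ∑ j, logGrad k l (fun i => ∑ j, κ j - κ i) j) :
    ∑ i, (∑ j, t j - t i) * logGrad k l (fun i => ∑ j, κ j - κ i) i =
      (∑ j, logGrad k l (fun i => ∑ j, κ j - κ i) j) * ∑ i, weight k l κ i * t i := by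
  have h : ∀ i, (∑ j, logGrad k l (fun i => ∑ j, κ j - κ i) j) * (weight k l κ i * t i) =
      ((∑ j, logGrad k l (fun i => ∑ j, κ j - κ i) j) -
        logGrad k l (fun i => ∑ j, κ j - κ i) i) * t i := by
    intro i
    rw [weight, ← mul_assoc, mul_div_cancel₀ _ hS.ne']
  rw [Finset.mul_sum]
  simp only [h, sub_mul, Finset.sum_sub_distrib, ← Finset.mul_sum]
  rw [mul_comm]
  congr 1
  exact Finset.sum_congr rfl fun i _ => mul_comm _ _

theorem sum_logGrad_pos (hlk : l < k) (hkn : k < n)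
    (hd : PosTo Finset.univ (fun i => ∑ j, κ j - κ i) k) :
    0 < ∑ j, logGrad k l (fun i => ∑ j, κ j - κ i) j := by
  have hq : 0 < esym Finset.univ (fun i => ∑ j, κ j - κ i) k /
      esym Finset.univ (fun i => ∑ j, κ j - κ i) l := div_pos (hd k le_rfl) (hd l hlk.le)
  have hn : (0 : ℝ) < n := by exact_mod_cast (by omega : 0 < n)
  have hm : k - l ≠ 0 := by omega
  have h := sum_logGrad_ge hlk hkn hd (Real.rpow_pos_of_pos hq (1 / ((k - l : ℕ) : ℝ))) (by
    rw [one_div]; exact Real.rpow_inv_natCast_pow hq.le hm)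
  exact pos_of_mul_pos_right (lt_of_lt_of_le (by positivity) h) (Real.rpow_pos_of_pos hq _).le

/-- Uniform ellipticity with respect to the principal curvatures. -/
theorem weight_bounds (hlk : l < k) (hkn : k < n)
    (hd : PosTo Finset.univ (fun i => ∑ j, κ j - κ i) k) (i : Fin n) :
    1 / (2 * n + 1) ≤ weight k l κ i ∧ weight k l κ i ≤ n := by
  have hS := sum_logGrad_pos hlk hkn hd
  have hn : (0 : ℝ) < n := by exact_mod_cast (by omega : 0 < n)
  have h1 : ∀ i, 1 / (2 * n + 1) ≤ weight k l κ i := by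
    intro i
    have h := logGrad_le_sum hlk.le hkn hd i
    rw [weight, div_le_div_iff₀ (by positivity) hS]
    set S := ∑ j, logGrad k l (fun i => ∑ j, κ j - κ i) j
    set G := logGrad k l (fun i => ∑ j, κ j - κ i) i
    rw [div_mul_eq_mul_div, one_mul, div_le_iff₀ (by positivity)] at h
    linarith
  refine ⟨h1 i, ?_⟩
  have hsum : ∑ i, weight k l κ i = n - 1 := by
    simp only [weight]
    rw [← Finset.sum_div, Finset.sum_sub_distrib]
    simp only [Finset.sum_const, Finset.card_univ, Fintype.card_fin, nsmul_eq_mul]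
    field_simp
  have := Finset.single_le_sum (f := fun i => weight k l κ i)
    (fun i _ => le_trans (by positivity) (h1 i)) (Finset.mem_univ i)
  linarith

/-- Euler's identity in terms of the weights. -/
theorem sum_weight_mul (hlk : l < k) (hkn : k < n)
    (hd : PosTo Finset.univ (fun i => ∑ j, κ j - κ i) k) :
    (∑ j, logGrad k l (fun i => ∑ j, κ j - κ i) j) * ∑ i, weight k l κ i * κ i = (k : ℝ) - l := by
  rw [← sum_mul_logGrad_eq_weight _ (sum_logGrad_pos hlk hkn hd), sum_mul_logGrad,
    logRatioDeriv_self hlk.le hd]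

end Weights

section Linearization

variable {n : ℕ}

/-- The matrix of a bilinear form in the standard basis. -/
def formMat (B : E n →L[ℝ] E n →L[ℝ] ℝ) : Matrix (Fin n) (Fin n) ℝ :=
  Matrix.of fun i j => B (EuclideanSpace.single i 1) (EuclideanSpace.single j 1)

/-- The second derivative, as a bilinear form. -/
abbrev D2 (u : E n → ℝ) (x : E n) : E n →L[ℝ] E n →L[ℝ] ℝ := fderiv ℝ (fderiv ℝ u) x

/-- The third derivative, as a trilinear form. -/
abbrev D3 (u : E n → ℝ) (x : E n) : E n →L[ℝ] E n →L[ℝ] E n →L[ℝ] ℝ :=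
  fderiv ℝ (fderiv ℝ (fderiv ℝ u)) x

theorem hessian_eq (u : E n → ℝ) (x : E n) : hessian u x = formMat (D2 u x) := by
  ext i j
  simp [hessian, formMat, iteratedFDeriv_two_apply]

theorem norm_single_one (i : Fin n) : ‖(EuclideanSpace.single i 1 : E n)‖ = 1 := by simp

theorem abs_formMat_le (B : E n →L[ℝ] E n →L[ℝ] ℝ) (i j : Fin n) : |formMat B i j| ≤ ‖B‖ := by
  have := B.le_opNorm₂ (EuclideanSpace.single i 1) (EuclideanSpace.single j 1)
  simpa [formMat] using this

theorem formMat_transpose {u : E n → ℝ} {x : E n} (h : ContDiffAt ℝ 3 u x) :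
    (formMat (D2 u x)).transpose = formMat (D2 u x) := by
  have hs : IsSymmSndFDerivAt ℝ u x := h.isSymmSndFDerivAt (by
    rw [minSmoothness_of_isRCLikeNormedField]; norm_num)
  ext i j
  exact hs _ _

variable {u : E n → ℝ} {x : E n}

theorem hasFDerivAt_fderiv (h : ContDiffAt ℝ 3 u x) :
    HasFDerivAt (fderiv ℝ u) (D2 u x) x :=
  ((h.fderiv_right (m := 2) (by norm_num)).differentiableAt (by norm_num)).hasFDerivAt

theorem hasFDerivAt_D2 (h : ContDiffAt ℝ 3 u x) :
    HasFDerivAt (fderiv ℝ (fderiv ℝ u)) (D3 u x) x :=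
  (((h.fderiv_right (m := 2) (by norm_num)).fderiv_right (m := 1)
    (by norm_num)).differentiableAt (by norm_num)).hasFDerivAt

theorem hasDerivAt_line (x a : E n) : HasDerivAt (fun s : ℝ => x + s • a) a 0 := by
  simpa using ((hasDerivAt_id (0 : ℝ)).smul_const a).const_add x

theorem hasDerivAt_comp_line {F : Type*} [NormedAddCommGroup F] [NormedSpace ℝ F] {f : E n → F}
    {f' : E n →L[ℝ] F} (h : HasFDerivAt f f' x) (a : E n) :
    HasDerivAt (fun s : ℝ => f (x + s • a)) (f' a) 0 := by
  have h' : HasFDerivAt f f' (x + (0 : ℝ) • a) := by simpa using h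
  exact h'.comp_hasDerivAt (0 : ℝ) (hasDerivAt_line x a)

theorem hasDerivAt_partialDeriv (h : ContDiffAt ℝ 3 u x) (a : E n) :
    HasDerivAt (fun s : ℝ => partialDeriv u (x + s • a))
      (fun i => D2 u x a (EuclideanSpace.single i 1)) 0 := by
  refine hasDerivAt_pi.2 fun i => ?_
  have := hasDerivAt_comp_line (hasFDerivAt_fderiv h) a
  exact this.clm_apply (hasDerivAt_const _ (EuclideanSpace.single i (1 : ℝ))) |>.congr_deriv
    (by simp)

theorem hasDerivAt_hessian (h : ContDiffAt ℝ 3 u x) (a : E n) (i j : Fin n) :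
    HasDerivAt (fun s : ℝ => hessian u (x + s • a) i j) (formMat (D3 u x a) i j) 0 := by
  simp only [hessian_eq]
  have h1 : HasDerivAt (fun s : ℝ => fderiv ℝ (fderiv ℝ u) (x + s • a)) (D3 u x a) 0 :=
    hasDerivAt_comp_line (F := E n →L[ℝ] E n →L[ℝ] ℝ) (hasFDerivAt_D2 h) a
  have h2 := h1.clm_apply (hasDerivAt_const (0 : ℝ) (EuclideanSpace.single i (1 : ℝ) : E n))
  have h3 := h2.clm_apply (hasDerivAt_const (0 : ℝ) (EuclideanSpace.single j (1 : ℝ) : E n))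
  exact h3.congr_deriv (by simp [formMat])

theorem abs_partialDeriv_le (u : E n → ℝ) (x : E n) (i : Fin n) :
    |partialDeriv u x i| ≤ ‖fderiv ℝ u x‖ := by
  have := (fderiv ℝ u x).le_opNorm (EuclideanSpace.single i 1)
  simpa [partialDeriv] using this

/-- The part of the derivative of the curvature matrix in a direction `a` that comes from the
dependence on the gradient. -/
def gradientPart (u : E n → ℝ) (x a : E n) : Matrix (Fin n) (Fin n) ℝ :=
  Matrix.of fun i j => ∑ k, ∑ l,
    fderiv ℝ (curvatureCoeff i j k l) (partialDeriv u x)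
      (fun i => D2 u x a (EuclideanSpace.single i 1)) * hessian u x k l

theorem hasDerivAt_curvatureMatrix (h : ContDiffAt ℝ 3 u x) (a : E n) (i j : Fin n) :
    HasDerivAt (fun s : ℝ => curvatureMatrix (partialDeriv u (x + s • a))
        (hessian u (x + s • a)) i j)
      ((curvatureMatrix (partialDeriv u x) (formMat (D3 u x a)) + gradientPart u x a) i j) 0 := by
  have hval : (curvatureMatrix (partialDeriv u x) (formMat (D3 u x a)) + gradientPart u x a) i j =
      ∑ k, ∑ l, (fderiv ℝ (curvatureCoeff i j k l) (partialDeriv u x)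
        (fun i => D2 u x a (EuclideanSpace.single i 1)) * hessian u x k l +
        curvatureCoeff i j k l (partialDeriv u x) * formMat (D3 u x a) k l) := by
    rw [Matrix.add_apply, curvatureMatrix_apply, gradientPart, Matrix.of_apply]
    simp only [Finset.sum_add_distrib]
    ring
  rw [hval]
  simp only [curvatureMatrix_apply]
  refine HasDerivAt.fun_sum fun k _ => HasDerivAt.fun_sum fun l _ => ?_
  have h1 : HasFDerivAt (curvatureCoeff i j k l)
      (fderiv ℝ (curvatureCoeff i j k l) (partialDeriv u (x + (0 : ℝ) • a)))
      (partialDeriv u (x + (0 : ℝ) • a)) :=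
    ((contDiff_curvatureCoeff i j k l).differentiable one_ne_zero _).hasFDerivAt
  have h2 := h1.comp_hasDerivAt (0 : ℝ) (hasDerivAt_partialDeriv h a)
  have h3 := h2.mul (hasDerivAt_hessian h a k l)
  exact h3.congr_deriv (by simp)

theorem unitNormal_eq (u : E n → ℝ) (x : E n) : unitNormal u x = normalOf (partialDeriv u x) := rfl

theorem rayExtension_of_norm_one (f : E n → ℝ → E (n + 1) → ℝ) (x : E n) (z : ℝ)
    {ν : E (n + 1)} (hν : ‖ν‖ = 1) : rayExtension f (x, z, ν) = f x z ν := by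
  simp [rayExtension, hν]

theorem norm_D2_single_le (u : E n → ℝ) (x a : E n) :
    ‖fun i => D2 u x a (EuclideanSpace.single i 1)‖ ≤ ‖D2 u x a‖ := by
  rw [pi_norm_le_iff_of_nonneg (norm_nonneg _)]
  intro i
  simpa using (D2 u x a).le_opNorm (EuclideanSpace.single i 1)

/-- Along lines, the right-hand side of the equation has a derivative that is controlled by the
second derivatives of the solution. -/
theorem exists_hasDerivAt_rhs {M₁ M₂ Cν : ℝ} {f : E n → ℝ → E (n + 1) → ℝ} {Ω : Set (E n)}
    (hopen : IsOpen Ω) (hf : IsC1Data Ω f) (hfb : C1DataBound Ω M₁ M₂ f) (hx : x ∈ Ω)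
    (hu : ContDiffAt ℝ 3 u x) (hub : C1Bound Ω M₁ u)
    (hCν : ‖fderiv ℝ (normalOf (n := n)) (partialDeriv u x)‖ ≤ Cν) (a : E n) :
    ∃ D, HasDerivAt (fun s : ℝ => f (x + s • a) (u (x + s • a)) (unitNormal u (x + s • a))) D 0 ∧
      |D| ≤ M₂ * ((1 + M₁) * ‖a‖ + Cν * ‖D2 u x a‖) := by
  obtain ⟨hu1, hu2⟩ := hub x hx
  have hM₁ : 0 ≤ M₁ := (abs_nonneg _).trans hu1
  have hCν0 : 0 ≤ Cν := (norm_nonneg _).trans hCν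
  obtain ⟨hf1, hf2⟩ := hfb x hx (u x) hu1 (unitNormal u x) (norm_normalOf _)
  have hM₂ : 0 ≤ M₂ := (abs_nonneg _).trans hf1
  have hν0 : unitNormal u x ≠ 0 := by
    intro h0
    have := norm_normalOf (partialDeriv u x)
    rw [← unitNormal_eq, h0] at this
    simp at this
  have hdiff : DifferentiableAt ℝ (rayExtension f) (x, u x, unitNormal u x) := by
    refine (hf.differentiableOn one_ne_zero).differentiableAt ?_
    refine prod_mem_nhds (Filter.mem_of_superset (hopen.mem_nhds hx) subset_closure)
      (prod_mem_nhds Filter.univ_mem (isOpen_compl_singleton.mem_nhds hν0))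
  have hP := hasDerivAt_partialDeriv hu a
  have hN : HasFDerivAt (normalOf (n := n)) (fderiv ℝ normalOf (partialDeriv u x))
      (partialDeriv u (x + (0 : ℝ) • a)) := by
    rw [zero_smul, add_zero]
    exact (contDiff_normalOf.differentiable one_ne_zero _).hasFDerivAt
  have hν := hN.comp_hasDerivAt (0 : ℝ) hP
  have hu' := hasDerivAt_comp_line (hu.differentiableAt (by norm_num)).hasFDerivAt a
  have hcurve := (hasDerivAt_line x a).prodMk (hu'.prodMk hν)
  have hdiff' : HasFDerivAt (rayExtension f) (fderiv ℝ (rayExtension f) (x, u x, unitNormal u x))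
      (x + (0 : ℝ) • a, u (x + (0 : ℝ) • a), (normalOf ∘ fun s : ℝ => partialDeriv u (x + s • a)) 0) := by
    simpa [unitNormal_eq] using hdiff.hasFDerivAt
  have hD := hdiff'.comp_hasDerivAt (0 : ℝ) hcurve
  refine ⟨_, hD.congr_of_eventuallyEq (Filter.Eventually.of_forall fun s => ?_), ?_⟩
  · exact (rayExtension_of_norm_one f _ _ (norm_normalOf _)).symm
  · rw [← Real.norm_eq_abs]
    refine (ContinuousLinearMap.le_opNorm _ _).trans ?_
    refine mul_le_mul hf2 ?_ (norm_nonneg _) hM₂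
    have h1 : ‖fderiv ℝ u x a‖ ≤ M₁ * ‖a‖ :=
      ((fderiv ℝ u x).le_opNorm a).trans (mul_le_mul_of_nonneg_right hu2 (norm_nonneg _))
    have h2 : ‖fderiv ℝ normalOf (partialDeriv u x)
        (fun i => D2 u x a (EuclideanSpace.single i 1))‖ ≤ Cν * ‖D2 u x a‖ :=
      (ContinuousLinearMap.le_opNorm _ _).trans
        (mul_le_mul hCν (norm_D2_single_le u x a) (norm_nonneg _) hCν0)
    have h3 : 0 ≤ M₁ * ‖a‖ := by positivity
    have h4 : 0 ≤ Cν * ‖D2 u x a‖ := by positivity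
    have h5 := norm_nonneg a
    rw [norm_prod_le_iff, norm_prod_le_iff]
    refine ⟨?_, ?_, ?_⟩ <;> simp only <;> linarith

end Linearization

section Linearized

variable {n : ℕ}

/-- What the maximum principle needs to know about the equation at one point: coefficient matrices
`L`, the normalized linearization, and `L'`, the inverse metric, both uniformly elliptic, such that
the second derivatives `uᵢⱼ` satisfy `L^{ij} uᵢⱼ ≤ C` (Euler's identity) and `L'^{ij} uᵢⱼ ≥ 0` (mean
convexity), and such that the third derivatives satisfy the differentiated equation. -/
def HasLinearization (c C : ℝ) (u : E n → ℝ) (x : E n) : Prop :=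
  ∃ L L' : Matrix (Fin n) (Fin n) ℝ, Elliptic c C L ∧ Elliptic c C L' ∧
    contractMat L (formMat (D2 u x)) ≤ C ∧ 0 ≤ contractMat L' (formMat (D2 u x)) ∧
    ∀ a, |contractMat L (formMat (D3 u x a))| ≤
      C * (‖a‖ + (1 + ‖D2 u x‖) * ‖D2 u x a‖)

theorem diag_conj_diagonal {U : Matrix (Fin n) (Fin n) ℝ} (hU : U.transpose * U = 1)
    (κ : Fin n → ℝ) :
    U.transpose * (U * Matrix.diagonal κ * U.transpose) * U = Matrix.diagonal κ := by
  calc U.transpose * (U * Matrix.diagonal κ * U.transpose) * U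
      = (U.transpose * U) * Matrix.diagonal κ * (U.transpose * U) := by simp only [mul_assoc]
    _ = Matrix.diagonal κ := by rw [hU]; simp

theorem abs_sum_conj_le {U B : Matrix (Fin n) (Fin n) ℝ} (hU : U.transpose * U = 1)
    {μ : Fin n → ℝ} {m β : ℝ} (hm : ∀ i, |μ i| ≤ m) (hB : ∀ i j, |B i j| ≤ β) :
    |∑ i, μ i * (U.transpose * B * U) i i| ≤ n * (m * (n * n * β)) := by
  have hU' : U * U.transpose = 1 := mul_eq_one_comm.1 hU
  have hent : ∀ a i, |U a i| ≤ 1 := fun a i =>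
    abs_entry_le_one_of_row (by rw [hU']; simp) i
  have h1 : ∀ i, |(U.transpose * B * U) i i| ≤ n * n * β := by
    intro i
    simp only [Matrix.mul_apply, Finset.sum_mul, Matrix.transpose_apply]
    refine (Finset.abs_sum_le_sum_abs _ _).trans ?_
    refine (Finset.sum_le_sum fun a _ => Finset.abs_sum_le_sum_abs _ _).trans ?_
    have : ∀ a b, |U b i * B b a * U a i| ≤ β := by
      intro a b
      rw [abs_mul, abs_mul]
      have h2 := hent b i
      have h3 := hent a i
      have h4 := hB b a
      have h5 : |U b i| * |B b a| ≤ 1 * β := mul_le_mul h2 h4 (abs_nonneg _) zero_le_one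
      have h6 : 0 ≤ |U b i| * |B b a| := by positivity
      calc |U b i| * |B b a| * |U a i| ≤ |U b i| * |B b a| * 1 :=
            mul_le_mul_of_nonneg_left h3 h6
        _ ≤ β := by linarith
    refine (Finset.sum_le_sum fun a _ => Finset.sum_le_sum fun b _ => this a b).trans ?_
    simp [mul_assoc]
  refine (Finset.abs_sum_le_sum_abs _ _).trans ?_
  refine (Finset.sum_le_sum (g := fun _ => m * (n * n * β)) fun i _ => ?_).trans (by simp)
  rw [abs_mul]
  exact mul_le_mul (hm i) (h1 i) (abs_nonneg _) ((abs_nonneg _).trans (hm i))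

theorem trace_eq_sum_conj {U : Matrix (Fin n) (Fin n) ℝ} (hU : U.transpose * U = 1)
    (A : Matrix (Fin n) (Fin n) ℝ) : A.trace = ∑ i, (U.transpose * A * U) i i := by
  have hU' : U * U.transpose = 1 := mul_eq_one_comm.1 hU
  have : (U.transpose * A * U).trace = A.trace := by
    rw [Matrix.trace_mul_comm, ← mul_assoc, hU', one_mul]
  rw [← this]
  rfl

theorem abs_gradientPart_le {u : E n → ℝ} {x : E n} {Cc : ℝ}
    (hCc : ∀ i j k l, ‖fderiv ℝ (curvatureCoeff (n := n) i j k l) (partialDeriv u x)‖ ≤ Cc)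
    (a : E n) (i j : Fin n) :
    |gradientPart u x a i j| ≤ n * n * (Cc * ‖D2 u x a‖ * ‖D2 u x‖) := by
  rw [gradientPart, Matrix.of_apply]
  refine (Finset.abs_sum_le_sum_abs _ _).trans ?_
  refine (Finset.sum_le_sum fun k _ => Finset.abs_sum_le_sum_abs _ _).trans ?_
  have : ∀ k l, |fderiv ℝ (curvatureCoeff i j k l) (partialDeriv u x)
      (fun i => D2 u x a (EuclideanSpace.single i 1)) * hessian u x k l| ≤
        Cc * ‖D2 u x a‖ * ‖D2 u x‖ := by
    intro k l
    have hCc0 : 0 ≤ Cc := (norm_nonneg _).trans (hCc i j k l)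
    rw [abs_mul, hessian_eq]
    refine mul_le_mul ?_ (abs_formMat_le _ _ _) (abs_nonneg _) (by positivity)
    rw [← Real.norm_eq_abs]
    exact (ContinuousLinearMap.le_opNorm _ _).trans
      (mul_le_mul (hCc i j k l) (norm_D2_single_le u x a) (norm_nonneg _) hCc0)
  refine (Finset.sum_le_sum fun a _ => Finset.sum_le_sum fun b _ => this a b).trans ?_
  simp [mul_assoc]

/-- The differentiated equation at one point, before the constants are made uniform. -/
theorem abs_contractMat_D3_le {k l : ℕ} (hlk : l < k) (hkn : k < n) {M₁ M₂ Cν Cc : ℝ}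
    {Ω : Set (E n)} (hopen : IsOpen Ω) {ψ : E n → ℝ → E (n + 1) → ℝ} {u : E n → ℝ}
    (hf : IsC1Data Ω (rootData (k - l) ψ)) (hfb : C1DataBound Ω M₁ M₂ (rootData (k - l) ψ))
    (hu : ∀ x ∈ Ω, ContDiffAt ℝ 3 u x)
    (heq : ∀ x ∈ Ω, (etaEigen u x).esymm k / (etaEigen u x).esymm l = ψ x (u x) (unitNormal u x))
    (hub : C1Bound Ω M₁ u) {x : E n} (hx : x ∈ Ω)
    (hCν : ‖fderiv ℝ (normalOf (n := n)) (partialDeriv u x)‖ ≤ Cν)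
    (hCc : ∀ i j k l, ‖fderiv ℝ (curvatureCoeff (n := n) i j k l) (partialDeriv u x)‖ ≤ Cc)
    {U : Matrix (Fin n) (Fin n) ℝ} {κ : Fin n → ℝ} (hU : U.transpose * U = 1)
    (hA : curvatureMatrix (partialDeriv u x) (hessian u x) = U * Matrix.diagonal κ * U.transpose)
    (hd : PosTo Finset.univ (fun i => ∑ j, κ j - κ i) k) :
    contractMat (pulledCoeff (partialDeriv u x) U (weight k l κ)) (formMat (D2 u x)) ≤
        n * n * M₂ ∧
      ∀ a, |contractMat (pulledCoeff (partialDeriv u x) U (weight k l κ)) (formMat (D3 u x a))| ≤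
        n * n * (M₂ * ((1 + M₁) * ‖a‖ + Cν * ‖D2 u x a‖)) +
          n * (n * (n * n * (n * n * (Cc * ‖D2 u x a‖ * ‖D2 u x‖)))) := by
  have hn : (0 : ℝ) < n := by exact_mod_cast (by omega : 0 < n)
  have hm0 : k - l ≠ 0 := by omega
  have hm : (0 : ℝ) < ((k - l : ℕ) : ℝ) := by exact_mod_cast (by omega : 0 < k - l)
  have hmn : ((k - l : ℕ) : ℝ) ≤ n := by exact_mod_cast (by omega : k - l ≤ n)
  have hmcast : ((k - l : ℕ) : ℝ) = (k : ℝ) - l := by rw [Nat.cast_sub hlk.le]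
  set p := partialDeriv u x with hp
  set d : Fin n → ℝ := fun i => ∑ j, κ j - κ i with hddef
  set S := ∑ j, logGrad k l d j with hSdef
  have hS : 0 < S := sum_logGrad_pos hlk hkn hd
  set F := (esym Finset.univ d k / esym Finset.univ d l) ^ (1 / ((k - l : ℕ) : ℝ)) with hF
  have hq : 0 < esym Finset.univ d k / esym Finset.univ d l := div_pos (hd k le_rfl) (hd l hlk.le)
  have hFpos : 0 < F := Real.rpow_pos_of_pos hq _
  have hFS : 1 / n ≤ F * S := sum_logGrad_ge hlk hkn hd hFpos (by
    rw [hF, one_div]; exact Real.rpow_inv_natCast_pow hq.le hm0)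
  have hFS' : 1 ≤ n * (F * S) := by
    rw [div_le_iff₀ hn] at hFS; linarith
  -- On `Ω` the equation reads `F(A(Du, D²u)) = f(x, u, ν)` with the root `f` of `ψ`.
  have hquot : ∀ y ∈ Ω, (matEsym (etaMatrix (partialDeriv u y) (hessian u y)) k /
      matEsym (etaMatrix (partialDeriv u y) (hessian u y)) l) ^ (1 / ((k - l : ℕ) : ℝ)) =
        rootData (k - l) ψ y (u y) (unitNormal u y) := by
    intro y hy
    have hsym : (hessian u y).transpose = hessian u y := by
      rw [hessian_eq]; exact formMat_transpose (hu y hy)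
    rw [← etaEigen_esymm u y hsym hkn.le, ← etaEigen_esymm u y hsym (hlk.le.trans hkn.le), heq y hy]
    rfl
  have hch := charpoly_conj_diagonal hU d
  rw [← etaMatrix_eq_conj hU hA] at hch
  have hFval : F = rootData (k - l) ψ x (u x) (unitNormal u x) := by
    rw [← hquot x hx, matEsym_eq_of_charpoly hch hkn.le,
      matEsym_eq_of_charpoly hch (hlk.le.trans hkn.le)]
  have hFM : F ≤ M₂ := by
    rw [hFval]
    exact (le_abs_self _).trans (hfb x hx (u x) (hub x hx).1 _ (norm_normalOf _)).1
  constructor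
  · rw [contractMat_pulledCoeff, ← hessian_eq, hA, diag_conj_diagonal hU]
    simp only [Matrix.diagonal_apply_eq]
    have hE := sum_weight_mul hlk hkn hd
    rw [← hmcast] at hE
    set T := ∑ i, weight k l κ i * κ i
    have h1 : T * S = ((k - l : ℕ) : ℝ) := by rw [mul_comm]; exact hE
    have hT : 0 < T := pos_of_mul_pos_left (by rw [h1]; exact hm) hS.le
    calc T = T * 1 := (mul_one _).symm
      _ ≤ T * (n * (F * S)) := mul_le_mul_of_nonneg_left hFS' hT.le
      _ = n * F * (T * S) := by ring
      _ ≤ n * M₂ * n := by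
          rw [h1]
          exact mul_le_mul (mul_le_mul_of_nonneg_left hFM hn.le) hmn hm.le
            (mul_nonneg hn.le (hFpos.le.trans hFM))
      _ = n * n * M₂ := by ring
  · intro a
    set A' := curvatureMatrix p (formMat (D3 u x a)) + gradientPart u x a with hA'
    have hcurv := hasDerivAt_curvatureMatrix (hu x hx) a
    have htr : HasDerivAt (fun s : ℝ => (curvatureMatrix (partialDeriv u (x + s • a))
        (hessian u (x + s • a))).trace) A'.trace 0 :=
      HasDerivAt.fun_sum fun i _ => hcurv i i
    have heta : ∀ i j, HasDerivAt (fun s : ℝ => etaMatrix (partialDeriv u (x + s • a))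
        (hessian u (x + s • a)) i j) ((A'.trace • (1 : Matrix (Fin n) (Fin n) ℝ) - A') i j) 0 := by
      intro i j
      simp only [etaMatrix, Matrix.sub_apply, Matrix.smul_apply, smul_eq_mul]
      exact (htr.mul_const _).sub (hcurv i j)
    have h0 : etaMatrix (partialDeriv u (x + (0 : ℝ) • a)) (hessian u (x + (0 : ℝ) • a)) =
        U * Matrix.diagonal d * U.transpose := by
      rw [zero_smul, add_zero]
      exact etaMatrix_eq_conj hU hA
    have hL := hasDerivAt_quotient hlk hkn.le hU h0 heta hd
    obtain ⟨D, hD, hDb⟩ := exists_hasDerivAt_rhs hopen hf hfb hx (hu x hx) hub hCν a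
    have hev : (fun s : ℝ => rootData (k - l) ψ (x + s • a) (u (x + s • a))
        (unitNormal u (x + s • a))) =ᶠ[nhds 0] fun s : ℝ =>
        (matEsym (etaMatrix (partialDeriv u (x + s • a)) (hessian u (x + s • a))) k /
          matEsym (etaMatrix (partialDeriv u (x + s • a)) (hessian u (x + s • a))) l) ^
            (1 / ((k - l : ℕ) : ℝ)) := by
      have hc : ContinuousAt (fun s : ℝ => x + s • a) 0 := (hasDerivAt_line x a).continuousAt
      filter_upwards [hc (by simpa using hopen.mem_nhds hx : Ω ∈ nhds (x + (0 : ℝ) • a))] with s hs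
      exact (hquot _ hs).symm
    have hDL := hD.unique (hL.congr_of_eventuallyEq hev)
    have hsum : ∑ i, (U.transpose * (A'.trace • (1 : Matrix (Fin n) (Fin n) ℝ) - A') * U) i i *
        logGrad k l d i = S * ∑ i, weight k l κ i * (U.transpose * A' * U) i i := by
      rw [← sum_mul_logGrad_eq_weight _ hS, ← trace_eq_sum_conj hU]
      refine Finset.sum_congr rfl fun i _ => ?_
      congr 1
      rw [mul_sub, sub_mul, Matrix.mul_smul, Matrix.smul_mul, mul_one, hU]
      simp
    rw [hsum, ← hF] at hDL
    have hsplit : ∑ i, weight k l κ i * (U.transpose * A' * U) i i =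
        contractMat (pulledCoeff p U (weight k l κ)) (formMat (D3 u x a)) +
          ∑ i, weight k l κ i * (U.transpose * gradientPart u x a * U) i i := by
      rw [contractMat_pulledCoeff, ← Finset.sum_add_distrib]
      refine Finset.sum_congr rfl fun i _ => ?_
      rw [hA', mul_add, add_mul, Matrix.add_apply]
      ring
    set T := ∑ i, weight k l κ i * (U.transpose * A' * U) i i with hT
    have hR := abs_sum_conj_le (B := gradientPart u x a) hU (μ := weight k l κ) (m := n)
      (fun i => by
        have := weight_bounds hlk hkn hd i
        rw [abs_of_nonneg (le_trans (by positivity) this.1)]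
        exact this.2) (abs_gradientPart_le hCc a)
    have hTb : |T| ≤ n * n * |D| := by
      have h1 : |D| * ((k - l : ℕ) : ℝ) = (F * S) * |T| := by
        rw [hDL, abs_mul, abs_mul, abs_div, abs_of_pos hFpos, abs_of_pos hm, abs_of_pos hS]
        field_simp
      calc |T| ≤ (n * (F * S)) * |T| := le_mul_of_one_le_left (abs_nonneg _) hFS'
        _ = n * (|D| * ((k - l : ℕ) : ℝ)) := by rw [h1]; ring
        _ ≤ n * (|D| * n) := by gcongr
        _ = n * n * |D| := by ring
    have hfin : contractMat (pulledCoeff p U (weight k l κ)) (formMat (D3 u x a)) =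
        T - ∑ i, weight k l κ i * (U.transpose * gradientPart u x a * U) i i := by
      rw [hsplit]; ring
    rw [hfin]
    refine (abs_sub _ _).trans (add_le_add (hTb.trans ?_) hR)
    exact mul_le_mul_of_nonneg_left hDb (by positivity)

/-- The linearization exists with uniform constants at all points of the domain. -/
theorem exists_uniform_linearization {k l : ℕ} (hk : 1 ≤ k) (hlk : l < k) (hkn : k < n)
    (M₁ M₂ : ℝ) :
    ∃ c C : ℝ, 0 < c ∧ 0 ≤ C ∧ ∀ (Ω : Set (E n)) (ψ : E n → ℝ → E (n + 1) → ℝ) (u : E n → ℝ),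
      IsOpen Ω → IsC1Data Ω (rootData (k - l) ψ) → C1DataBound Ω M₁ M₂ (rootData (k - l) ψ) →
      (∀ x ∈ Ω, ContDiffAt ℝ 3 u x) → Admissible k Ω u →
      (∀ x ∈ Ω, (etaEigen u x).esymm k / (etaEigen u x).esymm l =
        ψ x (u x) (unitNormal u x)) →
      C1Bound Ω M₁ u → ∀ x ∈ Ω, HasLinearization c C u x := by
  have hn : (0 : ℝ) < n := by exact_mod_cast (by omega : 0 < n)
  obtain ⟨Cν, hCν0, hCν⟩ := exists_bound_fderiv (contDiff_normalOf (n := n)) M₁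
  have hcc : ∀ q : Fin n × Fin n × Fin n × Fin n, ∃ C, 0 ≤ C ∧ ∀ p : Fin n → ℝ,
      (∀ i, |p i| ≤ M₁) → ‖fderiv ℝ (curvatureCoeff q.1 q.2.1 q.2.2.1 q.2.2.2) p‖ ≤ C :=
    fun q => exists_bound_fderiv (contDiff_curvatureCoeff _ _ _ _) M₁
  choose Cq hCq0 hCq using hcc
  set Cc := ∑ q, Cq q with hCcdef
  have hCc0 : 0 ≤ Cc := Finset.sum_nonneg fun q _ => hCq0 q
  set W := Real.sqrt (1 + n * M₁ ^ 2) with hW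
  have hW1 : 1 ≤ W := by
    rw [hW, Real.one_le_sqrt]
    have : 0 ≤ (n : ℝ) * M₁ ^ 2 := by positivity
    linarith
  set c := 1 / (2 * (n : ℝ) + 1) * (W ^ 3)⁻¹ with hc
  set C := n * n + 2 + n * n * |M₂| + n * n * (|M₂| * (1 + |M₁|)) + n * n * (|M₂| * Cν) +
    n * (n * (n * n * (n * n * Cc))) with hC
  refine ⟨c, C, by positivity, by positivity, ?_⟩
  intro Ω ψ u hopen hf hfb hu hadm heq hub x hx
  have hsym : (hessian u x).transpose = hessian u x := by
    rw [hessian_eq]; exact formMat_transpose (hu x hx)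
  obtain ⟨U, κ, hU, hA, hd⟩ := exists_spectral_data hsym (hadm x hx)
  have hpb : ∀ i, |partialDeriv u x i| ≤ M₁ := fun i =>
    (abs_partialDeriv_le u x i).trans (hub x hx).2
  have hM₁ : 0 ≤ M₁ := (norm_nonneg _).trans (hub x hx).2
  have hM₂ : 0 ≤ M₂ := (abs_nonneg _).trans
    (hfb x hx (u x) (hub x hx).1 _ (norm_normalOf (partialDeriv u x))).1
  rw [abs_of_nonneg hM₁, abs_of_nonneg hM₂] at hC
  have hwW : slopeFactor (partialDeriv u x) ≤ W := slopeFactor_le hpb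
  have hw := slopeFactor_pos (partialDeriv u x)
  have hw1 := one_le_slopeFactor (partialDeriv u x)
  obtain ⟨hEuler, hthird⟩ := abs_contractMat_D3_le hlk hkn hopen hf hfb hu heq hub hx
    (hCν _ hpb) (Cc := Cc) (fun i j k l => (hCq (i, j, k, l) _ hpb).trans
      (Finset.single_le_sum (f := Cq) (fun q _ => hCq0 q) (Finset.mem_univ _))) hU hA hd
  have e1 : 0 ≤ (n : ℝ) * n * M₂ := by positivity
  have e2 : 0 ≤ (n : ℝ) * n * (M₂ * (1 + M₁)) := by positivity
  have e3 : 0 ≤ (n : ℝ) * n * (M₂ * Cν) := by positivity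
  have e4 : 0 ≤ (n : ℝ) * (n * (n * n * (n * n * Cc))) := by positivity
  have e5 : 0 ≤ (n : ℝ) * n := by positivity
  have hell := pulledCoeff_elliptic (p := partialDeriv u x) hU (m₀ := 1 / (2 * (n : ℝ) + 1))
    (by positivity) (fun i => (weight_bounds hlk hkn hd i).1)
    (fun i => (weight_bounds hlk hkn hd i).2)
  have hinv3 : (W ^ 3)⁻¹ ≤ (slopeFactor (partialDeriv u x) ^ 3)⁻¹ :=
    inv_anti₀ (by positivity) (by gcongr)
  have hinv2 : c ≤ (slopeFactor (partialDeriv u x) ^ 2)⁻¹ := by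
    have h1 : 1 / (2 * (n : ℝ) + 1) ≤ 1 := by
      rw [div_le_one (by positivity)]; linarith
    have h2 : (slopeFactor (partialDeriv u x) ^ 3)⁻¹ ≤ (slopeFactor (partialDeriv u x) ^ 2)⁻¹ :=
      inv_anti₀ (by positivity) (pow_le_pow_right₀ hw1 (by norm_num))
    calc c ≤ 1 * (W ^ 3)⁻¹ := mul_le_mul_of_nonneg_right h1 (by positivity)
      _ ≤ _ := by rw [one_mul]; exact hinv3.trans h2
  refine ⟨pulledCoeff (partialDeriv u x) U (weight k l κ), invForm (partialDeriv u x),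
    hell.mono ?_ ?_, (invForm_elliptic _).mono hinv2 ?_, hEuler.trans ?_, ?_, fun a => ?_⟩
  · exact mul_le_mul_of_nonneg_left hinv3 (by positivity)
  · rw [hC]; linarith
  · rw [hC]; linarith
  · rw [hC]; linarith
  · rw [← hessian_eq, contractMat_invForm _ _ hsym, trace_eq_sum_conj hU, hA, diag_conj_diagonal hU]
    simp only [Matrix.diagonal_apply_eq]
    refine mul_nonneg hw.le ?_
    -- The sum of the complementary sums is `n - 1` times the mean curvature.
    have h1 := hd 1 hk
    have h2 : esym Finset.univ (fun i => ∑ j, κ j - κ i) 1 = (n - 1) * ∑ j, κ j := by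
      simp [esym, Finset.powersetCard_one, Finset.sum_sub_distrib]
      ring
    rw [h2] at h1
    have h3 : (1 : ℝ) < n := by exact_mod_cast (by omega : 1 < n)
    exact (pos_of_mul_pos_right h1 (by linarith)).le
  · refine (hthird a).trans ?_
    have t1 : 0 ≤ ‖a‖ := norm_nonneg _
    have t2 : 0 ≤ ‖D2 u x a‖ := norm_nonneg _
    have t3 : 0 ≤ ‖D2 u x‖ * ‖D2 u x a‖ := by positivity
    rw [hC]
    have r1 : 0 ≤ (n : ℝ) * n + 2 + n * n * M₂ := by positivity
    nlinarith [mul_nonneg r1 t1, mul_nonneg r1 t2, mul_nonneg r1 t3, mul_nonneg e2 t2,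
      mul_nonneg e2 t3, mul_nonneg e3 t1, mul_nonneg e3 t3, mul_nonneg e4 t1, mul_nonneg e4 t2]

end Linearized

/-! ### Frames adapted to the boundary and the bound for the double normal derivative -/

/-- An orthogonal splitting of Euclidean space into a hyperplane, parametrized by `J` and with
projection `Y`, and a normal line spanned by the unit vector `ν`, with coordinate `H`. -/
structure Frame (n : ℕ) where
  J : E (n - 1) →L[ℝ] E n
  ν : E n
  Y : E n →L[ℝ] E (n - 1)
  H : E n →L[ℝ] ℝ
  decomp : ∀ z, J (Y z) + H z • ν = z
  Y_J : ∀ y, Y (J y) = y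
  H_J : ∀ y, H (J y) = 0
  Y_ν : Y ν = 0
  H_ν : H ν = 1
  norm_J : ∀ y, ‖J y‖ ≤ ‖y‖
  norm_ν : ‖ν‖ = 1
  norm_Y : ∀ z, ‖Y z‖ ≤ ‖z‖
  norm_H : ∀ z, |H z| ≤ ‖z‖

section FrameBasics

variable {n : ℕ}

/-- The frame of a linear isometry. -/
def Frame.ofIsometry (T : WithLp 2 (E (n - 1) × ℝ) ≃ₗᵢ[ℝ] E n) : Frame n where
  J := (T.toContinuousLinearEquiv : WithLp 2 (E (n - 1) × ℝ) →L[ℝ] E n).comp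
    ((WithLp.prodContinuousLinearEquiv 2 ℝ (E (n - 1)) ℝ).symm.toContinuousLinearMap.comp
      (ContinuousLinearMap.inl ℝ (E (n - 1)) ℝ))
  ν := T (WithLp.toLp 2 (0, 1))
  Y := ((ContinuousLinearMap.fst ℝ (E (n - 1)) ℝ).comp
    (WithLp.prodContinuousLinearEquiv 2 ℝ (E (n - 1)) ℝ).toContinuousLinearMap).comp
      (T.symm.toContinuousLinearEquiv : E n →L[ℝ] WithLp 2 (E (n - 1) × ℝ))
  H := ((ContinuousLinearMap.snd ℝ (E (n - 1)) ℝ).comp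
    (WithLp.prodContinuousLinearEquiv 2 ℝ (E (n - 1)) ℝ).toContinuousLinearMap).comp
      (T.symm.toContinuousLinearEquiv : E n →L[ℝ] WithLp 2 (E (n - 1) × ℝ))
  decomp z := by
    obtain ⟨w, rfl⟩ := T.surjective z
    obtain ⟨⟨y, t⟩⟩ := w
    simp only [ContinuousLinearMap.coe_comp, Function.comp_apply, ContinuousLinearMap.inl_apply]
    simp
    rw [← map_smul, ← map_add]
    congr 1
    refine WithLp.ofLp_injective 2 ?_
    simp
  Y_J y := by simp
  H_J y := by simp
  Y_ν := by simp
  H_ν := by simp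
  norm_J y := by simp
  norm_ν := by simp
  norm_Y z := by
    have h := WithLp.prod_norm_sq_eq_of_L2 (T.symm z)
    rw [T.symm.norm_map] at h
    simp
    nlinarith [sq_nonneg ‖(T.symm z).snd‖, norm_nonneg z, norm_nonneg (T.symm z).fst]
  norm_H z := by
    have h := WithLp.prod_norm_sq_eq_of_L2 (T.symm z)
    rw [T.symm.norm_map] at h
    simp
    rw [← Real.norm_eq_abs]
    nlinarith [sq_nonneg ‖(T.symm z).fst‖, norm_nonneg z, norm_nonneg (T.symm z).snd]

theorem Frame.ofIsometry_decomp (T : WithLp 2 (E (n - 1) × ℝ) ≃ₗᵢ[ℝ] E n) (z : E n) :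
    T (WithLp.toLp 2 ((Frame.ofIsometry T).Y z, (Frame.ofIsometry T).H z)) = z :=
  T.apply_symm_apply z

/-- The vector tangent to a graph with slope `g` over the hyperplane of the frame. -/
def Frame.tang (f : Frame n) (g : E (n - 1) →L[ℝ] ℝ) : E (n - 1) →L[ℝ] E n :=
  f.J + g.smulRight f.ν

theorem Frame.tang_apply (f : Frame n) (g : E (n - 1) →L[ℝ] ℝ) (e : E (n - 1)) :
    f.tang g e = f.J e + g e • f.ν := rfl

/-- The tangent vectors in the coordinate directions. -/
def Frame.tangBasis (f : Frame n) (g : E (n - 1) →L[ℝ] ℝ) (β : Fin (n - 1)) : E n :=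
  f.tang g (EuclideanSpace.single β 1)

theorem eq_sum_single {m : ℕ} (y : E m) : y = ∑ β, y β • (EuclideanSpace.single β 1 : E m) := by
  ext i
  simp [Finset.sum_apply, Pi.single_apply]

theorem Frame.tang_eq_sum (f : Frame n) (g : E (n - 1) →L[ℝ] ℝ) (y : E (n - 1)) :
    f.tang g y = ∑ β, y β • f.tangBasis g β := by
  conv_lhs => rw [eq_sum_single y, map_sum]
  simp [Frame.tangBasis]

theorem Frame.norm_tang_le (f : Frame n) {g : E (n - 1) →L[ℝ] ℝ} (hg : ‖g‖ ≤ 1) (e : E (n - 1)) :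
    ‖f.tang g e‖ ≤ 2 * ‖e‖ := by
  rw [f.tang_apply]
  refine (norm_add_le _ _).trans ?_
  rw [norm_smul, f.norm_ν, mul_one]
  have := g.le_opNorm e
  have := f.norm_J e
  nlinarith [norm_nonneg e]

theorem Frame.norm_tangBasis_le (f : Frame n) {g : E (n - 1) →L[ℝ] ℝ} (hg : ‖g‖ ≤ 1)
    (β : Fin (n - 1)) : ‖f.tangBasis g β‖ ≤ 2 := by
  have := f.norm_tang_le hg (EuclideanSpace.single β 1)
  simpa [Frame.tangBasis] using this

/-- The coefficient of `ν` in the decomposition of a vector into a tangential part and a multiple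
of `ν`. -/
def Frame.height (f : Frame n) (g : E (n - 1) →L[ℝ] ℝ) : E n →L[ℝ] ℝ := f.H - g.comp f.Y

theorem Frame.tang_add_height (f : Frame n) (g : E (n - 1) →L[ℝ] ℝ) (z : E n) :
    z = f.tang g (f.Y z) + f.height g z • f.ν := by
  conv_lhs => rw [← f.decomp z]
  simp only [Frame.tang, Frame.height, add_apply,
    ContinuousLinearMap.smulRight_apply, sub_apply,
    ContinuousLinearMap.comp_apply, sub_smul]
  abel

theorem Frame.height_ν (f : Frame n) (g : E (n - 1) →L[ℝ] ℝ) : f.height g f.ν = 1 := by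
  simp [Frame.height, f.Y_ν, f.H_ν]

theorem Frame.abs_height_le (f : Frame n) {g : E (n - 1) →L[ℝ] ℝ} (hg : ‖g‖ ≤ 1) (z : E n) :
    |f.height g z| ≤ 2 * ‖z‖ := by
  simp only [Frame.height, sub_apply, ContinuousLinearMap.comp_apply]
  refine (abs_sub _ _).trans ?_
  have h1 := f.norm_H z
  have h2 := g.le_opNorm (f.Y z)
  rw [Real.norm_eq_abs] at h2
  have h3 := f.norm_Y z
  nlinarith [norm_nonneg (f.Y z), norm_nonneg g]

theorem contractMat_le_of_abs_le {c C β : ℝ} {L X : Matrix (Fin n) (Fin n) ℝ} (hL : Elliptic c C L)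
    (hX : ∀ i j, |X i j| ≤ β) : |contractMat L X| ≤ n * n * (C * β) := by
  refine (Finset.abs_sum_le_sum_abs _ _).trans ?_
  refine (Finset.sum_le_sum fun k _ => Finset.abs_sum_le_sum_abs _ _).trans ?_
  refine (Finset.sum_le_sum fun a _ => Finset.sum_le_sum (g := fun _ => C * β) fun b _ => ?_).trans ?_
  · rw [abs_mul]
    exact mul_le_mul (hL.2 a b) (hX a b) (abs_nonneg _) ((abs_nonneg _).trans (hL.2 a b))
  · simp [mul_assoc]

/-- A linear functional is bounded by its values on the standard basis. -/
theorem norm_sq_le_sum_single (φ : E n →L[ℝ] ℝ) :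
    ‖φ‖ ^ 2 ≤ ∑ i, φ (EuclideanSpace.single i 1) ^ 2 := by
  set S := ∑ i, φ (EuclideanSpace.single i 1) ^ 2
  have hS : 0 ≤ S := by positivity
  have h : ‖φ‖ ≤ Real.sqrt S := by
    refine φ.opNorm_le_bound (Real.sqrt_nonneg _) fun z => ?_
    have h1 : φ z = ∑ i, z i * φ (EuclideanSpace.single i 1) := by
      conv_lhs => rw [eq_sum_single z, map_sum]
      simp
    have h2 := Finset.sum_mul_sq_le_sq_mul_sq Finset.univ (fun i => z i)
      (fun i => φ (EuclideanSpace.single i 1))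
    rw [← h1, ← EuclideanSpace.real_norm_sq_eq] at h2
    rw [Real.norm_eq_abs]
    refine abs_le_of_sq_le_sq ?_ (by positivity)
    rw [mul_pow, Real.sq_sqrt hS]
    linarith
  calc ‖φ‖ ^ 2 ≤ Real.sqrt S ^ 2 := pow_le_pow_left₀ (norm_nonneg _) h 2
    _ = S := Real.sq_sqrt hS

theorem Frame.one_le_sum_height_sq (f : Frame n) (g : E (n - 1) →L[ℝ] ℝ) :
    1 ≤ ∑ i, f.height g (EuclideanSpace.single i 1) ^ 2 := by
  refine le_trans ?_ (norm_sq_le_sum_single _)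
  have := (f.height g).le_opNorm f.ν
  rw [f.height_ν, f.norm_ν, mul_one, norm_one] at this
  nlinarith

/-- Ellipticity bounds the double normal second derivative by the tangential and mixed ones. -/
theorem norm_le_of_elliptic {c C : ℝ} (hc : 0 < c) (hC : 0 ≤ C) (f : Frame n)
    {g : E (n - 1) →L[ℝ] ℝ} (hg : ‖g‖ ≤ 1) {L L' : Matrix (Fin n) (Fin n) ℝ}
    (hL : Elliptic c C L) (hL' : Elliptic c C L') {B : E n →L[ℝ] E n →L[ℝ] ℝ}
    (hB : ∀ v w, B v w = B w v) (h1 : contractMat L (formMat B) ≤ C)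
    (h2 : 0 ≤ contractMat L' (formMat B)) :
    ‖B‖ ≤ (4 * C / c + 3 + 12 * n * n * C / c) * (1 + ∑ β, ‖B (f.tangBasis g β)‖) := by
  set R := ∑ β, ‖B (f.tangBasis g β)‖ with hR
  have hR0 : 0 ≤ R := by positivity
  set b := B f.ν f.ν with hb
  have htang : ∀ z, ‖B (f.tang g (f.Y z))‖ ≤ R * ‖z‖ := by
    intro z
    rw [f.tang_eq_sum, map_sum]
    refine (norm_sum_le _ _).trans ?_
    rw [hR, Finset.sum_mul]
    refine Finset.sum_le_sum fun β _ => ?_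
    rw [map_smul, norm_smul, mul_comm]
    refine mul_le_mul_of_nonneg_left ?_ (norm_nonneg _)
    exact (PiLp.norm_apply_le (f.Y z) β).trans (f.norm_Y z)
  have hsplit : ∀ z w, |B z w - f.height g z * f.height g w * b| ≤ 3 * R * ‖z‖ * ‖w‖ := by
    intro z w
    have e1 : B z w = B (f.tang g (f.Y z)) w + f.height g z * B f.ν w := by
      conv_lhs => rw [f.tang_add_height g z]
      simp
    have e2 : B f.ν w = B (f.tang g (f.Y w)) f.ν + f.height g w * b := by
      conv_lhs => rw [f.tang_add_height g w]
      simp [hB f.ν (f.tang g (f.Y w)), hb]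
    have e3 : B z w - f.height g z * f.height g w * b =
        B (f.tang g (f.Y z)) w + f.height g z * B (f.tang g (f.Y w)) f.ν := by
      rw [e1, e2]; ring
    rw [e3]
    refine (abs_add_le _ _).trans ?_
    have i1 : |B (f.tang g (f.Y z)) w| ≤ R * ‖z‖ * ‖w‖ := by
      rw [← Real.norm_eq_abs]
      exact ((B (f.tang g (f.Y z))).le_opNorm w).trans
        (mul_le_mul_of_nonneg_right (htang z) (norm_nonneg _))
    have i2 : |B (f.tang g (f.Y w)) f.ν| ≤ R * ‖w‖ := by
      rw [← Real.norm_eq_abs]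
      refine ((B (f.tang g (f.Y w))).le_opNorm f.ν).trans ?_
      rw [f.norm_ν, mul_one]
      exact htang w
    rw [abs_mul]
    have i3 := mul_le_mul (f.abs_height_le hg z) i2 (abs_nonneg _) (by positivity)
    linarith
  have hcontr : ∀ M : Matrix (Fin n) (Fin n) ℝ, Elliptic c C M →
      |contractMat M (formMat B) - b * ∑ i, ∑ j, M i j *
        (f.height g (EuclideanSpace.single i 1) * f.height g (EuclideanSpace.single j 1))| ≤
          n * n * (C * (3 * R)) := by
    intro M hM
    have := contractMat_le_of_abs_le (X := Matrix.of fun i j => formMat B i j -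
      f.height g (EuclideanSpace.single i 1) * f.height g (EuclideanSpace.single j 1) * b)
      (β := 3 * R) hM (fun i j => by
        have := hsplit (EuclideanSpace.single i 1) (EuclideanSpace.single j 1)
        simpa [formMat] using this)
    refine le_of_eq_of_le ?_ this
    congr 1
    simp only [contractMat, Matrix.of_apply, mul_sub, Finset.sum_sub_distrib, Finset.mul_sum]
    congr 1
    refine Finset.sum_congr rfl fun i _ => Finset.sum_congr rfl fun j _ => ?_
    ring
  have hS := f.one_le_sum_height_sq g
  have hbb : |b| ≤ (C + n * n * (C * (3 * R))) / c := by
    rw [le_div_iff₀ hc]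
    rcases le_total 0 b with hb0 | hb0
    · have h3 := (abs_le.1 (hcontr L hL)).1
      have h4 := hL.1 fun i => f.height g (EuclideanSpace.single i 1)
      have h5 : c ≤ ∑ i, ∑ j, L i j * (f.height g (EuclideanSpace.single i 1) *
          f.height g (EuclideanSpace.single j 1)) := by nlinarith
      have h6 := mul_le_mul_of_nonneg_left h5 hb0
      rw [abs_of_nonneg hb0]
      linarith
    · have h3 := (abs_le.1 (hcontr L' hL')).2
      have h4 := hL'.1 fun i => f.height g (EuclideanSpace.single i 1)
      have h5 : c ≤ ∑ i, ∑ j, L' i j * (f.height g (EuclideanSpace.single i 1) *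
          f.height g (EuclideanSpace.single j 1)) := by nlinarith
      have h6 := mul_le_mul_of_nonneg_left h5 (neg_nonneg.2 hb0)
      rw [abs_of_nonpos hb0]
      linarith
  have hBn : ‖B‖ ≤ 3 * R + 4 * |b| := by
    refine B.opNorm_le_bound (by positivity) fun z => ?_
    refine (B z).opNorm_le_bound (by positivity) fun w => ?_
    have h3 := hsplit z w
    have h4 : |f.height g z * f.height g w * b| ≤ 4 * |b| * ‖z‖ * ‖w‖ := by
      rw [abs_mul, abs_mul]
      have := mul_le_mul (f.abs_height_le hg z) (f.abs_height_le hg w) (abs_nonneg _)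
        (by positivity)
      nlinarith [abs_nonneg b]
    rw [Real.norm_eq_abs]
    have h5 : B z w = (B z w - f.height g z * f.height g w * b) + f.height g z * f.height g w * b := by
      ring
    rw [h5]
    refine (abs_add_le _ _).trans ?_
    linarith
  have hfin : 3 * R + 4 * ((C + n * n * (C * (3 * R))) / c) =
      4 * C / c + (3 + 12 * n * n * C / c) * R := by
    field_simp
    ring
  have p1 : 0 ≤ 4 * C / c := by positivity
  have p2 : 0 ≤ 12 * n * n * C / c := by positivity
  nlinarith [mul_nonneg p1 hR0]

end FrameBasics

/-! ### The second derivative test and the maximum principle -/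

section SecondDerivative

variable {n : ℕ}

/-- At a local maximum the second derivative is nonpositive. -/
theorem second_deriv_nonpos_of_isLocalMax {g g' : ℝ → ℝ} {b : ℝ}
    (hg : ∀ᶠ s in nhds 0, HasDerivAt g (g' s) s) (hg' : HasDerivAt g' b 0)
    (hmax : IsLocalMax g 0) : b ≤ 0 := by
  by_contra! hb
  have h1 : deriv g =ᶠ[nhds 0] g' := hg.mono fun s hs => hs.deriv
  have h2 : deriv (deriv g) 0 = b := (h1.deriv_eq).trans hg'.deriv
  have h3 : IsLocalMin g 0 := isLocalMin_of_deriv_deriv_pos (by rw [h2]; exact hb)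
    hmax.deriv_eq_zero hg.self_of_nhds.continuousAt
  -- A function with a local maximum and a local minimum at a point is locally constant there.
  have h4 : g =ᶠ[nhds 0] fun _ => g 0 := by
    filter_upwards [hmax, h3] with s hs1 hs2 using le_antisymm hs1 hs2
  have h5 : deriv g =ᶠ[nhds 0] fun _ => 0 := by
    have := h4.deriv
    simpa using this
  have h6 : deriv (deriv g) 0 = 0 := by
    rw [h5.deriv_eq]; simp
  linarith

theorem bilinear_nonpos_of_isLocalMax {Θ : E n → ℝ} {DΘ : E n → E n →L[ℝ] ℝ}
    {B : E n →L[ℝ] E n →L[ℝ] ℝ} {x : E n} (hΘ : ∀ᶠ y in nhds x, HasFDerivAt Θ (DΘ y) y)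
    (hDΘ : HasFDerivAt DΘ B x) (hmax : IsLocalMax Θ x) (z : E n) : B z z ≤ 0 := by
  have hcont : Filter.Tendsto (fun s : ℝ => x + s • z) (nhds 0) (nhds x) := by
    have : Continuous fun s : ℝ => x + s • z := by fun_prop
    simpa using this.tendsto 0
  refine second_deriv_nonpos_of_isLocalMax (g := fun s => Θ (x + s • z))
    (g' := fun s => DΘ (x + s • z) z) ?_ ?_ ?_
  · filter_upwards [hcont.eventually hΘ] with s hs
    have hl : HasDerivAt (fun s : ℝ => x + s • z) z s := by
      simpa using ((hasDerivAt_id s).smul_const z).const_add x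
    exact hs.comp_hasDerivAt s hl
  · have h1 := hasDerivAt_comp_line (F := E n →L[ℝ] ℝ) hDΘ z
    exact (h1.clm_apply (hasDerivAt_const (0 : ℝ) z)).congr_deriv (by simp)
  · have h2 := hcont.eventually hmax
    filter_upwards [h2] with s hs
    simpa using hs

theorem bilinear_eq_sum (B : E n →L[ℝ] E n →L[ℝ] ℝ) (v w : E n) :
    B v w = ∑ i, ∑ j, formMat B i j * (v i * w j) := by
  conv_lhs => rw [eq_sum_single v, eq_sum_single w]
  simp only [map_sum, map_smul, FunLike.coe_sum, Finset.sum_apply,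
    FunLike.coe_smul, Pi.smul_apply, smul_eq_mul, formMat, Matrix.of_apply,
    Finset.mul_sum]
  rw [Finset.sum_comm]
  refine Finset.sum_congr rfl fun i _ => Finset.sum_congr rfl fun j _ => ?_
  ring

/-- The contraction of a positive and a negative semidefinite matrix is nonpositive. -/
theorem contractMat_nonpos {c C : ℝ} (hc : 0 ≤ c) {L : Matrix (Fin n) (Fin n) ℝ}
    (hL : Elliptic c C L) {B : E n →L[ℝ] E n →L[ℝ] ℝ} (hB : ∀ v w, B v w = B w v)
    (hneg : ∀ z, B z z ≤ 0) : contractMat L (formMat B) ≤ 0 := by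
  have hsymm : (formMat B).transpose = formMat B := by
    ext i j
    exact hB _ _
  obtain ⟨U, κ, hU, hA⟩ := exists_orthogonal_diagonalization hsymm
  have hκ : ∀ k, κ k ≤ 0 := by
    intro k
    have h1 := hneg (WithLp.toLp 2 fun i => U i k)
    rw [bilinear_eq_sum] at h1
    have h2 : (U.transpose * formMat B * U) k k = κ k := by
      conv_lhs => rw [hA, diag_conj_diagonal hU]
      simp
    rw [← h2]
    refine le_of_eq_of_le ?_ h1
    simp only [Matrix.mul_apply, Matrix.transpose_apply, Finset.sum_mul]
    rw [Finset.sum_comm]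
    refine Finset.sum_congr rfl fun i _ => Finset.sum_congr rfl fun j _ => ?_
    ring
  have h3 : contractMat L (formMat B) = ∑ k, κ k * ∑ i, ∑ j, L i j * (U i k * U j k) := by
    rw [hA]
    simp only [contractMat, Matrix.mul_apply, Matrix.diagonal_apply, Matrix.transpose_apply,
      mul_ite, mul_zero, Finset.sum_ite_eq', Finset.mem_univ, if_true, Finset.mul_sum]
    rw [Finset.sum_congr rfl fun a _ => Finset.sum_comm, Finset.sum_comm]
    refine Finset.sum_congr rfl fun k _ => Finset.sum_congr rfl fun i _ =>
      Finset.sum_congr rfl fun j _ => ?_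
    ring
  rw [h3]
  refine Finset.sum_nonpos fun k _ => mul_nonpos_of_nonpos_of_nonneg (hκ k) ?_
  exact le_trans (mul_nonneg hc (by positivity)) (hL.1 fun i => U i k)

/-- At an interior maximum of `exp (A Q) - A v`, the second derivatives of `Q` and `v` are ordered,
and the exponential contributes a term that is quadratic in the gradient of `Q`. -/
theorem contractMat_le_of_isLocalMax_exp {c C A : ℝ} (hc : 0 ≤ c) (hA : 0 < A)
    {L : Matrix (Fin n) (Fin n) ℝ} (hL : Elliptic c C L) {Q v : E n → ℝ}
    {DQ Dv : E n → E n →L[ℝ] ℝ} {BQ Bv : E n →L[ℝ] E n →L[ℝ] ℝ} {x : E n}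
    (hQ : ∀ᶠ y in nhds x, HasFDerivAt Q (DQ y) y) (hv : ∀ᶠ y in nhds x, HasFDerivAt v (Dv y) y)
    (hDQ : HasFDerivAt DQ BQ x) (hDv : HasFDerivAt Dv Bv x)
    (hmax : IsLocalMax (fun y => Real.exp (A * Q y) - A * v y) x) :
    Real.exp (A * Q x) * (contractMat L (formMat BQ) + A * (c * ‖DQ x‖ ^ 2)) ≤
      contractMat L (formMat Bv) := by
  set Θ : E n → ℝ := fun y => Real.exp (A * Q y) - A * v y with hΘ
  set DΘ : E n → E n →L[ℝ] ℝ := fun y => (Real.exp (A * Q y) * A) • DQ y - A • Dv y with hDΘ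
  have h1 : ∀ᶠ y in nhds x, HasFDerivAt Θ (DΘ y) y := by
    filter_upwards [hQ, hv] with y h1 h2
    have h3 := (h1.const_mul A).exp.sub (h2.const_mul A)
    refine h3.congr_fderiv ?_
    rw [hDΘ, smul_smul]
  have hQx := hQ.self_of_nhds
  obtain ⟨B, hB, hBf⟩ : ∃ B : E n →L[ℝ] E n →L[ℝ] ℝ, HasFDerivAt DΘ B x ∧
      ∀ z w, B z w = Real.exp (A * Q x) * A * (A * (DQ x z * DQ x w) + BQ z w) - A * Bv z w := by
    have h3 := ((((hQx.const_mul A).exp.mul_const A).smul hDQ).sub (hDv.const_smul A))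
    refine ⟨_, h3, fun z w => ?_⟩
    simp
    ring
  have hBs : ∀ z w, B z w = B w z := fun z w =>
    second_derivative_symmetric_of_eventually h1 hB z w
  have h4 := contractMat_nonpos hc hL hBs (bilinear_nonpos_of_isLocalMax h1 hB hmax)
  have h5 : contractMat L (formMat B) = A * (Real.exp (A * Q x) * (contractMat L (formMat BQ) +
      A * ∑ i, ∑ j, L i j * (DQ x (EuclideanSpace.single i 1) * DQ x (EuclideanSpace.single j 1))) -
        contractMat L (formMat Bv)) := by
    simp only [contractMat, formMat, Matrix.of_apply, hBf, Finset.mul_sum, mul_add, mul_sub,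
      Finset.sum_add_distrib, Finset.sum_sub_distrib]
    rw [add_comm]
    congr 1
    · congr 1 <;>
      exact Finset.sum_congr rfl fun i _ => Finset.sum_congr rfl fun j _ => by ring
    · exact Finset.sum_congr rfl fun i _ => Finset.sum_congr rfl fun j _ => by ring
  rw [h5] at h4
  have h6 := nonpos_of_mul_nonpos_right h4 hA
  have h7 := hL.1 fun i => DQ x (EuclideanSpace.single i 1)
  have h8 := mul_le_mul_of_nonneg_left (norm_sq_le_sum_single (DQ x)) hc
  have h9 := mul_le_mul_of_nonneg_left (h8.trans h7) hA.le
  have h10 := mul_le_mul_of_nonneg_left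
    (add_le_add_right h9 (contractMat L (formMat BQ))) (Real.exp_pos (A * Q x)).le
  linarith

/-- A comparison principle for `exp (A Q)` and `1 + A v`, when `v` is a strict supersolution for
the linearized equation. -/
theorem exp_le_of_boundary {c C A C₂ Q₀ Λ : ℝ} (hc : 0 ≤ c) (hA : 0 < A) (hC₂ : 0 ≤ C₂)
    (hΛ : C₂ * Real.exp (A * Q₀) < Λ) {U : Set (E n)} (hU : IsOpen U)
    (hbdd : Bornology.IsBounded U) {Q v : E n → ℝ} (hQc : ContinuousOn Q (closure U))
    (hvc : ContinuousOn v (closure U)) {DQ Dv : E n → E n →L[ℝ] ℝ}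
    {BQ Bv : E n → E n →L[ℝ] E n →L[ℝ] ℝ}
    (hQ : ∀ x ∈ U, HasFDerivAt Q (DQ x) x) (hv : ∀ x ∈ U, HasFDerivAt v (Dv x) x)
    (hDQ : ∀ x ∈ U, HasFDerivAt DQ (BQ x) x) (hDv : ∀ x ∈ U, HasFDerivAt Dv (Bv x) x)
    (hQ₀ : ∀ x ∈ U, Q x ≤ Q₀)
    (hL : ∀ x ∈ U, ∃ L : Matrix (Fin n) (Fin n) ℝ, Elliptic c C L ∧
      -C₂ ≤ contractMat L (formMat (BQ x)) + A * (c * ‖DQ x‖ ^ 2) ∧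
      contractMat L (formMat (Bv x)) ≤ -Λ)
    (hbd : ∀ x ∈ closure U, x ∉ U → Real.exp (A * Q x) ≤ 1 + A * v x) :
    ∀ x ∈ closure U, Real.exp (A * Q x) ≤ 1 + A * v x := by
  intro x hx
  have hcompact : IsCompact (closure U) := hbdd.isCompact_closure
  have hcont : ContinuousOn (fun y => Real.exp (A * Q y) - A * v y) (closure U) :=
    (Real.continuous_exp.comp_continuousOn (continuousOn_const.mul hQc)).sub
      (continuousOn_const.mul hvc)
  obtain ⟨y, hy, hymax⟩ := hcompact.exists_isMaxOn ⟨x, hx⟩ hcont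
  have hxy : Real.exp (A * Q x) - A * v x ≤ Real.exp (A * Q y) - A * v y := hymax hx
  by_cases hyU : y ∈ U
  · exfalso
    have hnhds := hU.mem_nhds hyU
    have hloc : IsLocalMax (fun y => Real.exp (A * Q y) - A * v y) y := by
      filter_upwards [hnhds] with z hz using hymax (subset_closure hz)
    obtain ⟨L, hL1, hL2, hL3⟩ := hL y hyU
    have h1 := contractMat_le_of_isLocalMax_exp hc hA hL1
      (Filter.mem_of_superset hnhds hQ) (Filter.mem_of_superset hnhds hv) (hDQ y hyU) (hDv y hyU)
      hloc
    have h2 : -(C₂ * Real.exp (A * Q₀)) ≤ Real.exp (A * Q y) *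
        (contractMat L (formMat (BQ y)) + A * (c * ‖DQ y‖ ^ 2)) := by
      have h3 : Real.exp (A * Q y) ≤ Real.exp (A * Q₀) :=
        Real.exp_le_exp.2 (mul_le_mul_of_nonneg_left (hQ₀ y hyU) hA.le)
      have h4 := mul_le_mul_of_nonneg_left hL2 (Real.exp_pos (A * Q y)).le
      have h5 := mul_le_mul_of_nonneg_left h3 hC₂
      linarith
    linarith
  · have := hbd y hy hyU
    linarith

end SecondDerivative

/-! ### The test function for the mixed second derivatives -/

section TestFunction

variable {n : ℕ}

/-- The variation of the tangential direction `e` of a graph with Hessian `S` at the origin. -/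
def Frame.turn (f : Frame n) (S : E (n - 1) →L[ℝ] E (n - 1) →L[ℝ] ℝ) (e : E (n - 1)) :
    E n →L[ℝ] E n :=
  ((S.flip e).comp f.Y).smulRight f.ν

theorem Frame.turn_apply (f : Frame n) (S : E (n - 1) →L[ℝ] E (n - 1) →L[ℝ] ℝ) (e : E (n - 1))
    (z : E n) : f.turn S e z = S (f.Y z) e • f.ν := rfl

theorem Frame.norm_turn_le (f : Frame n) {S : E (n - 1) →L[ℝ] E (n - 1) →L[ℝ] ℝ} {e : E (n - 1)}
    {K : ℝ} (hS : ‖S‖ ≤ K) (he : ‖e‖ ≤ 1) : ‖f.turn S e‖ ≤ K := by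
  have hK : 0 ≤ K := (norm_nonneg S).trans hS
  refine ContinuousLinearMap.opNorm_le_bound _ hK fun z => ?_
  rw [f.turn_apply, norm_smul, f.norm_ν, mul_one]
  refine (S.le_opNorm₂ _ _).trans ?_
  have h1 := f.norm_Y z
  calc ‖S‖ * ‖f.Y z‖ * ‖e‖ ≤ K * ‖z‖ * 1 := by gcongr
    _ = K * ‖z‖ := mul_one _

/-- A vector field that is tangent to a graph with slope `g` and Hessian `S` at `q` up to an error
of second order. -/
def Frame.field (f : Frame n) (g : E (n - 1) →L[ℝ] ℝ) (S : E (n - 1) →L[ℝ] E (n - 1) →L[ℝ] ℝ)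
    (e : E (n - 1)) (q x : E n) : E n :=
  f.tang g e + f.turn S e (x - q)

/-- The test function: a derivative along the field `Frame.field`, plus the squares of the
derivatives in the directions that are tangent at the base point. The argument `D` stands for the
gradient of the solution. -/
def Frame.testFn (f : Frame n) (g : E (n - 1) →L[ℝ] ℝ) (S : E (n - 1) →L[ℝ] E (n - 1) →L[ℝ] ℝ)
    (e : E (n - 1)) (q : E n) (D : E n → E n →L[ℝ] ℝ) (x : E n) : ℝ :=
  D x (f.field g S e q x) + ∑ β, D x (f.tangBasis g β) ^ 2

/-- The direction in which the second derivative enters the gradient of the test function. -/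
def Frame.testDir (f : Frame n) (g : E (n - 1) →L[ℝ] ℝ) (S : E (n - 1) →L[ℝ] E (n - 1) →L[ℝ] ℝ)
    (e : E (n - 1)) (q : E n) (D : E n → E n →L[ℝ] ℝ) (x : E n) : E n :=
  f.field g S e q x + ∑ β, (2 * D x (f.tangBasis g β)) • f.tangBasis g β

variable (f : Frame n) (g : E (n - 1) →L[ℝ] ℝ) (S : E (n - 1) →L[ℝ] E (n - 1) →L[ℝ] ℝ)
  (e : E (n - 1)) (q : E n)

/-- The gradient of the test function. -/
def Frame.testGrad (D : E n → E n →L[ℝ] ℝ) (B : E n → E n →L[ℝ] E n →L[ℝ] ℝ) (x : E n) :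
    E n →L[ℝ] ℝ :=
  B x (f.testDir g S e q D x) + (D x).comp (f.turn S e)

variable {D : E n → E n →L[ℝ] ℝ} {B : E n → E n →L[ℝ] E n →L[ℝ] ℝ}
  {T : E n →L[ℝ] E n →L[ℝ] E n →L[ℝ] ℝ} {x : E n} {s : Set (E n)}

theorem Frame.hasFDerivAt_field : HasFDerivAt (f.field g S e q) (f.turn S e) x := by
  have h : HasFDerivAt (fun x : E n => x - q) (ContinuousLinearMap.id ℝ (E n)) x :=
    (hasFDerivAt_id x).sub_const q
  have := ((f.turn S e).hasFDerivAt.comp x h).const_add (f.tang g e)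
  exact this

theorem Frame.hasFDerivWithinAt_testFn (hD : HasFDerivWithinAt D (B x) s x)
    (hB : ∀ v w, B x v w = B x w v) :
    HasFDerivWithinAt (f.testFn g S e q D) (f.testGrad g S e q D B x) s x := by
  have h1 := hD.clm_apply (f.hasFDerivAt_field g S e q (x := x)).hasFDerivWithinAt
  have h2 : ∀ β ∈ Finset.univ, HasFDerivWithinAt (fun y => D y (f.tangBasis g β) ^ 2)
      ((2 * D x (f.tangBasis g β)) • (B x).flip (f.tangBasis g β)) s x := by
    intro β _
    have h3 := (hD.clm_apply (hasFDerivWithinAt_const (f.tangBasis g β) x s)).pow 2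
    refine h3.congr_fderiv ?_
    ext z
    simp
  refine (h1.add (HasFDerivWithinAt.fun_sum h2)).congr_fderiv ?_
  ext z
  simp [Frame.testGrad, Frame.testDir, hB z]
  ring

theorem Frame.hasFDerivAt_testFn (hD : HasFDerivAt D (B x) x)
    (hB : ∀ v w, B x v w = B x w v) :
    HasFDerivAt (f.testFn g S e q D) (f.testGrad g S e q D B x) x := by
  rw [← hasFDerivWithinAt_univ] at hD ⊢
  exact f.hasFDerivWithinAt_testFn g S e q hD hB

theorem Frame.hasFDerivAt_testDir (hD : HasFDerivAt D (B x) x) :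
    ∃ A : E n →L[ℝ] E n, HasFDerivAt (f.testDir g S e q D) A x ∧ ∀ v, A v = f.turn S e v +
      ∑ β, (2 * B x v (f.tangBasis g β)) • f.tangBasis g β := by
  have h2 : ∀ β ∈ Finset.univ, HasFDerivAt
      (fun y => (2 * D y (f.tangBasis g β)) • f.tangBasis g β)
      (((2 : ℝ) • (B x).flip (f.tangBasis g β)).smulRight (f.tangBasis g β)) x := by
    intro β _
    have h3 := ((hD.clm_apply (hasFDerivAt_const (f.tangBasis g β) x)).const_mul 2).smul_const
      (f.tangBasis g β)
    refine h3.congr_fderiv ?_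
    ext z
    simp
  refine ⟨_, (f.hasFDerivAt_field g S e q).add (HasFDerivAt.fun_sum h2), fun v => ?_⟩
  simp

theorem Frame.hasFDerivAt_testGrad (hD : HasFDerivAt D (B x) x) (hB : HasFDerivAt B T x) :
    ∃ BQ : E n →L[ℝ] E n →L[ℝ] ℝ, HasFDerivAt (f.testGrad g S e q D B) BQ x ∧
      ∀ v w, BQ v w = T v (f.testDir g S e q D x) w + (B x (f.turn S e v) w +
        B x v (f.turn S e w)) +
        ∑ β, 2 * B x v (f.tangBasis g β) * B x (f.tangBasis g β) w := by
  obtain ⟨A, hA, hAf⟩ := f.hasFDerivAt_testDir g S e q hD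
  have h2 := hB.clm_apply hA
  have h3 := hD.clm_comp (hasFDerivAt_const (f.turn S e) x)
  refine ⟨_, h2.add h3, fun v w => ?_⟩
  simp only [add_apply, ContinuousLinearMap.flip_apply, ContinuousLinearMap.comp_apply,
    ContinuousLinearMap.compL_apply, hAf, map_add, map_sum, map_smul,
    zero_apply, ContinuousLinearMap.comp_zero, smul_eq_mul,
    FunLike.coe_sum, Finset.sum_apply, FunLike.coe_smul, Pi.smul_apply]
  ring

end TestFunction

section TestEstimate

variable {n : ℕ}

/-- The differential inequality for the test function, up to the choice of constants. The square
terms of the test function dominate all terms that are linear in the second derivatives. -/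
theorem contractMat_test_ge {c C M₁ KR Kα Cg m P : ℝ} (hc : 0 < c) (hC : 0 ≤ C) (hM₁ : 0 ≤ M₁)
    (hKR : 0 ≤ KR) (hCg : 0 < Cg) {N : Fin (n - 1) → ℝ} (hn : 1 ≤ n) (hm : 0 ≤ m)
    (hN : ∀ β, 0 ≤ N β) (hgrowth : m ≤ Cg * (1 + ∑ β, N β)) {X t b : ℝ}
    (ht : |t| ≤ C * (Kα + (1 + m) * (P + M₁ * KR))) (hb : |b| ≤ n * n * (C * (2 * (m * KR))))
    (hX : t + b + 2 * c * ∑ β, N β ^ 2 ≤ X) (hKα : 0 ≤ Kα) :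
    -(2 * c + c / (n * Cg ^ 2) + (C * (Kα + M₁ * KR) + n * n * (C * (2 * KR))) +
      (C * (Kα + M₁ * KR) + n * n * (C * (2 * KR))) ^ 2 / (c / (n * Cg ^ 2))) -
        C ^ 2 / (c / (n * Cg ^ 2)) * P ^ 2 ≤ X := by
  have hn' : (1 : ℝ) ≤ n := by exact_mod_cast hn
  set κ := c / (n * Cg ^ 2) with hκ
  have hκ0 : 0 < κ := by positivity
  set C₃ := C * (Kα + M₁ * KR) + n * n * (C * (2 * KR)) with hC₃
  have hC₃0 : 0 ≤ C₃ := by positivity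
  set s₁ := ∑ β, N β with hs₁
  set s₂ := ∑ β, N β ^ 2 with hs₂
  have hs₁_nonneg : 0 ≤ s₁ := Finset.sum_nonneg fun β _ => hN β
  have hcs : s₁ ^ 2 ≤ n * s₂ := by
    have h1 := Finset.sum_mul_sq_le_sq_mul_sq Finset.univ (fun _ : Fin (n - 1) => (1 : ℝ)) N
    simp only [one_mul, one_pow, Finset.sum_const, Finset.card_univ, Fintype.card_fin,
      nsmul_eq_mul, mul_one] at h1
    have h2 : ((n - 1 : ℕ) : ℝ) ≤ n := by exact_mod_cast Nat.sub_le n 1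
    have h3 : 0 ≤ s₂ := Finset.sum_nonneg fun β _ => sq_nonneg _
    nlinarith
  have hm2 : κ * m ^ 2 ≤ 2 * c + 2 * c * s₂ := by
    have h1 : m ^ 2 ≤ Cg ^ 2 * (1 + s₁) ^ 2 := by
      rw [← mul_pow]; exact pow_le_pow_left₀ hm hgrowth 2
    have h2 : (1 + s₁) ^ 2 ≤ n * (2 + 2 * s₂) := by nlinarith [sq_nonneg (1 - s₁)]
    have h3 : m ^ 2 ≤ Cg ^ 2 * (n * (2 + 2 * s₂)) :=
      h1.trans (mul_le_mul_of_nonneg_left h2 (by positivity))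
    calc κ * m ^ 2 ≤ κ * (Cg ^ 2 * (n * (2 + 2 * s₂))) := mul_le_mul_of_nonneg_left h3 hκ0.le
      _ = 2 * c + 2 * c * s₂ := by rw [hκ]; field_simp
  have ht' := (abs_le.1 ht).1
  have hb' := (abs_le.1 hb).1
  have hlin : C * (Kα + (1 + m) * (P + M₁ * KR)) + n * n * (C * (2 * (m * KR))) ≤
      C₃ * (1 + m) + C * ((1 + m) * P) := by
    rw [hC₃]
    have e1 : 0 ≤ C * (Kα * m) := by positivity
    have e2 : 0 ≤ n * n * (C * (2 * KR)) := by positivity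
    nlinarith
  -- Young's inequality for the two mixed terms
  have hy1 : C * ((1 + m) * P) ≤ κ / 4 * (1 + m) ^ 2 + C ^ 2 / κ * P ^ 2 := by
    have h1 : 0 ≤ (κ / 2 * (1 + m) - C * P) ^ 2 / κ := by positivity
    have h2 : (κ / 2 * (1 + m) - C * P) ^ 2 / κ =
        κ / 4 * (1 + m) ^ 2 + C ^ 2 / κ * P ^ 2 - C * ((1 + m) * P) := by
      field_simp
      ring
    linarith
  have hy2 : C₃ * m ≤ κ / 4 * m ^ 2 + C₃ ^ 2 / κ := by
    have h1 : 0 ≤ (κ / 2 * m - C₃) ^ 2 / κ := by positivity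
    have h2 : (κ / 2 * m - C₃) ^ 2 / κ = κ / 4 * m ^ 2 + C₃ ^ 2 / κ - C₃ * m := by
      field_simp
      ring
    linarith
  have hsq : (1 + m) ^ 2 ≤ 2 + 2 * m ^ 2 := by nlinarith [sq_nonneg (1 - m)]
  have hsq' := mul_le_mul_of_nonneg_left hsq (by positivity : 0 ≤ κ / 4)
  have hκm : 0 ≤ κ * m ^ 2 := by positivity
  nlinarith

end TestEstimate

section TestInterior

variable {n : ℕ}

theorem D2_symm {u : E n → ℝ} {x : E n} (h : ContDiffAt ℝ 3 u x) (v w : E n) :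
    D2 u x v w = D2 u x w v :=
  (h.isSymmSndFDerivAt (by rw [minSmoothness_of_isRCLikeNormedField]; norm_num)) v w

theorem D3_symm {u : E n → ℝ} {x : E n} (h : ContDiffAt ℝ 3 u x) (v w z : E n) :
    D3 u x v w z = D3 u x w v z := by
  have h2 : ContDiffAt ℝ 2 (fderiv ℝ u) x := h.fderiv_right (by norm_num)
  have := (h2.isSymmSndFDerivAt (by rw [minSmoothness_of_isRCLikeNormedField])) v w
  exact congrArg (fun φ : E n →L[ℝ] ℝ => φ z) this

variable (f : Frame n) {g : E (n - 1) →L[ℝ] ℝ} {S : E (n - 1) →L[ℝ] E (n - 1) →L[ℝ] ℝ}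
  {e : E (n - 1)} {q x : E n}

theorem Frame.norm_field_le {K : ℝ} (hg : ‖g‖ ≤ 1) (hS : ‖S‖ ≤ K) (he : ‖e‖ ≤ 1)
    (hx : ‖x - q‖ ≤ 1) : ‖f.field g S e q x‖ ≤ 2 + K := by
  have hK : 0 ≤ K := (norm_nonneg S).trans hS
  refine (norm_add_le _ _).trans (add_le_add ?_ ?_)
  · have := f.norm_tang_le hg e
    linarith
  · refine ((f.turn S e).le_opNorm _).trans ?_
    have h1 := f.norm_turn_le hS he
    calc ‖f.turn S e‖ * ‖x - q‖ ≤ K * 1 := by gcongr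
      _ = K := mul_one K

/-- Sums over the tangential directions, bounded by the dimension of the whole space. -/
theorem Frame.sum_norm_le {F : Type*} [SeminormedAddCommGroup F] {φ : Fin (n - 1) → F} {b : ℝ}
    (hb : 0 ≤ b) (h : ∀ β, ‖φ β‖ ≤ b) : ‖∑ β, φ β‖ ≤ n * b := by
  refine (norm_sum_le _ _).trans ((Finset.sum_le_sum fun β _ => h β).trans ?_)
  simp only [Finset.sum_const, Finset.card_univ, Fintype.card_fin, nsmul_eq_mul]
  have h2 : ((n - 1 : ℕ) : ℝ) ≤ n := by exact_mod_cast Nat.sub_le n 1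
  exact mul_le_mul_of_nonneg_right h2 hb

theorem Frame.norm_testDir_le {K M₁ : ℝ} (hg : ‖g‖ ≤ 1) (hS : ‖S‖ ≤ K) (he : ‖e‖ ≤ 1)
    (hx : ‖x - q‖ ≤ 1) {D : E n → E n →L[ℝ] ℝ} (hD : ‖D x‖ ≤ M₁) :
    ‖f.testDir g S e q D x‖ ≤ 2 + K + n * (8 * M₁) := by
  have hM₁ : 0 ≤ M₁ := (norm_nonneg _).trans hD
  refine (norm_add_le _ _).trans (add_le_add (f.norm_field_le hg hS he hx) ?_)
  refine Frame.sum_norm_le (by positivity) fun β => ?_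
  have h1 := f.norm_tangBasis_le hg β
  have h2 := (D x).le_opNorm (f.tangBasis g β)
  rw [norm_smul, norm_mul, Real.norm_two]
  have h3 : ‖D x (f.tangBasis g β)‖ ≤ M₁ * 2 := h2.trans (by gcongr)
  calc 2 * ‖D x (f.tangBasis g β)‖ * ‖f.tangBasis g β‖ ≤ 2 * (M₁ * 2) * 2 := by gcongr
    _ = 8 * M₁ := by ring

theorem Frame.abs_testFn_le {K M₁ : ℝ} (hg : ‖g‖ ≤ 1) (hS : ‖S‖ ≤ K) (he : ‖e‖ ≤ 1)
    (hx : ‖x - q‖ ≤ 1) {D : E n → E n →L[ℝ] ℝ} (hD : ‖D x‖ ≤ M₁) :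
    |f.testFn g S e q D x| ≤ M₁ * (2 + K) + n * (2 * M₁) ^ 2 := by
  have hM₁ : 0 ≤ M₁ := (norm_nonneg _).trans hD
  refine (abs_add_le _ _).trans (add_le_add ?_ ?_)
  · rw [← Real.norm_eq_abs]
    exact ((D x).le_opNorm _).trans
      (mul_le_mul hD (f.norm_field_le hg hS he hx) (norm_nonneg _) hM₁)
  · rw [← Real.norm_eq_abs]
    refine Frame.sum_norm_le (by positivity) fun β => ?_
    rw [norm_pow]
    refine pow_le_pow_left₀ (norm_nonneg _) ?_ 2
    refine ((D x).le_opNorm _).trans ?_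
    have := f.norm_tangBasis_le hg β
    calc ‖D x‖ * ‖f.tangBasis g β‖ ≤ M₁ * 2 := by gcongr
      _ = 2 * M₁ := mul_comm _ _

/-- The differential inequality for the test function, with constants that only depend on the
ellipticity and on the bounds for the gradient and for the boundary. -/
theorem exists_test_constants (hn : 1 ≤ n) {c C M₁ K : ℝ} (hc : 0 < c) (hC : 0 ≤ C)
    (hM₁ : 0 ≤ M₁) (hK : 0 ≤ K) :
    ∃ A C₂ : ℝ, 0 < A ∧ 0 ≤ C₂ ∧ ∀ (f : Frame n) (g : E (n - 1) →L[ℝ] ℝ)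
      (S : E (n - 1) →L[ℝ] E (n - 1) →L[ℝ] ℝ) (e : E (n - 1)) (q x : E n) (u : E n → ℝ)
      (BQ : E n →L[ℝ] E n →L[ℝ] ℝ), ‖g‖ ≤ 1 → ‖S‖ ≤ K → ‖e‖ ≤ 1 → ‖x - q‖ ≤ 1 →
      ContDiffAt ℝ 3 u x → ‖fderiv ℝ u x‖ ≤ M₁ → HasLinearization c C u x →
      (∀ v w, BQ v w = D3 u x v (f.testDir g S e q (fderiv ℝ u) x) w +
        (D2 u x (f.turn S e v) w + D2 u x v (f.turn S e w)) +
        ∑ β, 2 * D2 u x v (f.tangBasis g β) * D2 u x (f.tangBasis g β) w) →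
      ∃ L : Matrix (Fin n) (Fin n) ℝ, Elliptic c C L ∧ -C₂ ≤ contractMat L (formMat BQ) +
        A * (c * ‖f.testGrad g S e q (fderiv ℝ u) (D2 u) x‖ ^ 2) := by
  have hn0 : (0 : ℝ) < n := by exact_mod_cast hn
  set Cg := 4 * C / c + 3 + 12 * n * n * C / c with hCg
  have hCg0 : 0 < Cg := by positivity
  set Kα := 2 + K + n * (8 * M₁) with hKα
  set κ := c / (n * Cg ^ 2) with hκ
  set C₃ := C * (Kα + M₁ * K) + n * n * (C * (2 * K)) with hC₃
  refine ⟨C ^ 2 / κ / c + 1, 2 * c + κ + C₃ + C₃ ^ 2 / κ, by positivity, by positivity, ?_⟩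
  intro f g S e q x u BQ hg hS he hx hu hD hlin hBQ
  obtain ⟨L, L', hL, hL', h1, h2, h3⟩ := hlin
  refine ⟨L, hL, ?_⟩
  set α := f.testDir g S e q (fderiv ℝ u) x with hα
  set P := ‖f.testGrad g S e q (fderiv ℝ u) (D2 u) x‖ with hP
  have hgrow := norm_le_of_elliptic hc hC f hg hL hL' (D2_symm hu) h1 h2
  have hαn : ‖α‖ ≤ Kα := f.norm_testDir_le hg hS he hx hD
  have hturn := f.norm_turn_le hS he
  -- The direction `α` is the one for which `D²u α` is the gradient of the test function, up to a
  -- term of order zero in the second derivatives.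
  have hDα : ‖D2 u x α‖ ≤ P + M₁ * K := by
    have h4 : D2 u x α = f.testGrad g S e q (fderiv ℝ u) (D2 u) x -
        (fderiv ℝ u x).comp (f.turn S e) := by
      rw [Frame.testGrad, add_sub_cancel_right]
    rw [h4]
    refine (norm_sub_le _ _).trans (add_le_add le_rfl ?_)
    exact (ContinuousLinearMap.opNorm_comp_le _ _).trans
      (mul_le_mul hD hturn (norm_nonneg _) hM₁)
  set t := contractMat L (formMat (D3 u x α)) with ht
  set bm : Matrix (Fin n) (Fin n) ℝ := Matrix.of fun i j =>
    D2 u x (f.turn S e (EuclideanSpace.single i 1)) (EuclideanSpace.single j 1) +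
      D2 u x (EuclideanSpace.single i 1) (f.turn S e (EuclideanSpace.single j 1)) with hbm
  have htb : |t| ≤ C * (Kα + (1 + ‖D2 u x‖) * (P + M₁ * K)) := by
    refine (h3 α).trans (mul_le_mul_of_nonneg_left ?_ hC)
    exact add_le_add hαn (mul_le_mul_of_nonneg_left hDα (by positivity))
  have hbb : |contractMat L bm| ≤ n * n * (C * (2 * (‖D2 u x‖ * K))) := by
    refine contractMat_le_of_abs_le hL fun i j => ?_
    rw [hbm, Matrix.of_apply]
    have hr : ∀ i : Fin n, ‖f.turn S e (EuclideanSpace.single i 1)‖ ≤ K := fun i => by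
      have := (f.turn S e).le_opNorm (EuclideanSpace.single i 1)
      rw [norm_single_one, mul_one] at this
      exact this.trans hturn
    have i1 := (D2 u x).le_opNorm₂ (f.turn S e (EuclideanSpace.single i 1))
      (EuclideanSpace.single j 1)
    have i2 := (D2 u x).le_opNorm₂ (EuclideanSpace.single i 1)
      (f.turn S e (EuclideanSpace.single j 1))
    rw [norm_single_one, mul_one] at i1
    rw [norm_single_one, mul_one] at i2
    have i3 := mul_le_mul_of_nonneg_left (hr i) (norm_nonneg (D2 u x))
    have i4 := mul_le_mul_of_nonneg_left (hr j) (norm_nonneg (D2 u x))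
    rw [Real.norm_eq_abs] at i1 i2
    exact (abs_add_le _ _).trans (by linarith)
  have hX : contractMat L (formMat BQ) = t + contractMat L bm +
      ∑ β, 2 * ∑ i, ∑ j, L i j * (D2 u x (f.tangBasis g β) (EuclideanSpace.single i 1) *
        D2 u x (f.tangBasis g β) (EuclideanSpace.single j 1)) := by
    have h5 : ∀ i j, formMat BQ i j = formMat (D3 u x α) i j + bm i j +
        ∑ β, 2 * (D2 u x (f.tangBasis g β) (EuclideanSpace.single i 1) *
        D2 u x (f.tangBasis g β) (EuclideanSpace.single j 1)) := by
      intro i j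
      simp only [formMat, hbm, Matrix.of_apply, hBQ]
      rw [D3_symm hu]
      congr 1
      refine Finset.sum_congr rfl fun β _ => ?_
      rw [D2_symm hu (EuclideanSpace.single i 1)]
      ring
    simp only [ht, contractMat, h5, mul_add, Finset.sum_add_distrib]
    congr 1
    simp only [Finset.mul_sum]
    rw [Finset.sum_congr rfl fun i _ => Finset.sum_comm, Finset.sum_comm]
    refine Finset.sum_congr rfl fun β _ => Finset.sum_congr rfl fun i _ =>
      Finset.sum_congr rfl fun j _ => ?_
    ring
  -- Ellipticity makes the terms from the squares in the test function positive.
  have hX' : t + contractMat L bm + 2 * c * ∑ β, ‖D2 u x (f.tangBasis g β)‖ ^ 2 ≤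
      contractMat L (formMat BQ) := by
    rw [hX, Finset.mul_sum]
    refine add_le_add le_rfl (Finset.sum_le_sum fun β _ => ?_)
    have h6 := hL.1 fun i => D2 u x (f.tangBasis g β) (EuclideanSpace.single i 1)
    have h7 := mul_le_mul_of_nonneg_left (norm_sq_le_sum_single (D2 u x (f.tangBasis g β))) hc.le
    linarith
  have hmain := contractMat_test_ge (N := fun β => ‖D2 u x (f.tangBasis g β)‖) hc hC hM₁ hK hCg0 hn
    (norm_nonneg (D2 u x)) (fun β => norm_nonneg _) hgrow htb hbb hX' (by positivity)
  have hA : (C ^ 2 / κ / c + 1) * (c * P ^ 2) = C ^ 2 / κ * P ^ 2 + c * P ^ 2 := by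
    field_simp
  rw [hA]
  have hcP : 0 ≤ c * P ^ 2 := by positivity
  rw [← hκ, ← hC₃] at hmain
  linarith

end TestInterior

/-! ### The barrier -/

section Barrier

variable {n : ℕ}

/-- The height of a point above the graph of `ρ`, in the coordinates of a frame at `q`. -/
def Frame.graphHeight (f : Frame n) (ρ : E (n - 1) → ℝ) (q x : E n) : ℝ :=
  f.H (x - q) - ρ (f.Y (x - q))

/-- The gradient of `Frame.graphHeight`. -/
def Frame.graphHeightGrad (f : Frame n) (ρ : E (n - 1) → ℝ) (q x : E n) : E n →L[ℝ] ℝ :=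
  f.H - (fderiv ℝ ρ (f.Y (x - q))).comp f.Y

/-- The barrier `a |x - q|² + b (d - N d²)`, with `d` the height above the graph of `ρ`. -/
def Frame.barrier (f : Frame n) (ρ : E (n - 1) → ℝ) (q : E n) (a b N : ℝ) (x : E n) : ℝ :=
  a * ‖x - q‖ ^ 2 + b * (f.graphHeight ρ q x - N * f.graphHeight ρ q x ^ 2)

/-- The gradient of the barrier. -/
def Frame.barrierGrad (f : Frame n) (ρ : E (n - 1) → ℝ) (q : E n) (a b N : ℝ) (x : E n) :
    E n →L[ℝ] ℝ :=
  (2 * a) • innerSL ℝ (x - q) +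
    (b * (1 - 2 * N * f.graphHeight ρ q x)) • f.graphHeightGrad ρ q x

variable (f : Frame n) {ρ : E (n - 1) → ℝ} {q x : E n} (a b N : ℝ)

theorem hasFDerivAt_sub_const_id : HasFDerivAt (fun x : E n => x - q)
    (ContinuousLinearMap.id ℝ (E n)) x := (hasFDerivAt_id x).sub_const q

theorem Frame.hasFDerivAt_graphHeight (h : DifferentiableAt ℝ ρ (f.Y (x - q))) :
    HasFDerivAt (f.graphHeight ρ q) (f.graphHeightGrad ρ q x) x := by
  have h1 : HasFDerivAt (fun x : E n => f.H (x - q)) f.H x := by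
    exact f.H.hasFDerivAt.comp x (hasFDerivAt_sub_const_id (q := q))
  have h2 : HasFDerivAt (fun x : E n => f.Y (x - q)) f.Y x := by
    exact f.Y.hasFDerivAt.comp x (hasFDerivAt_sub_const_id (q := q))
  exact h1.sub (h.hasFDerivAt.comp x h2)

theorem Frame.hasFDerivAt_barrier (h : DifferentiableAt ℝ ρ (f.Y (x - q))) :
    HasFDerivAt (f.barrier ρ q a b N) (f.barrierGrad ρ q a b N x) x := by
  have h1 := (hasFDerivAt_sub_const_id (q := q) (x := x)).norm_sq
  have h2 := f.hasFDerivAt_graphHeight h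
  have h3 := (h1.const_mul a).add ((h2.sub ((h2.pow 2).const_mul N)).const_mul b)
  refine h3.congr_fderiv ?_
  ext z
  simp [Frame.barrierGrad]
  ring

theorem Frame.hasFDerivAt_barrierGrad (h : ContDiffAt ℝ 2 ρ (f.Y (x - q))) :
    ∃ Bv : E n →L[ℝ] E n →L[ℝ] ℝ, HasFDerivAt (f.barrierGrad ρ q a b N) Bv x ∧
      ∀ v w, Bv v w = 2 * a * inner ℝ v w -
        b * (1 - 2 * N * f.graphHeight ρ q x) *
          fderiv ℝ (fderiv ℝ ρ) (f.Y (x - q)) (f.Y v) (f.Y w) -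
        2 * b * N * (f.graphHeightGrad ρ q x v * f.graphHeightGrad ρ q x w) := by
  have h2 : HasFDerivAt (fun x : E n => f.Y (x - q)) f.Y x := by
    exact f.Y.hasFDerivAt.comp x (hasFDerivAt_sub_const_id (q := q))
  have h3 : HasFDerivAt (fderiv ℝ ρ) (fderiv ℝ (fderiv ℝ ρ) (f.Y (x - q))) (f.Y (x - q)) :=
    ((h.fderiv_right (m := 1) (by norm_num)).differentiableAt (by norm_num)).hasFDerivAt
  have h4 := (h3.comp x h2).clm_comp (hasFDerivAt_const f.Y x)
  have h5 : HasFDerivAt (f.graphHeightGrad ρ q) _ x := h4.const_sub f.H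
  have h6 := f.hasFDerivAt_graphHeight (h.differentiableAt (by norm_num))
  have h7 : HasFDerivAt (fun x : E n => (2 * a) • innerSL ℝ (x - q)) ((2 * a) • innerSL ℝ) x := by
    have := ((innerSL ℝ (E := E n)).hasFDerivAt.comp x
      (hasFDerivAt_sub_const_id (q := q))).const_smul (2 * a)
    exact this
  have h8 := h7.add ((((h6.const_mul (2 * N)).const_sub 1).const_mul b).smul h5)
  refine ⟨_, h8, fun v w => ?_⟩
  have hin : innerSL ℝ v w = inner ℝ v w := rfl
  simp [hin]
  ring

/-- The barrier is a strict supersolution, up to terms that are controlled by `a` and `b`. -/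
theorem contractMat_barrier_le {c C K : ℝ} (hc : 0 ≤ c) (ha : 0 ≤ a) (hb : 0 ≤ b) (hN : 0 ≤ N)
    {L : Matrix (Fin n) (Fin n) ℝ} (hL : Elliptic c C L)
    (hK : ‖fderiv ℝ (fderiv ℝ ρ) (f.Y (x - q))‖ ≤ K) (h0 : 0 ≤ N * f.graphHeight ρ q x)
    (h1 : N * f.graphHeight ρ q x ≤ 1) {Bv : E n →L[ℝ] E n →L[ℝ] ℝ}
    (hBv : ∀ v w, Bv v w = 2 * a * inner ℝ v w -
        b * (1 - 2 * N * f.graphHeight ρ q x) *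
          fderiv ℝ (fderiv ℝ ρ) (f.Y (x - q)) (f.Y v) (f.Y w) -
        2 * b * N * (f.graphHeightGrad ρ q x v * f.graphHeightGrad ρ q x w)) :
    contractMat L (formMat Bv) ≤ n * n * (C * (2 * a + b * K)) - 2 * b * N * c := by
  have hK0 : 0 ≤ K := (norm_nonneg (fderiv ℝ (fderiv ℝ ρ) (f.Y (x - q)))).trans hK
  set bm : Matrix (Fin n) (Fin n) ℝ := Matrix.of fun i j =>
    2 * a * inner ℝ (EuclideanSpace.single i 1 : E n) (EuclideanSpace.single j 1) -
      b * (1 - 2 * N * f.graphHeight ρ q x) * fderiv ℝ (fderiv ℝ ρ) (f.Y (x - q))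
        (f.Y (EuclideanSpace.single i 1)) (f.Y (EuclideanSpace.single j 1)) with hbm
  have hsplit : contractMat L (formMat Bv) = contractMat L bm - 2 * b * N *
      ∑ i, ∑ j, L i j * (f.graphHeightGrad ρ q x (EuclideanSpace.single i 1) *
        f.graphHeightGrad ρ q x (EuclideanSpace.single j 1)) := by
    simp only [contractMat, formMat, Matrix.of_apply, hBv, hbm, Finset.mul_sum]
    simp only [← Finset.sum_sub_distrib]
    refine Finset.sum_congr rfl fun i _ => Finset.sum_congr rfl fun j _ => ?_
    ring
  have h2 : |contractMat L bm| ≤ n * n * (C * (2 * a + b * K)) := by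
    refine contractMat_le_of_abs_le hL fun i j => ?_
    rw [hbm, Matrix.of_apply]
    refine (abs_sub _ _).trans (add_le_add ?_ ?_)
    · rw [abs_mul, abs_of_nonneg (by positivity : 0 ≤ 2 * a)]
      have := abs_real_inner_le_norm (EuclideanSpace.single i 1 : E n) (EuclideanSpace.single j 1)
      rw [norm_single_one, norm_single_one, mul_one] at this
      nlinarith
    · rw [abs_mul, abs_mul, abs_of_nonneg hb]
      have h3 : |1 - 2 * N * f.graphHeight ρ q x| ≤ 1 := by
        rw [abs_le]; constructor <;> linarith
      have hy : ∀ i : Fin n, ‖f.Y (EuclideanSpace.single i 1)‖ ≤ 1 := fun i => by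
        have := f.norm_Y (EuclideanSpace.single i 1)
        rwa [norm_single_one] at this
      have h4 : |fderiv ℝ (fderiv ℝ ρ) (f.Y (x - q)) (f.Y (EuclideanSpace.single i 1))
          (f.Y (EuclideanSpace.single j 1))| ≤ K := by
        rw [← Real.norm_eq_abs]
        refine (ContinuousLinearMap.le_opNorm₂ _ _ _).trans ?_
        have := mul_le_mul (mul_le_mul hK (hy i) (norm_nonneg _) hK0) (hy j) (norm_nonneg _)
          (by positivity)
        linarith
      have h5 := mul_le_mul (mul_le_mul_of_nonneg_left h3 hb) h4 (abs_nonneg _) (by linarith)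
      linarith
  have h6 : 1 ≤ ∑ i, f.graphHeightGrad ρ q x (EuclideanSpace.single i 1) ^ 2 :=
    f.one_le_sum_height_sq (fderiv ℝ ρ (f.Y (x - q)))
  have h7 := hL.1 fun i => f.graphHeightGrad ρ q x (EuclideanSpace.single i 1)
  have h8 : c ≤ ∑ i, ∑ j, L i j * (f.graphHeightGrad ρ q x (EuclideanSpace.single i 1) *
        f.graphHeightGrad ρ q x (EuclideanSpace.single j 1)) := by nlinarith
  have h9 := mul_le_mul_of_nonneg_left h8 (by positivity : 0 ≤ 2 * b * N)
  rw [hsplit]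
  linarith [le_abs_self (contractMat L bm)]

end Barrier

/-! ### Uniform charts of the boundary -/

section Charts

variable {n : ℕ}

/-- A representation of `Ω` near the boundary point `q` as the region above the graph of `ρ` in the
coordinates of a frame at `q`, with bounds on a ball of radius `r`. The slope of the graph at `q`
need not vanish. -/
structure GraphChart (Ω : Set (E n)) (q : E n) (f : Frame n) (ρ : E (n - 1) → ℝ) (r K : ℝ) :
    Prop where
  pos : 0 < r
  value : ρ 0 = 0
  smooth : ∀ y ∈ Metric.ball (0 : E (n - 1)) r, ContDiffAt ℝ 2 ρ y
  slope : ∀ y ∈ Metric.ball (0 : E (n - 1)) r, ‖fderiv ℝ ρ y‖ ≤ 1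
  second : ∀ y ∈ Metric.ball (0 : E (n - 1)) r, ‖fderiv ℝ (fderiv ℝ ρ) y‖ ≤ K
  second_lipschitz : ∀ y ∈ Metric.ball (0 : E (n - 1)) r,
    ‖fderiv ℝ (fderiv ℝ ρ) y - fderiv ℝ (fderiv ℝ ρ) 0‖ ≤ K * ‖y‖
  region : ∀ x, ‖x - q‖ < r → (x ∈ Ω ↔ ρ (f.Y (x - q)) < f.H (x - q))

theorem GraphChart.mono {Ω : Set (E n)} {q : E n} {f : Frame n} {ρ : E (n - 1) → ℝ}
    {r K r' K' : ℝ} (h : GraphChart Ω q f ρ r K) (hr' : 0 < r') (hr : r' ≤ r) (hK : K ≤ K') :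
    GraphChart Ω q f ρ r' K' where
  pos := hr'
  value := h.value
  smooth y hy := h.smooth y (Metric.ball_subset_ball hr hy)
  slope y hy := h.slope y (Metric.ball_subset_ball hr hy)
  second y hy := (h.second y (Metric.ball_subset_ball hr hy)).trans hK
  second_lipschitz y hy := (h.second_lipschitz y (Metric.ball_subset_ball hr hy)).trans
    (mul_le_mul_of_nonneg_right hK (norm_nonneg y))
  region x hx := h.region x (hx.trans_le hr)

theorem norm_fderiv_fderiv_sub_le {m : ℕ} (ρ : E m → ℝ) (y z : E m) :
    ‖fderiv ℝ (fderiv ℝ ρ) y - fderiv ℝ (fderiv ℝ ρ) z‖ ≤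
      ‖iteratedFDeriv ℝ 2 ρ y - iteratedFDeriv ℝ 2 ρ z‖ := by
  refine ContinuousLinearMap.opNorm_le_bound₂ _ (norm_nonneg _) fun v w => ?_
  have h := (iteratedFDeriv ℝ 2 ρ y - iteratedFDeriv ℝ 2 ρ z).le_opNorm ![v, w]
  simp only [sub_apply, iteratedFDeriv_two_apply, Fin.prod_univ_two,
    Matrix.cons_val_zero, Matrix.cons_val_one] at h
  simpa [mul_assoc] using h

/-- A boundary point lies on the graph that represents the boundary. -/
theorem graph_eq_of_mem_frontier {Ω : Set (E n)} (hopen : IsOpen Ω) {p q : E n} {f : Frame n}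
    {ρ : E (n - 1) → ℝ} {r : ℝ} (hρ : ContinuousAt ρ (f.Y (q - p)))
    (hreg : ∀ x, ‖x - p‖ < r → (x ∈ Ω ↔ ρ (f.Y (x - p)) < f.H (x - p)))
    (hq : q ∈ frontier Ω) (hqp : ‖q - p‖ < r) : ρ (f.Y (q - p)) = f.H (q - p) := by
  have hqΩ : q ∉ Ω := by rw [hopen.frontier_eq] at hq; exact hq.2
  refine le_antisymm ?_ (not_lt.1 fun h => hqΩ ((hreg q hqp).2 h))
  by_contra! hlt
  have hc1 : ContinuousAt (fun x : E n => f.H (x - p)) q := by fun_prop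
  have hc2 : ContinuousAt (fun x : E n => f.Y (x - p)) q := by fun_prop
  have hc3 : ContinuousAt (fun x : E n => ρ (f.Y (x - p))) q :=
    ContinuousAt.comp (f := fun x : E n => f.Y (x - p)) (g := ρ) hρ hc2
  have hc4 : ContinuousAt (fun x : E n => ‖x - p‖) q := by fun_prop
  have hev := (hc1.eventually_lt hc3 hlt).and (hc4.eventually_lt continuousAt_const hqp)
  obtain ⟨x, hx3, hx1, hx2⟩ := ((mem_closure_iff_frequently.1 hq.1).and_eventually hev).exists
  exact absurd ((hreg x hx2).1 hx3) (not_lt.2 hx1.le)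

theorem IsBoundaryGraph.region_norm {Ω : Set (E n)} {p : E n}
    {T : WithLp 2 (E (n - 1) × ℝ) ≃ₗᵢ[ℝ] E n} {ρ : E (n - 1) → ℝ} {r : ℝ}
    (h : IsBoundaryGraph Ω p T ρ r) (x : E n) (hx : ‖x - p‖ < r) :
    x ∈ Ω ↔ ρ ((Frame.ofIsometry T).Y (x - p)) < (Frame.ofIsometry T).H (x - p) := by
  have h1 := h.region ((Frame.ofIsometry T).Y (x - p))
    (mem_ball_zero_iff.2 (((Frame.ofIsometry T).norm_Y _).trans_lt hx))
    ((Frame.ofIsometry T).H (x - p)) (((Frame.ofIsometry T).norm_H _).trans_lt hx)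
  rwa [Frame.ofIsometry_decomp, add_sub_cancel] at h1

/-- Recentring a boundary graph at the nearby boundary points. -/
theorem IsBoundaryGraph.exists_charts {Ω : Set (E n)} (hopen : IsOpen Ω) {p : E n}
    {T : WithLp 2 (E (n - 1) × ℝ) ≃ₗᵢ[ℝ] E n} {ρ : E (n - 1) → ℝ} {r : ℝ}
    (h : IsBoundaryGraph Ω p T ρ r) :
    ∃ s K : ℝ, 0 < s ∧ 0 ≤ K ∧ ∀ q ∈ frontier Ω, ‖q - p‖ < s →
      ∃ (f : Frame n) (ρ' : E (n - 1) → ℝ), GraphChart Ω q f ρ' s K := by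
  obtain ⟨L, hL⟩ := h.lipschitz
  set f := Frame.ofIsometry T with hf
  have hsm : ∀ y ∈ Metric.ball (0 : E (n - 1)) r, ContDiffAt ℝ 2 ρ y := fun y hy =>
    h.smooth.contDiffAt (Metric.isOpen_ball.mem_nhds hy)
  have h0 : (0 : E (n - 1)) ∈ Metric.ball (0 : E (n - 1)) r := Metric.mem_ball_self h.pos
  have hcont : ContinuousAt (fderiv ℝ ρ) 0 :=
    ((hsm 0 h0).fderiv_right (m := 1) (by norm_num)).continuousAt
  obtain ⟨ε, hε, hε1⟩ := Metric.continuousAt_iff.1 hcont 1 one_pos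
  have hslope : ∀ y : E (n - 1), ‖y‖ < ε → ‖fderiv ℝ ρ y‖ ≤ 1 := fun y hy => by
    have := hε1 (x := y) (by rwa [dist_zero_right])
    rw [h.gradient, dist_zero_right] at this
    exact this.le
  have hLip : ∀ y ∈ Metric.ball (0 : E (n - 1)) r, ∀ z ∈ Metric.ball (0 : E (n - 1)) r,
      ‖fderiv ℝ (fderiv ℝ ρ) y - fderiv ℝ (fderiv ℝ ρ) z‖ ≤ |L| * ‖y - z‖ := fun y hy z hz =>
    (norm_fderiv_fderiv_sub_le ρ y z).trans ((hL y hy z hz).trans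
      (mul_le_mul_of_nonneg_right (le_abs_self L) (norm_nonneg _)))
  set s := min ε r / 2 with hs
  have hs0 : 0 < s := half_pos (lt_min hε h.pos)
  have hsε : s + s ≤ ε := by rw [hs, add_halves]; exact min_le_left _ _
  have hsr : s + s ≤ r := by rw [hs, add_halves]; exact min_le_right _ _
  refine ⟨s, ‖fderiv ℝ (fderiv ℝ ρ) 0‖ + |L| * (r + 1), hs0, by have := h.pos; positivity, ?_⟩
  intro q hq hqp
  set y₀ := f.Y (q - p) with hy₀
  have hy₀s : ‖y₀‖ < s := (f.norm_Y _).trans_lt hqp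
  have hnorm : ∀ y ∈ Metric.ball (0 : E (n - 1)) s, ‖y₀ + y‖ < s + s := fun y hy =>
    (norm_add_le _ _).trans_lt (add_lt_add hy₀s (mem_ball_zero_iff.1 hy))
  have hball : ∀ y ∈ Metric.ball (0 : E (n - 1)) s, y₀ + y ∈ Metric.ball (0 : E (n - 1)) r :=
    fun y hy => mem_ball_zero_iff.2 ((hnorm y hy).trans_le hsr)
  have hy₀r : y₀ ∈ Metric.ball (0 : E (n - 1)) r := by
    rw [mem_ball_zero_iff]; linarith
  have hval : ρ y₀ = f.H (q - p) :=
    graph_eq_of_mem_frontier hopen (hsm y₀ hy₀r).continuousAt h.region_norm hq (by linarith)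
  set ρ' : E (n - 1) → ℝ := fun y => ρ (y₀ + y) - ρ y₀ with hρ'
  have hd1 : fderiv ℝ ρ' = fun y => fderiv ℝ ρ (y₀ + y) := by
    ext1 y
    rw [hρ', fderiv_sub_const]
    exact fderiv_comp_add_left y₀
  have hd2 : fderiv ℝ (fderiv ℝ ρ') = fun y => fderiv ℝ (fderiv ℝ ρ) (y₀ + y) := by
    rw [hd1]
    ext1 y
    exact fderiv_comp_add_left y₀
  -- The frame is kept and the graph function is translated, so the new slope at the origin is only
  -- bounded by one.
  refine ⟨f, ρ', ⟨hs0, by simp [hρ'], ?_, ?_, ?_, ?_, ?_⟩⟩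
  · intro y hy
    have hadd : ContDiffAt ℝ 2 (fun y : E (n - 1) => y₀ + y) y := by fun_prop
    exact ((hsm _ (hball y hy)).comp y hadd).sub contDiffAt_const
  · intro y hy
    rw [hd1]
    exact hslope _ ((hnorm y hy).trans_le hsε)
  · intro y hy
    rw [hd2]
    have h1 := hLip _ (hball y hy) 0 h0
    have h2 := norm_le_norm_add_norm_sub' (fderiv ℝ (fderiv ℝ ρ) (y₀ + y))
      (fderiv ℝ (fderiv ℝ ρ) 0)
    have h3 : |L| * ‖y₀ + y - 0‖ ≤ |L| * (r + 1) := by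
      rw [sub_zero]
      have := hnorm y hy
      exact mul_le_mul_of_nonneg_left (by linarith) (abs_nonneg L)
    linarith
  · intro y hy
    rw [hd2]
    refine (hLip _ (hball y hy) _ (hball 0 (Metric.mem_ball_self hs0))).trans ?_
    rw [add_sub_add_left_eq_sub, sub_zero]
    refine mul_le_mul_of_nonneg_right ?_ (norm_nonneg y)
    have := h.pos
    nlinarith [norm_nonneg (fderiv ℝ (fderiv ℝ ρ) 0), abs_nonneg L]
  · intro x hx
    have hxp : x - p = (q - p) + (x - q) := by abel
    have hxr : ‖x - p‖ < r := by
      rw [hxp]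
      exact (norm_add_le _ _).trans_lt ((add_lt_add hqp hx).trans_le hsr)
    rw [h.region_norm x hxr, ← hf, hxp, map_add, map_add, ← hval]
    simp only [hρ', ← hy₀]
    constructor <;> intro h' <;> linarith

/-- By compactness the boundary is covered by charts with common bounds. -/
theorem HasC21Boundary.exists_uniform_charts {Ω : Set (E n)} (hC : HasC21Boundary Ω)
    (hopen : IsOpen Ω) (hbdd : Bornology.IsBounded Ω) :
    ∃ r K : ℝ, 0 < r ∧ 0 ≤ K ∧ ∀ q ∈ frontier Ω,
      ∃ (f : Frame n) (ρ : E (n - 1) → ℝ), GraphChart Ω q f ρ r K := by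
  have hcompact : IsCompact (frontier Ω) :=
    hbdd.isCompact_closure.of_isClosed_subset isClosed_frontier frontier_subset_closure
  have key : ∃ r K : ℝ, 0 < r ∧ 0 ≤ K ∧ ∀ q ∈ frontier Ω, q ∈ frontier Ω →
      ∃ (f : Frame n) (ρ : E (n - 1) → ℝ), GraphChart Ω q f ρ r K := by
    refine hcompact.induction_on (p := fun s => ∃ r K : ℝ, 0 < r ∧ 0 ≤ K ∧ ∀ q ∈ s,
      q ∈ frontier Ω → ∃ (f : Frame n) (ρ : E (n - 1) → ℝ), GraphChart Ω q f ρ r K) ?_ ?_ ?_ ?_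
    · exact ⟨1, 0, one_pos, le_rfl, fun q hq => absurd hq (Set.notMem_empty q)⟩
    · rintro s t hst ⟨r, K, hr, hK, h⟩
      exact ⟨r, K, hr, hK, fun q hq => h q (hst hq)⟩
    · rintro s t ⟨r, K, hr, hK, h⟩ ⟨r', K', hr', hK', h'⟩
      refine ⟨min r r', max K K', lt_min hr hr', le_max_of_le_left hK, ?_⟩
      rintro q (hq | hq) hqf
      · obtain ⟨f, ρ, hch⟩ := h q hq hqf
        exact ⟨f, ρ, hch.mono (lt_min hr hr') (min_le_left _ _) (le_max_left _ _)⟩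
      · obtain ⟨f, ρ, hch⟩ := h' q hq hqf
        exact ⟨f, ρ, hch.mono (lt_min hr hr') (min_le_right _ _) (le_max_right _ _)⟩
    · intro p hp
      obtain ⟨T, ρ, r, hg⟩ := hC p hp
      obtain ⟨s, K, hs, hK, h⟩ := hg.exists_charts hopen
      refine ⟨Metric.ball p s, mem_nhdsWithin_of_mem_nhds (Metric.ball_mem_nhds p hs), s, K, hs,
        hK, fun q hq hqf => h q hqf ?_⟩
      rwa [← dist_eq_norm]
  obtain ⟨r, K, hr, hK, h⟩ := key
  exact ⟨r, K, hr, hK, fun q hq => h q hq hq⟩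

end Charts

/-! ### Derivatives up to the boundary and the tangential second derivatives -/

section ChartGeometry

variable {n : ℕ} {Ω : Set (E n)} {q : E n} {f : Frame n} {ρ : E (n - 1) → ℝ} {r K : ℝ}

/-- The parametrization of the graph of `ρ`. -/
def Frame.graphPoint (f : Frame n) (ρ : E (n - 1) → ℝ) (q : E n) (y : E (n - 1)) : E n :=
  q + (f.J y + ρ y • f.ν)

theorem Frame.hasFDerivAt_graphPoint (f : Frame n) {y : E (n - 1)} (h : DifferentiableAt ℝ ρ y) :
    HasFDerivAt (f.graphPoint ρ q) (f.tang (fderiv ℝ ρ y)) y :=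
  (f.J.hasFDerivAt.add (h.hasFDerivAt.smul_const f.ν)).const_add q

theorem Frame.Y_graphPoint_sub (f : Frame n) (y : E (n - 1)) (t : ℝ) :
    f.Y (q + (f.J y + t • f.ν) - q) = y := by
  rw [add_sub_cancel_left, map_add, map_smul, f.Y_J, f.Y_ν, smul_zero, add_zero]

theorem Frame.H_graphPoint_sub (f : Frame n) (y : E (n - 1)) (t : ℝ) :
    f.H (q + (f.J y + t • f.ν) - q) = t := by
  rw [add_sub_cancel_left, map_add, map_smul, f.H_J, f.H_ν, smul_eq_mul, mul_one, zero_add]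

theorem Frame.graphPoint_of_eq (f : Frame n) {x : E n} (h : ρ (f.Y (x - q)) = f.H (x - q)) :
    f.graphPoint ρ q (f.Y (x - q)) = x := by
  rw [Frame.graphPoint, h, f.decomp, add_sub_cancel]

theorem GraphChart.abs_le (h : GraphChart Ω q f ρ r K) {y : E (n - 1)} (hy : ‖y‖ < r) :
    |ρ y| ≤ ‖y‖ := by
  have h0 : (0 : E (n - 1)) ∈ Metric.ball (0 : E (n - 1)) r := Metric.mem_ball_self h.pos
  have h1 := (convex_ball (0 : E (n - 1)) r).norm_image_sub_le_of_norm_hasFDerivWithin_le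
    (f := ρ) (fun z hz =>
      ((h.smooth z hz).differentiableAt (by norm_num)).hasFDerivAt.hasFDerivWithinAt)
    h.slope h0 (mem_ball_zero_iff.2 hy)
  simpa [h.value] using h1

theorem GraphChart.graphHeight_le (h : GraphChart Ω q f ρ r K) {x : E n} (hx : ‖x - q‖ < r) :
    f.graphHeight ρ q x ≤ 2 * ‖x - q‖ := by
  have h1 := f.norm_H (x - q)
  have h2 := f.norm_Y (x - q)
  have h3 := h.abs_le (h2.trans_lt hx)
  rw [Frame.graphHeight]
  linarith [le_abs_self (f.H (x - q)), neg_abs_le (ρ (f.Y (x - q)))]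

theorem GraphChart.graphPoint_mem_closure (h : GraphChart Ω q f ρ r K) {y : E (n - 1)}
    (hy : ‖y‖ < r / 2) : f.graphPoint ρ q y ∈ closure Ω := by
  have hr := h.pos
  have hab := h.abs_le (y := y) (by linarith)
  have hnorm : ∀ t : ℝ, ‖q + (f.J y + t • f.ν) - q‖ ≤ ‖y‖ + |t| := fun t => by
    rw [add_sub_cancel_left]
    refine (norm_add_le _ _).trans (add_le_add (f.norm_J y) ?_)
    rw [norm_smul, f.norm_ν, mul_one, Real.norm_eq_abs]
  have hc : ContinuousAt (fun t : ℝ => q + (f.J y + t • f.ν)) (ρ y) := by fun_prop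
  refine mem_closure_of_frequently_of_tendsto (f := fun t : ℝ => q + (f.J y + t • f.ν))
    (b := nhdsWithin (ρ y) (Set.Ioi (ρ y))) ?_ (hc.tendsto.mono_left nhdsWithin_le_nhds)
  refine Filter.Eventually.frequently ?_
  have hev : ∀ᶠ t in nhdsWithin (ρ y) (Set.Ioi (ρ y)), |t| < r / 2 :=
    nhdsWithin_le_nhds ((continuous_abs.tendsto (ρ y)).eventually_lt_const (by linarith))
  filter_upwards [hev, self_mem_nhdsWithin] with t ht1 ht2
  rw [h.region _ (by have := hnorm t; linarith), f.Y_graphPoint_sub, f.H_graphPoint_sub]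
  exact ht2

theorem GraphChart.graphPoint_mem_frontier (h : GraphChart Ω q f ρ r K) (hopen : IsOpen Ω)
    {y : E (n - 1)} (hy : ‖y‖ < r / 2) : f.graphPoint ρ q y ∈ frontier Ω := by
  have hr := h.pos
  have hab := h.abs_le (y := y) (by linarith)
  rw [hopen.frontier_eq]
  refine ⟨h.graphPoint_mem_closure hy, fun hmem => ?_⟩
  rw [Frame.graphPoint, h.region, f.Y_graphPoint_sub, f.H_graphPoint_sub] at hmem
  · exact lt_irrefl _ hmem
  · rw [add_sub_cancel_left]
    refine (norm_add_le _ _).trans_lt ?_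
    rw [norm_smul, f.norm_ν, mul_one, Real.norm_eq_abs]
    have := f.norm_J y
    linarith

theorem GraphChart.normal_mem (h : GraphChart Ω q f ρ r K) {s : ℝ} (hs : 0 < s) (hsr : s < r) :
    q + s • f.ν ∈ Ω := by
  rw [h.region, add_sub_cancel_left, map_smul, map_smul, f.Y_ν, f.H_ν, smul_zero, h.value]
  · simpa using hs
  · rw [add_sub_cancel_left, norm_smul, f.norm_ν, mul_one, Real.norm_eq_abs, abs_of_pos hs]
    exact hsr

/-- An interior cone at a boundary point. -/
theorem GraphChart.uniqueDiffWithinAt (h : GraphChart Ω q f ρ r K) :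
    UniqueDiffWithinAt ℝ (closure Ω) q := by
  set s : Set (E n) := {x | ‖x - q‖ < r} ∩ {x | ‖f.Y (x - q)‖ - f.H (x - q) < 0} with hs
  have hsub : s ⊆ Ω := by
    rintro x ⟨hx1, hx2⟩
    have hx2' : ‖f.Y (x - q)‖ - f.H (x - q) < 0 := hx2
    have h3 := h.abs_le ((f.norm_Y (x - q)).trans_lt hx1)
    rw [h.region x hx1]
    linarith [le_abs_self (ρ (f.Y (x - q)))]
  have hopen : IsOpen s := by
    refine IsOpen.inter ?_ ?_
    · exact isOpen_lt (by fun_prop) continuous_const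
    · exact isOpen_lt (by fun_prop) continuous_const
  have hconv : Convex ℝ s := by
    refine Convex.inter ?_ ?_
    · have : {x : E n | ‖x - q‖ < r} = Metric.ball q r := by
        ext x; simp [dist_eq_norm]
      rw [this]
      exact convex_ball q r
    · intro x hx y hy a b ha hb hab
      have hx' : ‖f.Y (x - q)‖ - f.H (x - q) < 0 := hx
      have hy' : ‖f.Y (y - q)‖ - f.H (y - q) < 0 := hy
      have he : a • x + b • y - q = a • (x - q) + b • (y - q) := by
        rw [smul_sub, smul_sub, sub_add_sub_comm, ← add_smul, hab, one_smul]
      change ‖f.Y (a • x + b • y - q)‖ - f.H (a • x + b • y - q) < 0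
      rw [he, map_add, map_add, map_smul, map_smul, map_smul, map_smul]
      have h1 := norm_add_le (a • f.Y (x - q)) (b • f.Y (y - q))
      rw [norm_smul, norm_smul, Real.norm_of_nonneg ha, Real.norm_of_nonneg hb] at h1
      simp only [smul_eq_mul]
      rcases ha.eq_or_lt with rfl | ha'
      · obtain rfl : b = 1 := by linarith
        linarith
      · nlinarith [mul_neg_of_pos_of_neg ha' hx', mul_nonpos_of_nonneg_of_nonpos hb hy'.le]
  have hmem : ∀ t : ℝ, 0 < t → t < r → q + t • f.ν ∈ s := by
    intro t ht htr
    constructor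
    · change ‖q + t • f.ν - q‖ < r
      rwa [add_sub_cancel_left, norm_smul, f.norm_ν, mul_one, Real.norm_eq_abs, abs_of_pos ht]
    · change ‖f.Y (q + t • f.ν - q)‖ - f.H (q + t • f.ν - q) < 0
      rw [add_sub_cancel_left, map_smul, map_smul, f.Y_ν, f.H_ν, smul_zero]
      simpa using ht
  have hq : q ∈ closure s := by
    have hc : ContinuousAt (fun t : ℝ => q + t • f.ν) 0 := by fun_prop
    have hc' : Filter.Tendsto (fun t : ℝ => q + t • f.ν) (nhdsWithin 0 (Set.Ioi 0)) (nhds q) := by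
      have := hc.tendsto.mono_left (nhdsWithin_le_nhds (s := Set.Ioi (0 : ℝ)))
      simpa using this
    refine mem_closure_of_frequently_of_tendsto (Filter.Eventually.frequently ?_) hc'
    filter_upwards [Ioo_mem_nhdsGT h.pos] with t ht using hmem t ht.1 ht.2
  have hne : (interior s).Nonempty := by
    rw [hopen.interior_eq]
    exact ⟨_, hmem (r / 2) (half_pos h.pos) (half_lt_self h.pos)⟩
  exact (uniqueDiffWithinAt_convex hconv hne hq).mono (hsub.trans subset_closure)

/-- The graph agrees with its second order Taylor polynomial up to third order. -/
theorem GraphChart.norm_fderiv_sub_le (h : GraphChart Ω q f ρ r K) {y : E (n - 1)} (hy : ‖y‖ < r) :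
    ‖fderiv ℝ ρ y - fderiv ℝ ρ 0 - fderiv ℝ (fderiv ℝ ρ) 0 y‖ ≤ K * ‖y‖ * ‖y‖ := by
  have hK : 0 ≤ K := (norm_nonneg (fderiv ℝ (fderiv ℝ ρ) 0)).trans (h.second 0 (Metric.mem_ball_self h.pos))
  have hball : ∀ z ∈ Metric.closedBall (0 : E (n - 1)) ‖y‖, z ∈ Metric.ball (0 : E (n - 1)) r :=
    fun z hz => mem_ball_zero_iff.2 ((mem_closedBall_zero_iff.1 hz).trans_lt hy)
  have h1 := (convex_closedBall (0 : E (n - 1)) ‖y‖).norm_image_sub_le_of_norm_hasFDerivWithin_le'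
    (f := fderiv ℝ ρ) (f' := fderiv ℝ (fderiv ℝ ρ)) (φ := fderiv ℝ (fderiv ℝ ρ) 0)
    (C := K * ‖y‖) (x := 0) (y := y)
    (fun z hz => (((h.smooth z (hball z hz)).fderiv_right (m := 1) (by norm_num)).differentiableAt
      (by norm_num)).hasFDerivAt.hasFDerivWithinAt)
    (fun z hz => (h.second_lipschitz z (hball z hz)).trans
      (mul_le_mul_of_nonneg_left (mem_closedBall_zero_iff.1 hz) hK))
    (Metric.mem_closedBall_self (norm_nonneg y)) (mem_closedBall_zero_iff.2 le_rfl)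
  simpa using h1

theorem GraphChart.norm_fderiv_sub_le' (h : GraphChart Ω q f ρ r K) {y : E (n - 1)}
    (hy : ‖y‖ < r) : ‖fderiv ℝ ρ y - fderiv ℝ ρ 0‖ ≤ K * ‖y‖ := by
  have h1 := (convex_ball (0 : E (n - 1)) r).norm_image_sub_le_of_norm_hasFDerivWithin_le
    (f := fderiv ℝ ρ) (f' := fderiv ℝ (fderiv ℝ ρ))
    (fun z hz => (((h.smooth z hz).fderiv_right (m := 1) (by norm_num)).differentiableAt
      (by norm_num)).hasFDerivAt.hasFDerivWithinAt)
    h.second (Metric.mem_ball_self h.pos) (mem_ball_zero_iff.2 hy)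
  simpa using h1

end ChartGeometry

section UpToBoundary

variable {n : ℕ} {Ω : Set (E n)} {u : E n → ℝ} {x : E n}

/-- The gradient up to the boundary. -/
abbrev gradUp (Ω : Set (E n)) (u : E n → ℝ) : E n → E n →L[ℝ] ℝ := fderivWithin ℝ u (closure Ω)

/-- The second derivative up to the boundary. -/
abbrev hessUp (Ω : Set (E n)) (u : E n → ℝ) : E n → E n →L[ℝ] E n →L[ℝ] ℝ :=
  fderivWithin ℝ (gradUp Ω u) (closure Ω)

theorem closure_mem_nhds_of_mem (hopen : IsOpen Ω) (hx : x ∈ Ω) : closure Ω ∈ nhds x :=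
  Filter.mem_of_superset (hopen.mem_nhds hx) subset_closure

theorem gradUp_eq (hopen : IsOpen Ω) (hx : x ∈ Ω) : gradUp Ω u x = fderiv ℝ u x :=
  fderivWithin_of_mem_nhds (closure_mem_nhds_of_mem hopen hx)

theorem gradUp_eventuallyEq (hopen : IsOpen Ω) (hx : x ∈ Ω) : gradUp Ω u =ᶠ[nhds x] fderiv ℝ u := by
  filter_upwards [hopen.mem_nhds hx] with y hy using gradUp_eq hopen hy

theorem hessUp_eq (hopen : IsOpen Ω) (hx : x ∈ Ω) : hessUp Ω u x = D2 u x := by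
  rw [hessUp, fderivWithin_of_mem_nhds (closure_mem_nhds_of_mem hopen hx)]
  exact (gradUp_eventuallyEq hopen hx).fderiv_eq

theorem hasFDerivWithinAt_gradUp (hu : ContDiffOn ℝ 3 u (closure Ω)) (hx : x ∈ closure Ω) :
    HasFDerivWithinAt u (gradUp Ω u x) (closure Ω) x :=
  ((hu.differentiableOn (by norm_num)) x hx).hasFDerivWithinAt

theorem contDiffOn_gradUp (hud : UniqueDiffOn ℝ (closure Ω))
    (hu : ContDiffOn ℝ 3 u (closure Ω)) : ContDiffOn ℝ 2 (gradUp Ω u) (closure Ω) :=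
  hu.fderivWithin hud (by norm_num)

theorem hasFDerivWithinAt_hessUp (hud : UniqueDiffOn ℝ (closure Ω))
    (hu : ContDiffOn ℝ 3 u (closure Ω)) (hx : x ∈ closure Ω) :
    HasFDerivWithinAt (gradUp Ω u) (hessUp Ω u x) (closure Ω) x :=
  (((contDiffOn_gradUp hud hu).differentiableOn (by norm_num)) x hx).hasFDerivWithinAt

theorem continuousOn_hessUp (hud : UniqueDiffOn ℝ (closure Ω))
    (hu : ContDiffOn ℝ 3 u (closure Ω)) : ContinuousOn (hessUp Ω u) (closure Ω) :=
  (contDiffOn_gradUp hud hu).continuousOn_fderivWithin hud (by norm_num)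

theorem hessUp_symm (hopen : IsOpen Ω) (hud : UniqueDiffOn ℝ (closure Ω))
    (hu : ContDiffOn ℝ 3 u (closure Ω)) (hx : x ∈ closure Ω) (v w : E n) :
    hessUp Ω u x v w = hessUp Ω u x w v := by
  refine (hu x hx).isSymmSndFDerivWithinAt
    (by rw [minSmoothness_of_isRCLikeNormedField]; norm_num) hud ?_ hx v w
  exact closure_mono (interior_maximal subset_closure hopen) hx

theorem norm_gradUp_le {M₁ : ℝ} (hopen : IsOpen Ω) (hud : UniqueDiffOn ℝ (closure Ω))
    (hu : ContDiffOn ℝ 3 u (closure Ω)) (hM : ∀ x ∈ Ω, ‖fderiv ℝ u x‖ ≤ M₁)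
    (hx : x ∈ closure Ω) : ‖gradUp Ω u x‖ ≤ M₁ :=
  le_on_closure (f := fun x => ‖gradUp Ω u x‖) (g := fun _ => M₁)
    (fun y hy => by rw [gradUp_eq hopen hy]; exact hM y hy)
    (contDiffOn_gradUp hud hu).continuousOn.norm continuousOn_const hx

/-- The second derivative bounds the norm of the second iterated derivative. -/
theorem norm_iteratedFDerivWithin_two_le (hud : UniqueDiffOn ℝ (closure Ω)) (hx : x ∈ closure Ω) :
    ‖iteratedFDerivWithin ℝ 2 u (closure Ω) x‖ ≤ ‖hessUp Ω u x‖ := by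
  refine ContinuousMultilinearMap.opNorm_le_bound (norm_nonneg (hessUp Ω u x)) fun m => ?_
  rw [iteratedFDerivWithin_two_apply u hud hx, Fin.prod_univ_two, ← mul_assoc]
  exact (hessUp Ω u x).le_opNorm₂ _ _

end UpToBoundary

section BoundaryRelations

variable {n : ℕ} {Ω : Set (E n)} {q : E n} {f : Frame n} {ρ : E (n - 1) → ℝ} {r K : ℝ}
  {u : E n → ℝ}

/-- The tangential derivatives of a function that vanishes on the boundary. -/
theorem GraphChart.gradUp_tang (h : GraphChart Ω q f ρ r K) (hopen : IsOpen Ω)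
    (hu : ContDiffOn ℝ 3 u (closure Ω)) (hzero : ∀ x ∈ frontier Ω, u x = 0) {y : E (n - 1)}
    (hy : ‖y‖ < r / 2) (e : E (n - 1)) :
    gradUp Ω u (f.graphPoint ρ q y) (f.tang (fderiv ℝ ρ y) e) = 0 := by
  have hr := h.pos
  have hball : Metric.ball (0 : E (n - 1)) (r / 2) ∈ nhds y :=
    Metric.isOpen_ball.mem_nhds (mem_ball_zero_iff.2 hy)
  have h1 := (hasFDerivWithinAt_gradUp hu (h.graphPoint_mem_closure hy)).comp_hasFDerivAt y
    (f.hasFDerivAt_graphPoint ((h.smooth y (mem_ball_zero_iff.2 (by linarith))).differentiableAt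
      (by norm_num)))
    (Filter.mem_of_superset hball fun z hz => h.graphPoint_mem_closure (mem_ball_zero_iff.1 hz))
  have h2 : u ∘ f.graphPoint ρ q =ᶠ[nhds y] fun _ => 0 := by
    filter_upwards [hball] with z hz
    exact hzero _ (h.graphPoint_mem_frontier hopen (mem_ball_zero_iff.1 hz))
  have h3 := (h2.hasFDerivAt_iff.1 h1).unique (hasFDerivAt_const 0 y)
  exact congrArg (fun φ : E (n - 1) →L[ℝ] ℝ => φ e) h3

theorem GraphChart.graphPoint_zero (h : GraphChart Ω q f ρ r K) : f.graphPoint ρ q 0 = q := by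
  simp [Frame.graphPoint, h.value]

theorem GraphChart.gradUp_tang_zero (h : GraphChart Ω q f ρ r K) (hopen : IsOpen Ω)
    (hu : ContDiffOn ℝ 3 u (closure Ω)) (hzero : ∀ x ∈ frontier Ω, u x = 0) (e : E (n - 1)) :
    gradUp Ω u q (f.tang (fderiv ℝ ρ 0) e) = 0 := by
  have h1 := h.gradUp_tang hopen hu hzero (y := 0) (by simpa using half_pos h.pos) e
  rwa [h.graphPoint_zero] at h1

/-- The tangential second derivatives on the boundary, in terms of the normal derivative and the
second derivatives of the boundary graph. -/
theorem GraphChart.hessUp_tang_tang (h : GraphChart Ω q f ρ r K) (hopen : IsOpen Ω)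
    (hud : UniqueDiffOn ℝ (closure Ω)) (hu : ContDiffOn ℝ 3 u (closure Ω))
    (hzero : ∀ x ∈ frontier Ω, u x = 0) (hq : q ∈ closure Ω) (e e' : E (n - 1)) :
    hessUp Ω u q (f.tang (fderiv ℝ ρ 0) e') (f.tang (fderiv ℝ ρ 0) e) =
      -(fderiv ℝ (fderiv ℝ ρ) 0 e' e * gradUp Ω u q f.ν) := by
  have hr := h.pos
  have h0 : (0 : E (n - 1)) ∈ Metric.ball (0 : E (n - 1)) r := Metric.mem_ball_self h.pos
  have hball : Metric.ball (0 : E (n - 1)) (r / 2) ∈ nhds 0 :=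
    Metric.ball_mem_nhds 0 (half_pos hr)
  have hq' := h.graphPoint_zero
  have hgp := f.hasFDerivAt_graphPoint (q := q) ((h.smooth 0 h0).differentiableAt (by norm_num))
  have h1 := (hq'.symm ▸ hasFDerivWithinAt_hessUp hud hu hq :
    HasFDerivWithinAt (gradUp Ω u) (hessUp Ω u q) (closure Ω) (f.graphPoint ρ q 0)).comp_hasFDerivAt
      0 hgp
    (Filter.mem_of_superset hball fun z hz => h.graphPoint_mem_closure (mem_ball_zero_iff.1 hz))
  have h2 : HasFDerivAt (fderiv ℝ ρ) (fderiv ℝ (fderiv ℝ ρ) 0) 0 :=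
    (((h.smooth 0 h0).fderiv_right (m := 1) (by norm_num)).differentiableAt
      (by norm_num)).hasFDerivAt
  have h3 : HasFDerivAt (fun y => f.tang (fderiv ℝ ρ y) e)
      (((fderiv ℝ (fderiv ℝ ρ) 0).flip e).smulRight f.ν) 0 := by
    have h4 := ((h2.clm_apply (hasFDerivAt_const e 0)).smul_const f.ν).const_add (f.J e)
    refine h4.congr_fderiv ?_
    ext z
    simp
  have h5 := h1.clm_apply h3
  have h6 : (fun y => (gradUp Ω u ∘ f.graphPoint ρ q) y (f.tang (fderiv ℝ ρ y) e)) =ᶠ[nhds 0]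
      fun _ => 0 := by
    filter_upwards [hball] with z hz
    exact h.gradUp_tang hopen hu hzero (mem_ball_zero_iff.1 hz) e
  have h7 := (h6.hasFDerivAt_iff.1 h5).unique (hasFDerivAt_const 0 0)
  have h8 := congrArg (fun φ : E (n - 1) →L[ℝ] ℝ => φ e') h7
  simp [hq'] at h8
  linarith

/-- On the boundary the test function is of second order at the base point. -/
theorem GraphChart.testFn_le (h : GraphChart Ω q f ρ r K) (hopen : IsOpen Ω)
    (hu : ContDiffOn ℝ 3 u (closure Ω)) (hzero : ∀ x ∈ frontier Ω, u x = 0) {M₁ : ℝ} {x : E n}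
    (hx : x ∈ frontier Ω) (hxq : ‖x - q‖ < r / 2) (hM : ‖gradUp Ω u x‖ ≤ M₁) {e : E (n - 1)}
    (he : ‖e‖ ≤ 1) :
    f.testFn (fderiv ℝ ρ 0) (fderiv ℝ (fderiv ℝ ρ) 0) e q (gradUp Ω u) x ≤
      (M₁ * K + n * (M₁ * K) ^ 2) * ‖x - q‖ ^ 2 := by
  have hr := h.pos
  have hM₁ : 0 ≤ M₁ := (norm_nonneg _).trans hM
  have hK : 0 ≤ K := (norm_nonneg (fderiv ℝ (fderiv ℝ ρ) 0)).trans (h.second 0 (Metric.mem_ball_self h.pos))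
  set y := f.Y (x - q) with hy
  have hyx : ‖y‖ ≤ ‖x - q‖ := f.norm_Y (x - q)
  have hyr : ‖y‖ < r := by linarith
  have hgr : ρ y = f.H (x - q) := graph_eq_of_mem_frontier hopen
    (h.smooth y (mem_ball_zero_iff.2 hyr)).continuousAt h.region hx (by linarith)
  have hpt : f.graphPoint ρ q y = x := f.graphPoint_of_eq hgr
  have htan : ∀ e, gradUp Ω u x (f.tang (fderiv ℝ ρ y) e) = 0 := fun e => by
    have := h.gradUp_tang hopen hu hzero (y := y) (by linarith) e
    rwa [hpt] at this
  have hν : |gradUp Ω u x f.ν| ≤ M₁ := by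
    have := (gradUp Ω u x).le_opNorm f.ν
    rw [f.norm_ν, mul_one, Real.norm_eq_abs] at this
    exact this.trans hM
  have h1 : gradUp Ω u x (f.field (fderiv ℝ ρ 0) (fderiv ℝ (fderiv ℝ ρ) 0) e q x) =
      -((fderiv ℝ ρ y - fderiv ℝ ρ 0 - fderiv ℝ (fderiv ℝ ρ) 0 y) e * gradUp Ω u x f.ν) := by
    have h2 : f.field (fderiv ℝ ρ 0) (fderiv ℝ (fderiv ℝ ρ) 0) e q x =
        f.tang (fderiv ℝ ρ y) e -
          ((fderiv ℝ ρ y - fderiv ℝ ρ 0 - fderiv ℝ (fderiv ℝ ρ) 0 y) e) • f.ν := by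
      rw [Frame.field, f.turn_apply, f.tang_apply, f.tang_apply, ← hy, sub_apply, sub_apply,
        sub_smul, sub_smul]
      abel
    rw [h2, map_sub, htan, map_smul, smul_eq_mul, zero_sub]
  have h3 : gradUp Ω u x (f.field (fderiv ℝ ρ 0) (fderiv ℝ (fderiv ℝ ρ) 0) e q x) ≤
      M₁ * K * ‖x - q‖ ^ 2 := by
    rw [h1]
    refine (neg_le_abs _).trans ?_
    rw [abs_mul]
    have h4 := (fderiv ℝ ρ y - fderiv ℝ ρ 0 - fderiv ℝ (fderiv ℝ ρ) 0 y).le_opNorm e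
    rw [Real.norm_eq_abs] at h4
    have h5 := h.norm_fderiv_sub_le hyr
    calc _ ≤ (K * ‖y‖ * ‖y‖ * 1) * M₁ := by
          refine mul_le_mul (h4.trans ?_) hν (abs_nonneg _) (by positivity)
          exact mul_le_mul h5 he (norm_nonneg _) (by positivity)
      _ ≤ (K * ‖x - q‖ * ‖x - q‖ * 1) * M₁ := by gcongr
      _ = M₁ * K * ‖x - q‖ ^ 2 := by ring
  have h6 : ∀ β, |gradUp Ω u x (f.tangBasis (fderiv ℝ ρ 0) β)| ≤ M₁ * K * ‖x - q‖ := by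
    intro β
    have h7 : f.tangBasis (fderiv ℝ ρ 0) β = f.tang (fderiv ℝ ρ y) (EuclideanSpace.single β 1) -
        ((fderiv ℝ ρ y - fderiv ℝ ρ 0) (EuclideanSpace.single β 1)) • f.ν := by
      rw [Frame.tangBasis, f.tang_apply, f.tang_apply, sub_apply, sub_smul]
      abel
    rw [h7, map_sub, htan, map_smul, smul_eq_mul, zero_sub, abs_neg, abs_mul]
    have h8 := (fderiv ℝ ρ y - fderiv ℝ ρ 0).le_opNorm (EuclideanSpace.single β 1)
    rw [norm_single_one, mul_one, Real.norm_eq_abs] at h8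
    calc _ ≤ (K * ‖y‖) * M₁ :=
          mul_le_mul (h8.trans (h.norm_fderiv_sub_le' hyr)) hν (abs_nonneg _) (by positivity)
      _ ≤ (K * ‖x - q‖) * M₁ := by gcongr
      _ = M₁ * K * ‖x - q‖ := by ring
  have h9 : ∑ β, gradUp Ω u x (f.tangBasis (fderiv ℝ ρ 0) β) ^ 2 ≤
      n * (M₁ * K * ‖x - q‖) ^ 2 := by
    refine (le_abs_self _).trans ?_
    rw [← Real.norm_eq_abs]
    refine Frame.sum_norm_le (by positivity) fun β => ?_
    rw [norm_pow, Real.norm_eq_abs]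
    exact pow_le_pow_left₀ (abs_nonneg _) (h6 β) 2
  rw [Frame.testFn]
  linarith

end BoundaryRelations

/-! ### The mixed and the double normal derivatives -/

section BoundaryEstimate

variable {n : ℕ}

/-- The choice of the constants of the barrier: a small radius `δ` makes the term `- 2 b N c`, with
`N = 1 / (4 δ)`, dominate the contribution of the curvature of the boundary, which is linear in `b`;
then `a` is fixed by the boundary values and `b` by the required supersolution property. -/
theorem exists_barrier_constants (n : ℕ) {c C K r A X Cb Λ : ℝ} (hc : 0 < c) (hC : 0 ≤ C)
    (hK : 0 ≤ K) (hr : 0 < r) (hA : 0 < A) (hX : 0 ≤ X) (hCb : 0 ≤ Cb) (hΛ : 0 ≤ Λ) :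
    ∃ δ a b N : ℝ, 0 < δ ∧ δ ≤ 1 ∧ δ ≤ r / 4 ∧ 0 ≤ a ∧ 0 ≤ b ∧ 0 ≤ N ∧ N * (2 * δ) ≤ 1 ∧
      X * Cb ≤ a ∧ X ≤ A * (a * δ ^ 2) ∧ n * n * (C * (2 * a + b * K)) - 2 * b * N * c ≤ -Λ := by
  set m := n * n * C * K + 1 with hm
  have hm0 : 0 < m := by positivity
  set δ := min (min 1 (r / 4)) (c / (4 * m)) with hδ
  have hδ0 : 0 < δ := lt_min (lt_min one_pos (by positivity)) (by positivity)
  have hδ1 : δ ≤ 1 := (min_le_left _ _).trans (min_le_left _ _)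
  have hδr : δ ≤ r / 4 := (min_le_left _ _).trans (min_le_right _ _)
  have hδm : m ≤ c / (4 * δ) := by
    have h : δ ≤ c / (4 * m) := min_le_right _ _
    rw [le_div_iff₀ (by positivity)] at h ⊢
    linarith
  set a := (X * Cb + X / A) / δ ^ 2 with ha
  have ha0 : 0 ≤ a := by positivity
  have haδ : a * δ ^ 2 = X * Cb + X / A := by rw [ha]; field_simp
  set b := 4 * δ / c * (n * n * (C * (2 * a)) + Λ) with hb
  have hb0 : 0 ≤ b := by positivity
  refine ⟨δ, a, b, 1 / (4 * δ), hδ0, hδ1, hδr, ha0, hb0, by positivity, ?_, ?_, ?_, ?_⟩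
  · field_simp
    norm_num
  · have h1 : δ ^ 2 ≤ 1 := pow_le_one₀ hδ0.le hδ1
    have h2 := mul_le_mul_of_nonneg_left h1 ha0
    have h3 : 0 ≤ X / A := by positivity
    linarith
  · rw [haδ, mul_add, mul_div_cancel₀ _ hA.ne']
    have : 0 ≤ A * (X * Cb) := by positivity
    linarith
  · have h1 : b * (c / (4 * δ)) = n * n * (C * (2 * a)) + Λ := by rw [hb]; field_simp
    have h2 := mul_le_mul_of_nonneg_left hδm hb0
    have h3 : 2 * b * (1 / (4 * δ)) * c = 2 * (b * (c / (4 * δ))) := by field_simp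
    rw [h3]
    have h4 : b * m = n * n * (C * (b * K)) + b := by rw [hm]; ring
    linarith

/-- A consequence of `exp z - 1 ≤ z exp z`. -/
theorem exp_le_one_add_mul {z B : ℝ} (hB : 0 ≤ z → z ≤ B) {t : ℝ} (ht : z ≤ t) (h0 : 0 ≤ t) :
    Real.exp z ≤ 1 + t * Real.exp B := by
  rcases le_total z 0 with hz | hz
  · have h1 : Real.exp z ≤ 1 := Real.exp_le_one_iff.2 hz
    have h2 := mul_nonneg h0 (Real.exp_pos B).le
    linarith
  · have h1 : 1 - z ≤ Real.exp (-z) := by linarith [Real.add_one_le_exp (-z)]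
    have h2 := mul_le_mul_of_nonneg_right h1 (Real.exp_pos z).le
    rw [← Real.exp_add, neg_add_cancel, Real.exp_zero] at h2
    have h3 : z * Real.exp z ≤ t * Real.exp B :=
      mul_le_mul ht (Real.exp_le_exp.2 (hB hz)) (Real.exp_pos z).le h0
    linarith

/-- A one-sided derivative is nonnegative at a minimum at the left end of an interval. -/
theorem deriv_nonneg_of_right {φ : ℝ → ℝ} {φ' δ : ℝ} (hδ : 0 < δ)
    (h : HasDerivWithinAt φ φ' (Set.Ico 0 δ) 0) (hφ : ∀ s ∈ Set.Ioo 0 δ, φ 0 ≤ φ s) : 0 ≤ φ' := by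
  have h1 := (hasDerivWithinAt_iff_tendsto_slope' (s := Set.Ioo 0 δ) (by simp)).1
    (h.mono Set.Ioo_subset_Ico_self)
  have hne : (nhdsWithin (0 : ℝ) (Set.Ioo 0 δ)).NeBot := by
    rw [nhdsWithin_Ioo_eq_nhdsGT hδ]
    infer_instance
  refine ge_of_tendsto h1 ?_
  filter_upwards [self_mem_nhdsWithin] with s hs
  rw [slope_def_field, sub_zero]
  exact div_nonneg (sub_nonneg.2 (hφ s hs)) hs.1.le

/-- The estimate for the mixed second derivatives on the boundary, by comparison of an exponential
of the test function with the barrier. -/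
theorem exists_mixed_bound (hn : 1 ≤ n) {c C M₁ K r : ℝ} (hc : 0 < c) (hC : 0 ≤ C) (hM₁ : 0 ≤ M₁)
    (hK : 0 ≤ K) (hr : 0 < r) :
    ∃ b : ℝ, 0 ≤ b ∧ ∀ (Ω : Set (E n)) (f : Frame n) (ρ : E (n - 1) → ℝ) (q : E n) (u : E n → ℝ)
      (e : E (n - 1)), IsOpen Ω → Bornology.IsBounded Ω → UniqueDiffOn ℝ (closure Ω) →
      GraphChart Ω q f ρ r K → q ∈ frontier Ω → ContDiffOn ℝ 3 u (closure Ω) →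
      (∀ x ∈ Ω, HasLinearization c C u x) → (∀ x ∈ Ω, ‖fderiv ℝ u x‖ ≤ M₁) →
      (∀ x ∈ frontier Ω, u x = 0) → ‖e‖ ≤ 1 →
      hessUp Ω u q (f.tang (fderiv ℝ ρ 0) e) f.ν ≤ b := by
  obtain ⟨A, C₂, hA, hC₂, htest⟩ := exists_test_constants hn hc hC hM₁ hK
  set Q₀ := M₁ * (2 + K) + n * (2 * M₁) ^ 2 with hQ₀
  set X := Real.exp (A * Q₀) with hX
  have hX0 : 0 < X := Real.exp_pos _
  set Cb := M₁ * K + n * (M₁ * K) ^ 2 with hCb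
  have hCb0 : 0 ≤ Cb := by positivity
  set Λ := C₂ * X + 1 with hΛ
  obtain ⟨δ, a, b, N, hδ, hδ1, hδr, ha, hb, hN, hNδ, haX, hAX, hsuper⟩ :=
    exists_barrier_constants n hc hC hK hr hA hX0.le hCb0 (by positivity : 0 ≤ Λ)
  refine ⟨b, hb, fun Ω f ρ q u e hopen hbdd hud hch hq hu hlin hM hzero he => ?_⟩
  set g := fderiv ℝ ρ 0 with hg
  set S := fderiv ℝ (fderiv ℝ ρ) 0 with hS
  have h0ball : (0 : E (n - 1)) ∈ Metric.ball (0 : E (n - 1)) r := Metric.mem_ball_self hr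
  have hg1 : ‖g‖ ≤ 1 := hch.slope 0 h0ball
  have hS1 : ‖S‖ ≤ K := hch.second 0 h0ball
  set Q := f.testFn g S e q (gradUp Ω u) with hQdef
  set v := f.barrier ρ q a b N with hvdef
  set U := Ω ∩ Metric.ball q δ with hU
  have hUopen : IsOpen U := hopen.inter Metric.isOpen_ball
  have hclU : closure U ⊆ closure Ω := closure_mono Set.inter_subset_left
  have hclU' : ∀ x ∈ closure U, ‖x - q‖ ≤ δ := fun x hx => by
    have := closure_mono (Set.inter_subset_right (s := Ω) (t := Metric.ball q δ)) hx
    rw [← dist_eq_norm]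
    exact Metric.closure_ball_subset_closedBall this
  have hqΩ : q ∈ closure Ω := frontier_subset_closure hq
  have hgrad : ∀ x ∈ closure Ω, ‖gradUp Ω u x‖ ≤ M₁ := fun x hx =>
    norm_gradUp_le hopen hud hu hM hx
  have hYball : ∀ x ∈ closure U, f.Y (x - q) ∈ Metric.ball (0 : E (n - 1)) r := fun x hx => by
    rw [mem_ball_zero_iff]
    have h1 := f.norm_Y (x - q)
    have h2 := hclU' x hx
    linarith
  have hρ : ∀ x ∈ closure U, ContDiffAt ℝ 2 ρ (f.Y (x - q)) := fun x hx =>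
    hch.smooth _ (hYball x hx)
  have hQ' : ∀ x ∈ closure Ω, HasFDerivWithinAt Q (f.testGrad g S e q (gradUp Ω u) (hessUp Ω u) x)
      (closure Ω) x := fun x hx =>
    f.hasFDerivWithinAt_testFn g S e q (hasFDerivWithinAt_hessUp hud hu hx)
      (hessUp_symm hopen hud hu hx)
  have hQabs : ∀ x ∈ closure U, |Q x| ≤ Q₀ := fun x hx =>
    f.abs_testFn_le hg1 hS1 he ((hclU' x hx).trans hδ1) (hgrad x (hclU hx))
  have hv' : ∀ x ∈ closure U, HasFDerivAt v (f.barrierGrad ρ q a b N x) x := fun x hx =>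
    f.hasFDerivAt_barrier a b N ((hρ x hx).differentiableAt (by norm_num))
  -- Above the boundary graph the barrier is at least its quadratic part, since `N d ≤ 1`.
  have hvge : ∀ x ∈ closure U, 0 ≤ f.graphHeight ρ q x → a * ‖x - q‖ ^ 2 ≤ v x := by
    intro x hx hd
    have h1 := hclU' x hx
    have h2 := hch.graphHeight_le (x := x) (by linarith)
    have h3 : N * f.graphHeight ρ q x ≤ 1 :=
      (mul_le_mul_of_nonneg_left (by linarith) hN).trans hNδ
    have h4 : 0 ≤ b * (f.graphHeight ρ q x * (1 - N * f.graphHeight ρ q x)) :=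
      mul_nonneg hb (mul_nonneg hd (by linarith))
    rw [hvdef, Frame.barrier]
    nlinarith
  have hdΩ : ∀ x ∈ Ω, ‖x - q‖ ≤ δ → 0 ≤ f.graphHeight ρ q x := by
    intro x hx hxq
    have := (hch.region x (by linarith)).1 hx
    rw [Frame.graphHeight]
    linarith
  have hcu : ∀ x ∈ Ω, ContDiffAt ℝ 3 u x := fun x hx =>
    hu.contDiffAt (closure_mem_nhds_of_mem hopen hx)
  have hcomp : ∀ x ∈ closure U, Real.exp (A * Q x) ≤ 1 + A * v x := by
    have hBv := fun x (hx : x ∈ U) =>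
      f.hasFDerivAt_barrierGrad a b N (hρ x (subset_closure hx))
    have hBQ := fun x (hx : x ∈ U) => f.hasFDerivAt_testGrad g S e q (D := fderiv ℝ u) (B := D2 u)
      (hasFDerivAt_fderiv (hcu x hx.1)) (hasFDerivAt_D2 (hcu x hx.1))
    choose! BV hBV hBV' using hBv
    choose! BQ hBQ hBQ' using hBQ
    refine exp_le_of_boundary (c := c) (C := C) (C₂ := C₂) (Q₀ := Q₀) (Λ := Λ)
      (DQ := f.testGrad g S e q (fderiv ℝ u) (D2 u)) (Dv := f.barrierGrad ρ q a b N)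
      (BQ := BQ) (Bv := BV) hc.le hA hC₂ (lt_add_one _)
      hUopen (hbdd.subset Set.inter_subset_left)
      (fun x hx => ((hQ' x (hclU hx)).continuousWithinAt).mono hclU)
      (fun x hx => (hv' x hx).continuousAt.continuousWithinAt) ?_
      (fun x hx => hv' x (subset_closure hx)) hBQ hBV
      (fun x hx => (le_abs_self _).trans (hQabs x (subset_closure hx))) ?_ ?_
    · intro x hx
      have h1 := f.hasFDerivAt_testFn g S e q (D := fderiv ℝ u) (B := D2 u)
        (hasFDerivAt_fderiv (hcu x hx.1)) (D2_symm (hcu x hx.1))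
      refine h1.congr_of_eventuallyEq ?_
      filter_upwards [gradUp_eventuallyEq (u := u) hopen hx.1] with y hy
      rw [hQdef, Frame.testFn, Frame.testFn, hy]
    · intro x hx
      have hxδ := hclU' x (subset_closure hx)
      obtain ⟨L, hL, hL'⟩ := htest f g S e q x u (BQ x) hg1 hS1 he (hxδ.trans hδ1) (hcu x hx.1)
        (hM x hx.1) (hlin x hx.1) (hBQ' x hx)
      refine ⟨L, hL, hL', ?_⟩
      have hd := hdΩ x hx.1 hxδ
      have h2 := hch.graphHeight_le (x := x) (by linarith)
      exact (contractMat_barrier_le f a b N hc.le ha hb hN hL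
        (hch.second _ (hYball x (subset_closure hx))) (mul_nonneg hN hd)
        ((mul_le_mul_of_nonneg_left (by linarith) hN).trans hNδ) (hBV' x hx)).trans hsuper
    · intro x hx hxU
      have hxδ := hclU' x hx
      by_cases hxΩ : x ∈ Ω
      -- On the sphere of radius `δ` the quadratic part of the barrier dominates.
      · have hxball : x ∉ Metric.ball q δ := fun h => hxU ⟨hxΩ, h⟩
        have hxδ' : ‖x - q‖ = δ :=
          le_antisymm hxδ (by rw [Metric.mem_ball, dist_eq_norm, not_lt] at hxball; exact hxball)
        have h1 := hvge x hx (hdΩ x hxΩ hxδ)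
        rw [hxδ'] at h1
        have h2 : Real.exp (A * Q x) ≤ X := Real.exp_le_exp.2
          (mul_le_mul_of_nonneg_left ((le_abs_self _).trans (hQabs x hx)) hA.le)
        have h3 := mul_le_mul_of_nonneg_left h1 hA.le
        linarith
      -- On the boundary of `Ω` the test function is of second order at `q`.
      · have hxf : x ∈ frontier Ω := by
          rw [hopen.frontier_eq]
          exact ⟨hclU hx, hxΩ⟩
        have hQx : Q x ≤ Cb * ‖x - q‖ ^ 2 := hch.testFn_le hopen hu hzero hxf (by linarith)
          (hgrad x (hclU hx)) he
        have hd0 : f.graphHeight ρ q x = 0 := by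
          rw [Frame.graphHeight, graph_eq_of_mem_frontier hopen (hρ x hx).continuousAt hch.region
            hxf (by linarith), sub_self]
        have h1 := hvge x hx hd0.ge
        have h2 := exp_le_one_add_mul (z := A * Q x) (B := A * Q₀) (t := A * (Cb * ‖x - q‖ ^ 2))
          (fun _ => mul_le_mul_of_nonneg_left ((le_abs_self _).trans (hQabs x hx)) hA.le)
          (mul_le_mul_of_nonneg_left hQx hA.le) (by positivity)
        have h3 := mul_le_mul_of_nonneg_right haX (sq_nonneg ‖x - q‖)
        have h4 := mul_le_mul_of_nonneg_left (h3.trans h1) hA.le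
        rw [← hX] at h2
        linarith
  -- Both functions vanish at `q`, so their normal derivatives are ordered
  have hτ : ∀ e, gradUp Ω u q (f.tang g e) = 0 := hch.gradUp_tang_zero hopen hu hzero
  have hDQν : f.testGrad g S e q (gradUp Ω u) (hessUp Ω u) q f.ν =
      hessUp Ω u q (f.tang g e) f.ν := by
    have h1 : f.testDir g S e q (gradUp Ω u) q = f.tang g e := by
      simp [Frame.testDir, Frame.field, Frame.tangBasis, hτ]
    rw [Frame.testGrad, h1]
    simp [f.turn_apply, f.Y_ν]
  have hQq : Q q = 0 := by
    simp [hQdef, Frame.testFn, Frame.field, Frame.tangBasis, hτ]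
  have hhq : f.graphHeight ρ q q = 0 := by simp [Frame.graphHeight, hch.value]
  have hvq : v q = 0 := by simp [hvdef, Frame.barrier, hhq]
  have hDvν : f.barrierGrad ρ q a b N q f.ν = b := by
    simp [Frame.barrierGrad, Frame.graphHeightGrad, hhq, f.Y_ν, f.H_ν]
  have hray : HasDerivWithinAt (fun s : ℝ => q + s • f.ν) f.ν (Set.Ico 0 δ) 0 := by
    have h1 := ((hasDerivAt_id (0 : ℝ)).smul_const f.ν).const_add q
    simpa using h1.hasDerivWithinAt
  have hmem : ∀ s ∈ Set.Ioo 0 δ, q + s • f.ν ∈ U := by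
    intro s hs
    refine ⟨hch.normal_mem hs.1 (by linarith [hs.2]), ?_⟩
    rw [Metric.mem_ball, dist_eq_norm, add_sub_cancel_left, norm_smul, f.norm_ν, mul_one,
      Real.norm_eq_abs, abs_of_pos hs.1]
    exact hs.2
  have hmaps : Set.MapsTo (fun s : ℝ => q + s • f.ν) (Set.Ico 0 δ) (closure Ω) := by
    intro s hs
    rcases hs.1.eq_or_lt with rfl | hs0
    · simpa using hqΩ
    · exact subset_closure (hmem s ⟨hs0, hs.2⟩).1
  have hq0 : q + (0 : ℝ) • f.ν = q := by rw [zero_smul, add_zero]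
  have hqU : q ∈ closure U := by
    refine mem_closure_of_frequently_of_tendsto (f := fun s : ℝ => q + s • f.ν)
      (b := nhdsWithin 0 (Set.Ioi 0)) (Filter.Eventually.frequently ?_) ?_
    · filter_upwards [Ioo_mem_nhdsGT hδ] with s hs using hmem s hs
    · have hc0 : ContinuousAt (fun s : ℝ => q + s • f.ν) 0 := by fun_prop
      have := hc0.tendsto.mono_left (nhdsWithin_le_nhds (s := Set.Ioi (0 : ℝ)))
      rwa [hq0] at this
  have hd1 : HasDerivWithinAt (fun s : ℝ => Q (q + s • f.ν))
      (f.testGrad g S e q (gradUp Ω u) (hessUp Ω u) q f.ν) (Set.Ico 0 δ) 0 :=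
    HasFDerivWithinAt.comp_hasDerivWithinAt (l := Q) (f := fun s : ℝ => q + s • f.ν) 0 (by rw [hq0]; exact hQ' q hqΩ) hray hmaps
  have hd2 : HasDerivWithinAt (fun s : ℝ => v (q + s • f.ν))
      (f.barrierGrad ρ q a b N q f.ν) (Set.Ico 0 δ) 0 :=
    HasFDerivAt.comp_hasDerivWithinAt (l := v) (f := fun s : ℝ => q + s • f.ν) 0 (by rw [hq0]; exact hv' q hqU) hray
  have hd3 := deriv_nonneg_of_right hδ (hd2.sub hd1) fun s hs => by
    have h1 := hcomp _ (subset_closure (hmem s hs))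
    have h2 := Real.add_one_le_exp (A * Q (q + s • f.ν))
    have h3 : Q (q + s • f.ν) ≤ v (q + s • f.ν) :=
      le_of_mul_le_mul_left (by linarith) hA
    simp only [Pi.sub_apply, hq0, hQq, hvq]
    linarith
  rw [hDQν, hDvν] at hd3
  linarith

/-- The bound for the full second derivative at a boundary point. -/
theorem exists_boundary_bound (hn : 1 ≤ n) {c C M₁ K r : ℝ} (hc : 0 < c) (hC : 0 ≤ C)
    (hM₁ : 0 ≤ M₁) (hK : 0 ≤ K) (hr : 0 < r) :
    ∃ B : ℝ, 0 ≤ B ∧ ∀ (Ω : Set (E n)) (f : Frame n) (ρ : E (n - 1) → ℝ) (q : E n) (u : E n → ℝ),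
      IsOpen Ω → Bornology.IsBounded Ω → UniqueDiffOn ℝ (closure Ω) →
      GraphChart Ω q f ρ r K → q ∈ frontier Ω → ContDiffOn ℝ 3 u (closure Ω) →
      (∀ x ∈ Ω, HasLinearization c C u x) → (∀ x ∈ Ω, ‖fderiv ℝ u x‖ ≤ M₁) →
      (∀ x ∈ frontier Ω, u x = 0) → ‖hessUp Ω u q‖ ≤ B := by
  obtain ⟨b, hb, hmix⟩ := exists_mixed_bound hn hc hC hM₁ hK hr
  set Cg := 4 * C / c + 3 + 12 * n * n * C / c with hCg
  have hCg0 : 0 ≤ Cg := by positivity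
  refine ⟨Cg * (1 + n * (M₁ * K + 2 * b)), by positivity, ?_⟩
  intro Ω f ρ q u hopen hbdd hud hch hq hu hlin hM hzero
  have hqΩ : q ∈ closure Ω := frontier_subset_closure hq
  have h0ball : (0 : E (n - 1)) ∈ Metric.ball (0 : E (n - 1)) r := Metric.mem_ball_self hr
  set g := fderiv ℝ ρ 0 with hg
  have hg1 : ‖g‖ ≤ 1 := hch.slope 0 h0ball
  have hcu : ∀ x ∈ Ω, ContDiffAt ℝ 3 u x := fun x hx =>
    hu.contDiffAt (closure_mem_nhds_of_mem hopen hx)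
  have hcont := continuousOn_hessUp hud hu
  have hcontn : ContinuousOn (fun x => ‖hessUp Ω u x‖) (closure Ω) :=
    ContinuousOn.norm (E := E n →L[ℝ] E n →L[ℝ] ℝ) hcont
  have hgrow : ‖hessUp Ω u q‖ ≤ Cg * (1 + ∑ β, ‖hessUp Ω u q (f.tangBasis g β)‖) := by
    refine le_on_closure (f := fun x => ‖hessUp Ω u x‖)
      (g := fun x => Cg * (1 + ∑ β, ‖hessUp Ω u x (f.tangBasis g β)‖)) ?_ hcontn ?_ hqΩ
    · intro x hx
      obtain ⟨L, L', hL, hL', h1, h2, -⟩ := hlin x hx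
      simp only [hessUp_eq hopen hx]
      exact norm_le_of_elliptic hc hC f hg1 hL hL' (D2_symm (hcu x hx)) h1 h2
    · refine continuousOn_const.mul (continuousOn_const.add (continuousOn_finsetSum _ fun β _ => ?_))
      exact (hcont.clm_apply continuousOn_const).norm
  have hνn : |gradUp Ω u q f.ν| ≤ M₁ := by
    have := (gradUp Ω u q).le_opNorm f.ν
    rw [f.norm_ν, mul_one, Real.norm_eq_abs] at this
    exact this.trans (norm_gradUp_le hopen hud hu hM hqΩ)
  have hτ : ∀ β, ‖hessUp Ω u q (f.tangBasis g β)‖ ≤ M₁ * K + 2 * b := by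
    intro β
    refine ContinuousLinearMap.opNorm_le_bound _ (by positivity) fun z => ?_
    set e : E (n - 1) := EuclideanSpace.single β 1 with he
    have he1 : ‖e‖ = 1 := norm_single_one β
    have h1 : |hessUp Ω u q (f.tang g e) (f.tang g (f.Y z))| ≤ M₁ * K * ‖z‖ := by
      rw [hch.hessUp_tang_tang hopen hud hu hzero hqΩ, abs_neg, abs_mul]
      have h2 := (fderiv ℝ (fderiv ℝ ρ) 0).le_opNorm₂ e (f.Y z)
      rw [he1, mul_one, Real.norm_eq_abs] at h2
      have h3 : ‖fderiv ℝ (fderiv ℝ ρ) 0‖ * ‖f.Y z‖ ≤ K * ‖z‖ :=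
        mul_le_mul (hch.second 0 h0ball) (f.norm_Y z) (norm_nonneg _) hK
      calc _ ≤ (K * ‖z‖) * M₁ := mul_le_mul (h2.trans h3) hνn (abs_nonneg _) (by positivity)
        _ = M₁ * K * ‖z‖ := by ring
    have h4 : |hessUp Ω u q (f.tang g e) f.ν| ≤ b := by
      have h5 := hmix Ω f ρ q u e hopen hbdd hud hch hq hu hlin hM hzero he1.le
      have h6 := hmix Ω f ρ q u (-e) hopen hbdd hud hch hq hu hlin hM hzero (by rw [norm_neg, he1])
      rw [map_neg, map_neg, neg_apply] at h6
      exact abs_le.2 ⟨by linarith, h5⟩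
    conv_lhs => rw [f.tang_add_height g z]
    rw [Frame.tangBasis, ← he, map_add, map_smul, smul_eq_mul, Real.norm_eq_abs]
    refine (abs_add_le _ _).trans ?_
    rw [abs_mul]
    have h7 := mul_le_mul (f.abs_height_le hg1 z) h4 (abs_nonneg _) (by positivity)
    linarith
  refine hgrow.trans (mul_le_mul_of_nonneg_left ?_ hCg0)
  have h8 := Frame.sum_norm_le (φ := fun β => ‖hessUp Ω u q (f.tangBasis g β)‖)
    (b := M₁ * K + 2 * b) (by positivity) fun β => by rw [norm_norm]; exact hτ β
  rw [Real.norm_eq_abs] at h8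
  linarith [le_abs_self (∑ β, ‖hessUp Ω u q (f.tangBasis g β)‖)]

end BoundaryEstimate

end HessianQuotient

end

theorem theorem5p2 (n k l : ℕ) (hk : 2 ≤ k) (hlk : l < k) (hkn : k < n)
    (Ω : Set (HessianQuotient.E n)) (hopen : IsOpen Ω) (hconn : IsConnected Ω)
    (hbdd : Bornology.IsBounded Ω) (hC21 : HessianQuotient.HasC21Boundary Ω)
    (hconv : HessianQuotient.UniformlyConvex k Ω) (M₁ M₂ : ℝ) :
    ∃ C : ℝ, 0 < C ∧
      ∀ (ψ : HessianQuotient.E n → ℝ → HessianQuotient.E (n + 1) → ℝ)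
        (u : HessianQuotient.E n → ℝ),
        (∀ x ∈ closure Ω, ∀ z : ℝ, ∀ ν : HessianQuotient.E (n + 1), ‖ν‖ = 1 → 0 ≤ ψ x z ν) →
        HessianQuotient.IsC1Data Ω (HessianQuotient.rootData (k - l) ψ) →
        HessianQuotient.C1DataBound Ω M₁ M₂ (HessianQuotient.rootData (k - l) ψ) →
        ContDiffOn ℝ 3 u (closure Ω) →
        HessianQuotient.Admissible k Ω u →
        HessianQuotient.SolvesDirichlet k l Ω ψ u →
        HessianQuotient.C1Bound Ω M₁ u →
        ∀ x ∈ frontier Ω, ‖iteratedFDerivWithin ℝ 2 u (closure Ω) x‖ ≤ C := by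
  have hn : 1 ≤ n := by omega
  obtain ⟨r, K, hr, hK, hcharts⟩ := hC21.exists_uniform_charts hopen hbdd
  obtain ⟨c, C, hc, hC, hlin⟩ := HessianQuotient.exists_uniform_linearization (n := n)
    (by omega : 1 ≤ k) hlk hkn M₁ M₂
  obtain ⟨B, hB, hbound⟩ := HessianQuotient.exists_boundary_bound hn hc hC (abs_nonneg M₁) hK hr
  have hud : UniqueDiffOn ℝ (closure Ω) := by
    intro x hx
    by_cases hxΩ : x ∈ Ω
    · exact (hopen.uniqueDiffWithinAt hxΩ).mono subset_closure
    · obtain ⟨f, ρ, hch⟩ := hcharts x (by rw [hopen.frontier_eq]; exact ⟨hx, hxΩ⟩)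
      exact hch.uniqueDiffWithinAt
  refine ⟨B + 1, by linarith, fun ψ u _ hψ hψb hu hadm hsol hb x hx => ?_⟩
  obtain ⟨f, ρ, hch⟩ := hcharts x hx
  have hcu : ∀ y ∈ Ω, ContDiffAt ℝ 3 u y := fun y hy =>
    hu.contDiffAt (HessianQuotient.closure_mem_nhds_of_mem hopen hy)
  have h1 := hbound Ω f ρ x u hopen hbdd hud hch hx hu
    (hlin Ω ψ u hopen hψ hψb hcu hadm hsol.1 hb)
    (fun y hy => ((hb y hy).2).trans (le_abs_self M₁)) hsol.2
  have h2 := HessianQuotient.norm_iteratedFDerivWithin_two_le (u := u) hud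
    (frontier_subset_closure hx)
  linarith
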